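/- **Proposition 5.3.** Let $G=\mathbb Z/r_1\mathbb Z\times\dots\times\mathbb Z/r_n\mathbb Z$ be non-trivial with $r_j\mid r_{j+1}$, let $q$ be a prime power with $q\equiv 1 \pmod{r_n}$, and for each $m\mid r_n$ let $\chi_m$ be a multiplicative character of $\mathbb F_q$ of exact order $m$, extended by $\chi_m(0)=0$. *Notation.* Let $\mathcal R'=\prod_j\{0,\dots,r_j-1\}$ and $\mathcal R=\mathcal R'\setminus\{0\}$. For $s=(s_1,\dots,s_n)$ with $s_j\mid r_j$ put $\ell(s)=\operatorname{lcm}(s_1,\dots,s_n)$ and $\Omega_s=\{\omega: 1\le\omega_j\le s_j,\ (\omega_j,s_j)=1\}$; below, $(s,\omega)$ runs over all pairs with $s_j\mid r_j$, $\omega\in\Omega_s$. For $\beta\in\mathcal R'$ let $$A_\beta=\Big\{(s,\omega):\ \sum_j \tfrac{\ell(s)}{s_j}\omega_j\beta_j\equiv 0 \bmod \ell(s)\Big\},\qquad e(\beta)=\operatorname*{lcm}_j\frac{r_j}{(r_j,\beta_j)},$$ and write $\beta\sim\beta'$ if $A_\beta=A_{\beta'}$, with classes $[\beta]$; $e(\beta)$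 depends only on $[\beta]$. For non-negative integers $d(\alpha)$, $\alpha\in\mathcal R$, let $\mathcal F_{d(\alpha)}$ be the set of tuples $(f_\alpha)_{\alpha\in\mathcal R}$ of monic, squarefree, pairwise coprime polynomials in $\mathbb F_q[X]$ with $\deg f_\alpha=d(\alpha)$. For $\beta\in\mathcal R$ let $\mathcal F^\beta_{d(\alpha)}$ be defined in the same way, with $\deg f_\beta=d(\beta)-1$ instead of $\deg f_\beta=d(\beta)$, and let $\mathcal F_{[d(\alpha)]}=\mathcal F_{d(\alpha)}\cup\bigcup_{\beta\in\mathcal R}\mathcal F_{d(\alpha)}^\beta$. For $c\in(\mathbb F_q^*)^n$ and a tuple $(f_\alpha)$ let $$F_{(s)}^{(\omega)}=c_{(s)}^{(\omega)}\prod_{\alpha\in\mathcal R} f_\alpha^{\,\sum_j\frac{\ell(s)}{s_j}\omega_j\alpha_j \bmod \ell(s)},\qquad c_{(s)}^{(\omega)}=\prod_j c_j^{\,\frac{\ell(s)}{s_j}\omega_j \bmod \ell(s)},$$ exponents being least non-negative residues; at the point at infinity put $F_{(s)}^{(\omega)}(\infty)=c_{(s)}^{(\omega)}$ if $\sum_j\frac{\ell(s)}{s_j}\omega_j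 d_j\equiv0\bmod\ell(s)$ and $0$ otherwise, where $d_j=\sum_\alpha\alpha_j\deg f_\alpha$. For $(f_\alpha)\in\mathcal F_{d(\alpha)}$ without specified $c$, all $c_j=1$. A family $(\epsilon_{s,\omega})$ is *admissible* if there are $c\in(\mathbb F_q^*)^n$, $(f_\alpha)\in\mathcal F_{[d(\alpha)]}$ and $x\in\mathbb P^1(\mathbb F_q)$ with $\epsilon_{s,\omega}=\chi_{\ell(s)}(F_{(s)}^{(\omega)}(x))$ for all $(s,\omega)$; it is *$[\beta]$-admissible* if moreover $\epsilon_{s,\omega}=0$ exactly when $(s,\omega)\notin A_\beta$. *Statement.* Let $0\le\ell\le q$, let $x_1,\dots,x_\ell\in\mathbb F_q$ be distinct, let $(\epsilon_{s,\omega,i})_{s,\omega}$ be admissible for each $1\le i\le\ell$, and let $m_{[\beta]}$ be the number of $i\le \ell$ for which it is $[\beta]$-admissible. Then $$\#\big\{(f_\alpha)\in\mathcal F_{d(\alpha)}:\ \chi_{\ell(s)}\big(F_{(s)}^{(\omega)}(x_i)\big)=\epsilon_{s,\omega,i}\ \text{ for all } (s,\omega) \text{ and } 1\le i\le\ell\big\}$$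 $$=\frac{L_{|G|-2}\,q^{\sum_\alpha d(\alpha)}}{\zeta_q(2)^{|G|-1}}\prod_{[\beta]\ne[0]}\left(\frac{\phi\big(e(\beta)^2\big)}{|G|(q+|G|-1)}\right)^{m_{[\beta]}}\left(\frac{q}{|G|(q+|G|-1)}\right)^{m_{[0]}}\Big(1+O\big(q^{-\min_\alpha d(\alpha)/2}\big)\Big),$$ where $\phi$ is Euler's function, $\zeta_q(t)=\sum_{f\ \mathrm{monic}}|f|^{-t}$ is the zeta function of $\mathbb F_q[X]$ with $|f|=q^{\deg f}$, $$L_m=\prod_{j=1}^{m}\prod_P\Big(1-\frac{j}{(|P|+1)(|P|+j)}\Big)$$ with $P$ running over the monic irreducible polynomials in $\mathbb F_q[X]$, and the implied constant depends only on $q$ and $(r_1,\dots,r_n)$. -/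

import Mathlib

open Polynomial Finset

namespace AbelianCovers

noncomputable section

/-! ### Index sets attached to the group `ℤ/r₁ × ⋯ × ℤ/rₙ` -/

section Indices

variable {n : ℕ} (r : Fin n → ℕ)

/-- The order `|G| = r₁ ⋯ rₙ` of `G = ℤ/r₁ × ⋯ × ℤ/rₙ`. -/
def groupOrder : ℕ := ∏ j, r j

/-- All integer vectors `(β₁, …, βₙ)` with `0 ≤ βⱼ ≤ rⱼ - 1`. -/
abbrev RFull : Type := (j : Fin n) → Fin (r j)

/-- The vectors of `RFull r` other than `(0, …, 0)`. -/
abbrev RNonzero : Type := {α : RFull r // ∃ j, (α j : ℕ) ≠ 0}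

/-- The vector `(0, …, 0)`. -/
def zeroVec (hr : ∀ j, 0 < r j) : RFull r := fun j => ⟨0, hr j⟩

/-- The vectors `s = (s₁, …, sₙ)` with `sⱼ ∣ rⱼ`. -/
def divisorVecs : Finset (Fin n → ℕ) := Fintype.piFinset fun j => (r j).divisors

/-- `ℓ(s) = lcm(s₁, …, sₙ)`. -/
def ell (s : Fin n → ℕ) : ℕ := univ.lcm s

/-- The vectors `ω` with `1 ≤ ωⱼ ≤ sⱼ` and `gcd(ωⱼ, sⱼ) = 1`. -/
def Omega (s : Fin n → ℕ) : Finset (Fin n → ℕ) :=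
  Fintype.piFinset fun j => (Finset.Icc 1 (s j)).filter fun w => Nat.Coprime w (s j)

/-- The type of pairs `(s, ω)` with `sⱼ ∣ rⱼ` and `ω ∈ Omega s`. -/
abbrev PairIndex : Type :=
  {p : (_ : Fin n → ℕ) × (Fin n → ℕ) // p ∈ (divisorVecs r).sigma Omega}

variable {r}

/-- The component `s` of a pair `(s, ω)`. -/
abbrev PairIndex.s (p : PairIndex r) : Fin n → ℕ := p.1.1

/-- The component `ω` of a pair `(s, ω)`. -/
abbrev PairIndex.w (p : PairIndex r) : Fin n → ℕ := p.1.2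

/-- The integer `∑ⱼ (ℓ(s) / sⱼ) ωⱼ vⱼ`. -/
def pairing (p : PairIndex r) (v : Fin n → ℕ) : ℕ :=
  ∑ j, ell p.s / p.s j * p.w j * v j

/-- `A_β`: the pairs `(s, ω)` with `∑ⱼ (ℓ(s) / sⱼ) ωⱼ βⱼ ≡ 0 mod ℓ(s)`. -/
def zeroSumPairs (β : RFull r) : Finset (PairIndex r) :=
  univ.filter fun p => pairing p (fun j => (β j : ℕ)) ≡ 0 [MOD ell p.s]

/-- `e(β) = lcmⱼ (rⱼ / gcd(rⱼ, βⱼ))`. -/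
def ramIndex (β : RFull r) : ℕ := univ.lcm fun j => r j / Nat.gcd (r j) (β j)

variable (r)

/-- `β ∼ β'` if and only if `A_β = A_β'`. -/
instance relSetoid : Setoid (RFull r) where
  r β γ := zeroSumPairs β = zeroSumPairs γ
  iseqv := ⟨fun _ => rfl, fun h => h.symm, fun h k => h.trans k⟩

instance relDecidable : DecidableRel ((· ≈ ·) : RFull r → RFull r → Prop) :=
  fun β γ => inferInstanceAs (Decidable (zeroSumPairs β = zeroSumPairs γ))

/-- The set of classes `[β]`. -/
abbrev RClass : Type := Quotient (relSetoid r)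

variable {r}

/-- Whether a divisor `t` of `rⱼ` divides `βⱼ` can be read off from `A_β`. -/
theorem dvd_iff_of_rel {β γ : RFull r} (h : zeroSumPairs β = zeroSumPairs γ)
    (hr : ∀ j, 0 < r j) (j : Fin n) {t : ℕ} (ht : t ∣ r j) :
    t ∣ (β j : ℕ) ↔ t ∣ (γ j : ℕ) := by
  have htp : 0 < t := Nat.pos_of_dvd_of_pos ht (hr j)
  let s : Fin n → ℕ := Function.update (fun _ => 1) j t
  have hsj : s j = t := Function.update_self ..
  have hsi : ∀ i, i ≠ j → s i = 1 := fun i hi => Function.update_of_ne hi ..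
  have hl : ell s = t := by
    apply Nat.dvd_antisymm
    · apply Finset.lcm_dvd
      intro i _
      by_cases hi : i = j
      · subst hi; rw [hsj]
      · rw [hsi i hi]; exact one_dvd _
    · have := Finset.dvd_lcm (f := s) (mem_univ j)
      rwa [hsj] at this
  have hmem : (⟨s, fun _ => 1⟩ : (_ : Fin n → ℕ) × (Fin n → ℕ)) ∈
      (divisorVecs r).sigma Omega := by
    simp only [Finset.mem_sigma, divisorVecs, Omega, Fintype.mem_piFinset, Nat.mem_divisors,
      Finset.mem_filter, Finset.mem_Icc]
    refine ⟨fun i => ⟨?_, (hr i).ne'⟩, fun i => ⟨⟨le_rfl, ?_⟩, Nat.coprime_one_left _⟩⟩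
    · by_cases hi : i = j
      · subst hi; rw [hsj]; exact ht
      · rw [hsi i hi]; exact one_dvd _
    · by_cases hi : i = j
      · subst hi; rw [hsj]; exact htp
      · rw [hsi i hi]
  have key : ∀ δ : RFull r, (⟨_, hmem⟩ : PairIndex r) ∈ zeroSumPairs δ ↔ t ∣ (δ j : ℕ) := by
    intro δ
    simp only [zeroSumPairs, Finset.mem_filter, mem_univ, true_and, pairing, Nat.modEq_zero_iff_dvd]
    rw [hl, ← Finset.add_sum_erase _ _ (mem_univ j)]
    change t ∣ t / s j * 1 * (δ j : ℕ) + ∑ i ∈ univ.erase j, t / s i * 1 * (δ i : ℕ) ↔ _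
    rw [hsj, Nat.div_self htp, Nat.dvd_add_left]
    · simp
    · apply Finset.dvd_sum
      intro i hi
      rw [hsi i (Finset.ne_of_mem_erase hi)]
      simp
  rw [← key β, ← key γ, h]

theorem ramIndex_eq_of_rel {β γ : RFull r} (h : β ≈ γ) : ramIndex β = ramIndex γ := by
  have hr : ∀ j, 0 < r j := fun j => Nat.lt_of_le_of_lt (Nat.zero_le _) (β j).isLt
  have hg : ∀ j, Nat.gcd (r j) (β j) = Nat.gcd (r j) (γ j) := fun j =>
    Nat.dvd_antisymm
      (Nat.dvd_gcd (Nat.gcd_dvd_left _ _)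
        ((dvd_iff_of_rel h hr j (Nat.gcd_dvd_left _ _)).1 (Nat.gcd_dvd_right _ _)))
      (Nat.dvd_gcd (Nat.gcd_dvd_left _ _)
        ((dvd_iff_of_rel h hr j (Nat.gcd_dvd_left _ _)).2 (Nat.gcd_dvd_right _ _)))
  simp only [ramIndex, hg]

/-- The common value of `e` on a class. -/
def classRamIndex (b : RClass r) : ℕ :=
  Quotient.lift ramIndex (fun _ _ h => ramIndex_eq_of_rel h) b

end Indices

/-! ### Tuples of polynomials and their values -/

section Tuples

variable {F : Type*} [Field F] {n : ℕ} {r : Fin n → ℕ}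

/-- Tuples `(f_α)` of monic, squarefree, pairwise coprime polynomials. -/
def IsGoodTuple (f : RNonzero r → F[X]) : Prop :=
  (∀ α, (f α).Monic ∧ Squarefree (f α)) ∧ ∀ α γ, α ≠ γ → IsCoprime (f α) (f γ)

/-- The set `𝓕_d` of such tuples with `deg f_α = d α` for all `α`. -/
def tuples (F : Type*) [Field F] (d : RNonzero r → ℕ) : Set (RNonzero r → F[X]) :=
  {f | IsGoodTuple f ∧ ∀ α, (f α).natDegree = d α}

/-- The set `𝓕_d^β` of such tuples with `deg f_β = d β - 1` (in particular `d β ≥ 1`) and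
`deg f_α = d α` for `α ≠ β`. -/
def tuplesDrop (F : Type*) [Field F] (d : RNonzero r → ℕ) (β : RNonzero r) :
    Set (RNonzero r → F[X]) :=
  {f | IsGoodTuple f ∧ (f β).natDegree + 1 = d β ∧ ∀ α, α ≠ β → (f α).natDegree = d α}

/-- The union `𝓕_[d]` of `𝓕_d` and all the `𝓕_d^β`. -/
def tuplesAll (F : Type*) [Field F] (d : RNonzero r → ℕ) : Set (RNonzero r → F[X]) :=
  tuples F d ∪ ⋃ β, tuplesDrop F d β

/-- `c_(s)^(ω) = ∏ⱼ cⱼ ^ ((ℓ(s) / sⱼ) ωⱼ mod ℓ(s))`. -/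
def twistCoeff (c : Fin n → Fˣ) (p : PairIndex r) : F :=
  ∏ j, (c j : F) ^ ((ell p.s / p.s j * p.w j) % ell p.s)

/-- `F_(s)^(ω) = c_(s)^(ω) ∏_α f_α ^ (∑ⱼ (ℓ(s) / sⱼ) ωⱼ αⱼ mod ℓ(s))`. -/
def twistPoly (c : Fin n → Fˣ) (f : RNonzero r → F[X]) (p : PairIndex r) : F[X] :=
  C (twistCoeff c p) * ∏ α : RNonzero r, f α ^ (pairing p (fun j => (α.1 j : ℕ)) % ell p.s)

/-- `dⱼ = ∑_α αⱼ deg f_α`. -/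
def totalDegree (f : RNonzero r → F[X]) (j : Fin n) : ℕ :=
  ∑ α : RNonzero r, (α.1 j : ℕ) * (f α).natDegree

/-- The value of `F_(s)^(ω)` at a point of `ℙ¹(F)`, where `none` is the point at infinity; there
the value is `c_(s)^(ω)` if `∑ⱼ (ℓ(s) / sⱼ) ωⱼ dⱼ ≡ 0 mod ℓ(s)`, and `0` otherwise. -/
def twistValue (c : Fin n → Fˣ) (f : RNonzero r → F[X]) (p : PairIndex r) : Option F → F
  | some x => (twistPoly c f p).eval x
  | none => if pairing p (totalDegree f) ≡ 0 [MOD ell p.s] then twistCoeff c p else 0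

/-- The prescription `ε` is admissible: it is the family of values `χ_ℓ(s) (F_(s)^(ω) (x))` for
some leading coefficients `c`, some tuple in `𝓕_[d]` and some point `x ∈ ℙ¹(F)`. -/
def IsAdmissible (χ : ℕ → MulChar F ℂ) (d : RNonzero r → ℕ) (ε : PairIndex r → ℂ) : Prop :=
  ∃ c : Fin n → Fˣ, ∃ f ∈ tuplesAll F d, ∃ x : Option F,
    ∀ p : PairIndex r, ε p = χ (ell p.s) (twistValue c f p x)

/-- `ε` is `[β]`-admissible: it is admissible and vanishes exactly outside `A_β`. -/
def IsClassAdmissible (χ : ℕ → MulChar F ℂ) (d : RNonzero r → ℕ) (ε : PairIndex r → ℂ)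
    (b : RClass r) : Prop :=
  IsAdmissible χ d ε ∧
    ∀ p : PairIndex r, ε p = 0 ↔
      p ∉ Quotient.lift (zeroSumPairs (r := r)) (fun _ _ h => h) b

/-- `m_[β]`: the number of indices `i` for which `ε i` is `[β]`-admissible. -/
def classCount (χ : ℕ → MulChar F ℂ) (d : RNonzero r → ℕ) {k : ℕ}
    (ε : Fin k → PairIndex r → ℂ) (b : RClass r) : ℕ :=
  Set.ncard {i : Fin k | IsClassAdmissible χ d (ε i) b}

/-- The tuples of `𝓕_d` (with all leading coefficients `cⱼ = 1`) that take the prescribed values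
`χ_ℓ(s) (F_(s)^(ω) (x i)) = ε i (s, ω)` at the points `x i`. -/
def valueSet (χ : ℕ → MulChar F ℂ) (d : RNonzero r → ℕ) {k : ℕ} (x : Fin k → F)
    (ε : Fin k → PairIndex r → ℂ) : Set (RNonzero r → F[X]) :=
  {f | f ∈ tuples F d ∧
    ∀ i, ∀ p : PairIndex r, χ (ell p.s) ((twistPoly 1 f p).eval (x i)) = ε i p}

end Tuples

/-! ### The constants -/

section Constants

variable (F : Type*) [Field F] [Fintype F]

/-- The norm `|f| = q ^ deg f` of a nonzero polynomial. -/
def polyNorm {F : Type*} [Field F] [Fintype F] (f : F[X]) : ℝ :=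
  (Fintype.card F : ℝ) ^ f.natDegree

/-- The zeta function of `F[X]`: the sum of `|f| ^ (-t)` over the monic polynomials. -/
def zetaPoly (t : ℝ) : ℝ := ∑' f : {f : F[X] // f.Monic}, polyNorm f.1 ^ (-t)

/-- The Euler factor `1 - j / ((|P| + 1) (|P| + j))`. -/
def eulerFactor {F : Type*} [Field F] [Fintype F] (j : ℕ) (P : F[X]) : ℝ :=
  1 - (j : ℝ) / ((polyNorm P + 1) * (polyNorm P + j))

/-- `L_m`: the product over `1 ≤ j ≤ m` and over the monic irreducible polynomials `P` of the
Euler factors. -/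
def eulerL (m : ℕ) : ℝ :=
  ∏ j ∈ Finset.Icc 1 m, ∏' P : {P : F[X] // P.Monic ∧ Irreducible P}, eulerFactor j P.1

/-- The series that defines `zetaPoly F t` converges for `t > 1`. -/
theorem summable_zetaPoly {t : ℝ} (ht : 1 < t) :
    Summable fun f : {f : F[X] // f.Monic} => polyNorm f.1 ^ (-t) := by
  have hq : (1 : ℝ) < Fintype.card F := by exact_mod_cast Fintype.one_lt_card
  let g : {f : F[X] // f.Monic} → ℕ := fun f => f.1.natDegree
  let φ : (m : ℕ) → {f // g f = m} → (Fin m → F) := fun m f i => f.1.1.coeff i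
  have hφ : ∀ m, Function.Injective (φ m) := by
    rintro m ⟨⟨f, hf⟩, hfm⟩ ⟨⟨h, hh⟩, hhm⟩ he
    simp only [Subtype.mk.injEq]
    ext i
    change f.natDegree = m at hfm
    change h.natDegree = m at hhm
    rcases lt_trichotomy i m with hi | hi | hi
    · exact congrFun he ⟨i, hi⟩
    · have h1 : f.coeff i = 1 := by rw [hi, ← hfm]; exact hf
      have h2 : h.coeff i = 1 := by rw [hi, ← hhm]; exact hh
      rw [h1, h2]
    · rw [coeff_eq_zero_of_natDegree_lt (by omega), coeff_eq_zero_of_natDegree_lt (by omega)]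
  have hfin : ∀ m, Finite {f // g f = m} := fun m => Finite.of_injective _ (hφ m)
  have hcard : ∀ m, (Nat.card {f // g f = m} : ℝ) ≤ (Fintype.card F : ℝ) ^ m := by
    intro m
    have := Nat.card_le_card_of_injective _ (hφ m)
    simp only [Nat.card_eq_fintype_card, Fintype.card_pi, prod_const, card_univ,
      Fintype.card_fin] at this
    exact_mod_cast this
  rw [← (Equiv.sigmaFiberEquiv g).summable_iff]
  rw [summable_sigma_of_nonneg (fun _ => by
    simp only [Function.comp, polyNorm]; positivity)]
  refine ⟨fun m => Summable.of_finite, ?_⟩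
  have hval : ∀ m (f : {f // g f = m}),
      ((fun f : {f : F[X] // f.Monic} => polyNorm f.1 ^ (-t)) ∘ (Equiv.sigmaFiberEquiv g)) ⟨m, f⟩
        = ((Fintype.card F : ℝ) ^ (-t)) ^ m := by
    rintro m ⟨f, rfl⟩
    simp only [Function.comp, Equiv.sigmaFiberEquiv, Equiv.coe_fn_mk, polyNorm, g]
    rw [← Real.rpow_natCast, ← Real.rpow_natCast, ← Real.rpow_mul (by positivity),
      ← Real.rpow_mul (by positivity), mul_comm]
  simp only [hval, tsum_const, nsmul_eq_mul]
  have hr : (Fintype.card F : ℝ) * (Fintype.card F : ℝ) ^ (-t) < 1 := by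
    have h0 : (0 : ℝ) < Fintype.card F := by linarith
    rw [← Real.rpow_one_add' h0.le (by linarith)]
    exact Real.rpow_lt_one_of_one_lt_of_neg hq (by linarith)
  refine Summable.of_nonneg_of_le (fun m => by positivity) (fun m => ?_)
    (summable_geometric_of_lt_one (by positivity) hr)
  rw [mul_pow]
  exact mul_le_mul_of_nonneg_right (hcard m) (by positivity)

/-- The products that define `eulerL` converge. -/
theorem multipliable_eulerFactor (j : ℕ) :
    Multipliable fun P : {P : F[X] // P.Monic ∧ Irreducible P} => eulerFactor j P.1 := by
  have hs : Summable fun P : {P : F[X] // P.Monic ∧ Irreducible P} =>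
      polyNorm P.1 ^ (-(2 : ℝ)) :=
    (summable_zetaPoly F one_lt_two).comp_injective
      (i := fun P : {P : F[X] // P.Monic ∧ Irreducible P} =>
        (⟨P.1, P.2.1⟩ : {f : F[X] // f.Monic}))
      (fun P Q h => Subtype.ext (by simpa using h))
  have hpos : ∀ f : F[X], 0 < polyNorm f := fun f => by
    have : (0 : ℝ) < Fintype.card F := by exact_mod_cast Fintype.card_pos
    simp only [polyNorm]; positivity
  have h2 : Summable fun P : {P : F[X] // P.Monic ∧ Irreducible P} =>
      -((j : ℝ) / ((polyNorm P.1 + 1) * (polyNorm P.1 + j))) := by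
    apply Summable.neg
    refine Summable.of_nonneg_of_le (fun P => ?_) (fun P => ?_) (hs.mul_left (j : ℝ))
    · have := hpos P.1; positivity
    · have := hpos P.1
      rw [div_eq_mul_inv, Real.rpow_neg this.le]
      gcongr
      norm_cast
      rw [sq]
      gcongr
      · linarith
      · have : (0 : ℝ) ≤ j := Nat.cast_nonneg j
        linarith
  have := multipliable_one_add_of_summable h2.norm
  simpa only [eulerFactor, sub_eq_add_neg] using this

/-- The main term. -/
def mainTerm {F : Type*} [Field F] [Fintype F] {n : ℕ} {r : Fin n → ℕ} (hr : ∀ j, 0 < r j)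
    (χ : ℕ → MulChar F ℂ) (d : RNonzero r → ℕ) {k : ℕ} (ε : Fin k → PairIndex r → ℂ) : ℝ :=
  eulerL F (groupOrder r - 2) * (Fintype.card F : ℝ) ^ (∑ α, d α)
      / zetaPoly F 2 ^ (groupOrder r - 1)
    * (∏ b ∈ (univ : Finset (RClass r)).erase (Quotient.mk _ (zeroVec r hr)),
        ((Nat.totient (classRamIndex b ^ 2) : ℝ)
          / (groupOrder r * (Fintype.card F + groupOrder r - 1))) ^ classCount χ d ε b)
    * ((Fintype.card F : ℝ) / (groupOrder r * (Fintype.card F + groupOrder r - 1)))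
        ^ classCount χ d ε (Quotient.mk _ (zeroVec r hr))

end Constants

end

end AbelianCovers

open AbelianCovers

/-! A tuple of monic polynomials is squarefree and pairwise coprime exactly when, at every monic
irreducible `P`, no entry is divisible by `P ^ 2` and at most one entry is divisible by `P`. The
prescribed values are extra conditions at the linear primes `X - C (x i)`. So the count is a sieve
problem with conditions modulo `P ^ 2`, and its main term is `q ^ ∑ d` times the product of the
local densities.

Error term. The degrees are raised one at a time. Fix the other entries, with product `h`; the
remaining entry must avoid `P` if `P ∣ h` and `P ^ 2` otherwise. In the inclusion-exclusion for this
entry, the passage from degree `D` to `D + 1` leaves the density for each modulus of small degree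
exactly unchanged. Each remaining sieve modulus of degree at most `D + 1` contributes at most `q ^
(-D)`, and there are `O(q ^ (D / 2))` of them times the sum of `|E| ^ (-1/2)` over `E ∣ h`, which is
bounded on average over `h`. Hence each increment of the density is `O(q ^ (-D / 2))`, and the
increments sum geometrically (`abs_card_sieve_sub_le`, `card_powerset_filter_le`, `sum_divSum_le`).
The limit only has to be identified without a rate in the degrees: for huge degrees the Chinese
remainder theorem and a crude tail bound give the product of local densities
(`abs_sieveDensity_sub_prod_le`, `abs_sieveDensity_sub_limit_le`).

Main term. With `m = |G| - 1`, a prime of norm `Q` has density `(1 - 1/Q) ^ m * (1 + m/Q)`, which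
splits into the Euler factors of `L` and of `ζ(2)⁻¹` (`goodDensity_eq_prod`). A condition at a point
changes its factor by a ratio of weights. To find this ratio, regard the pairs `(s, ω)` as the
characters of `G`. Then `A_β` is the annihilator of `β`, and `[β]` consists of the `φ(e(β))`
generators of the cyclic group `⟨β⟩` (`zeroSumPairs_eq_iff`). By discrete logarithms, nonzero values
`a` give the element `∑ log(a_α) α` of `G`; if `a_γ = 0`, only its coset modulo `⟨γ⟩` is visible. An
admissible prescription therefore amounts to a class and a coset (`charValue_eq_iff`). Unit tuples
are equidistributed over `G`, so each `γ` in the class takes the share `e(β) / |G|`, and `e φ(e) =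
φ(e ^ 2)` yields the stated factor (`valueWeight_charValue`). -/

namespace AbelianCovers

noncomputable section

/-! ### Monic polynomials in residue classes -/

section Counting

open scoped Classical

/-- The polynomials of degree less than `n`. -/
def lowDeg (F : Type*) [Field F] [Fintype F] (n : ℕ) : Finset F[X] :=
  univ.image fun a : Fin n → F => ((degreeLTEquiv F n).symm a : F[X])

/-- The monic polynomials of degree `d`. -/
def monics (F : Type*) [Field F] [Fintype F] (d : ℕ) : Finset F[X] :=
  (lowDeg F d).image fun p => X ^ d + p

theorem isCoprime_of_monic_irreducible {F : Type*} [Field F] {P Q : F[X]} (hP : P.Monic) (hQ : Q.Monic)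
    (hPi : Irreducible P) (hQi : Irreducible Q) (h : P ≠ Q) : IsCoprime P Q := by
  rw [hPi.coprime_iff_not_dvd]
  intro hd
  exact h (eq_of_monic_of_associated hP hQ (hPi.associated_of_dvd hQi hd))

variable {F : Type*} [Field F] [Fintype F]

theorem mem_lowDeg {n : ℕ} {p : F[X]} : p ∈ lowDeg F n ↔ p.degree < n := by
  simp only [lowDeg, mem_image, mem_univ, true_and]
  constructor
  · rintro ⟨a, rfl⟩
    exact mem_degreeLT.1 ((degreeLTEquiv F n).symm a).2
  · intro h
    exact ⟨degreeLTEquiv F n ⟨p, mem_degreeLT.2 h⟩, by simp⟩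

theorem card_lowDeg (n : ℕ) : (lowDeg F n).card = Fintype.card F ^ n := by
  have : Function.Injective fun a : Fin n → F => ((degreeLTEquiv F n).symm a : F[X]) :=
    Subtype.val_injective.comp (degreeLTEquiv F n).symm.injective
  rw [lowDeg, Finset.card_image_of_injective _ this]
  simp

theorem mem_monics {d : ℕ} {p : F[X]} : p ∈ monics F d ↔ p.Monic ∧ p.natDegree = d := by
  simp only [monics, mem_image, mem_lowDeg]
  constructor
  · rintro ⟨a, ha, rfl⟩
    refine ⟨monic_X_pow_add ha, ?_⟩
    rw [natDegree_add_eq_left_of_degree_lt (by rwa [degree_X_pow]), natDegree_X_pow]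
  · rintro ⟨hp, rfl⟩
    refine ⟨p - X ^ p.natDegree, ?_, by ring⟩
    have h := degree_sub_lt_left (p := p) (q := X ^ p.natDegree)
      (by rw [degree_X_pow, degree_eq_natDegree hp.ne_zero]) hp.ne_zero (by simp [hp.leadingCoeff])
    rwa [degree_eq_natDegree hp.ne_zero] at h

theorem card_monics (d : ℕ) : (monics F d).card = Fintype.card F ^ d := by
  rw [monics, Finset.card_image_of_injective _ (add_right_injective _), card_lowDeg]

theorem monics_zero : monics F 0 = {1} := by
  ext p
  rw [mem_monics, mem_singleton]
  refine ⟨fun h => h.1.natDegree_eq_zero.1 h.2, ?_⟩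
  rintro rfl
  simp

/-- Division by `M` writes a solution as `M * g + R %ₘ M` with `g` monic of degree `d - deg M`, and
`g` is arbitrary. The count is exact, with no error term, as soon as `deg M ≤ d`. -/
theorem card_monics_congr {M : F[X]} (hM : M.Monic) (R : F[X]) {d : ℕ} (hd : M.natDegree ≤ d) :
    ((monics F d).filter fun f => M ∣ f - R).card = Fintype.card F ^ (d - M.natDegree) := by
  rw [← card_monics (F := F)]
  symm
  have hR : (R %ₘ M).degree < M.degree := degree_modByMonic_lt _ hM
  have hlt : ∀ g ∈ monics F (d - M.natDegree), (R %ₘ M).degree < (M * g).degree := by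
    intro g hg
    rw [mem_monics] at hg
    rw [degree_mul, degree_eq_natDegree hg.1.ne_zero]
    exact hR.trans_le (le_add_of_nonneg_right (by exact_mod_cast Nat.zero_le _))
  refine Finset.card_bij (fun g _ => M * g + R %ₘ M) ?_ ?_ ?_
  · intro g hg
    have h1 := hlt g hg
    rw [mem_monics] at hg
    rw [mem_filter, mem_monics]
    refine ⟨⟨(hM.mul hg.1).add_of_left h1, ?_⟩, ?_⟩
    · rw [natDegree_add_eq_left_of_degree_lt h1, hM.natDegree_mul hg.1, hg.2]
      omega
    · have h2 := modByMonic_add_div R M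
      have : M * g + R %ₘ M - R = M * (g - R /ₘ M) := by linear_combination h2
      rw [this]
      exact dvd_mul_right _ _
  · intro a _ b _ h
    exact mul_left_cancel₀ hM.ne_zero (add_right_cancel h)
  · intro f hf
    rw [mem_filter, mem_monics] at hf
    obtain ⟨⟨hf1, hf2⟩, hf3⟩ := hf
    have h2 := modByMonic_add_div R M
    have : M ∣ f - R %ₘ M := by
      have : f - R %ₘ M = (f - R) + M * (R /ₘ M) := by linear_combination -h2
      rw [this]
      exact dvd_add hf3 (dvd_mul_right _ _)
    obtain ⟨g, hg⟩ := this
    have hfg : f = M * g + R %ₘ M := by linear_combination hg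
    have hdeg : (R %ₘ M).degree < f.degree := by
      refine hR.trans_le ?_
      rw [degree_eq_natDegree hM.ne_zero, degree_eq_natDegree hf1.ne_zero, hf2]
      exact_mod_cast hd
    have hmg : (M * g).Monic := by
      rw [← hg, sub_eq_add_neg]
      exact hf1.add_of_left (by rwa [degree_neg])
    have hgm : g.Monic := hM.of_mul_monic_left hmg
    refine ⟨g, ?_, hfg.symm⟩
    rw [mem_monics]
    refine ⟨hgm, ?_⟩
    have h3 : (M * g).natDegree = d := by
      rw [← hg, sub_eq_add_neg, natDegree_add_eq_left_of_degree_lt (by rwa [degree_neg]), hf2]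
    rw [hM.natDegree_mul hgm] at h3
    omega

theorem card_monics_congr_le_one {M : F[X]} (R : F[X]) {d : ℕ} (hd : d < M.natDegree) :
    ((monics F d).filter fun f => M ∣ f - R).card ≤ 1 := by
  rw [Finset.card_le_one]
  intro a ha b hb
  rw [mem_filter, mem_monics] at ha hb
  have h : M ∣ a - b := by
    have := dvd_sub ha.2 hb.2
    rwa [sub_sub_sub_cancel_right] at this
  by_contra hne
  have h1 := natDegree_le_of_dvd h (sub_ne_zero.2 hne)
  have h2 := natDegree_sub_le a b
  rw [ha.1.2, hb.1.2, max_self] at h2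
  omega

theorem card_monics_dvd_le {M : F[X]} (hM : M.Monic) (d : ℕ) :
    (((monics F d).filter fun f => M ∣ f).card : ℝ) ≤
      (Fintype.card F : ℝ) ^ d / (Fintype.card F : ℝ) ^ M.natDegree := by
  have hq : (0 : ℝ) < Fintype.card F := by exact_mod_cast Fintype.card_pos
  rcases le_or_gt M.natDegree d with h | h
  · have := card_monics_congr hM 0 h
    simp only [sub_zero] at this
    rw [this, Nat.cast_pow, pow_sub₀ _ hq.ne' h, div_eq_mul_inv]
  · rw [Finset.card_eq_zero.2]
    · simp only [Nat.cast_zero]; positivity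
    · refine Finset.filter_eq_empty_iff.2 fun f hf hd => ?_
      rw [mem_monics] at hf
      have := natDegree_le_of_dvd hd hf.1.ne_zero
      omega

/-- The monic irreducible polynomials of degree `n`. -/
def primesOf (F : Type*) [Field F] [Fintype F] (n : ℕ) : Finset F[X] :=
  (monics F n).filter Irreducible

theorem mem_primesOf {n : ℕ} {P : F[X]} :
    P ∈ primesOf F n ↔ P.Monic ∧ P.natDegree = n ∧ Irreducible P := by
  rw [primesOf, mem_filter, mem_monics, and_assoc]

theorem card_primesOf_le (n : ℕ) : (primesOf F n).card ≤ Fintype.card F ^ n := by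
  rw [primesOf, ← card_monics (F := F)]
  exact card_filter_le _ _

/-- The monic irreducible polynomials of degree between `a` and `b`. -/
def primesIn (F : Type*) [Field F] [Fintype F] (a b : ℕ) : Finset F[X] :=
  (Finset.Icc a b).biUnion (primesOf F)

theorem mem_primesIn {a b : ℕ} {P : F[X]} :
    P ∈ primesIn F a b ↔ P.Monic ∧ Irreducible P ∧ a ≤ P.natDegree ∧ P.natDegree ≤ b := by
  simp only [primesIn, mem_biUnion, mem_Icc, mem_primesOf]
  constructor
  · rintro ⟨n, h1, h2, rfl, h3⟩
    exact ⟨h2, h3, h1⟩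
  · rintro ⟨h1, h2, h3⟩
    exact ⟨_, h3, h1, rfl, h2⟩

end Counting

/-! ### Chinese remainder theorem -/

section Congruences

theorem exists_congr_of_isCoprime {R : Type*} [CommRing R] {M N : R} (h : IsCoprime M N)
    (a b : R) : ∃ c, ∀ g, (M ∣ g - a ∧ N ∣ g - b) ↔ M * N ∣ g - c := by
  obtain ⟨u, v, huv⟩ := h
  have hMc : M ∣ a - (a * (v * N) + b * (u * M)) :=
    ⟨a * u - b * u, by linear_combination (-a) * huv⟩
  have hNc : N ∣ b - (a * (v * N) + b * (u * M)) :=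
    ⟨b * v - a * v, by linear_combination (-b) * huv⟩
  refine ⟨a * (v * N) + b * (u * M), fun g => ⟨fun ⟨h1, h2⟩ => ?_, fun h0 => ⟨?_, ?_⟩⟩⟩
  · refine IsCoprime.mul_dvd ⟨u, v, huv⟩ ?_ ?_
    · simpa using dvd_add h1 hMc
    · simpa using dvd_add h2 hNc
  · simpa using dvd_sub ((dvd_mul_right M N).trans h0) hMc
  · simpa using dvd_sub ((dvd_mul_left N M).trans h0) hNc

end Congruences

/-! ### The sieve in one variable -/

section OneVariable

open scoped Classical

/-- Inclusion-exclusion over the moduli `μ P`. -/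
theorem card_sieve_eq {F : Type*} [Field F] {s : Finset F[X]} {T : Finset F[X]} {μ : F[X] → F[X]}
    (hμ : (T : Set F[X]).Pairwise (Function.onFun IsCoprime μ)) :
    ((s.filter fun g => ∀ P ∈ T, ¬ μ P ∣ g).card : ℝ) =
      ∑ S ∈ T.powerset, (-1) ^ S.card * ((s.filter fun g => ∏ P ∈ S, μ P ∣ g).card : ℝ) := by
  have key : ∀ g : F[X], (if ∀ P ∈ T, ¬ μ P ∣ g then (1 : ℝ) else 0) =
      ∑ S ∈ T.powerset, (-1) ^ S.card * if ∏ P ∈ S, μ P ∣ g then (1 : ℝ) else 0 := by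
    intro g
    have h1 : (if ∀ P ∈ T, ¬ μ P ∣ g then (1 : ℝ) else 0) =
        ∏ P ∈ T, (1 + (-1) * if μ P ∣ g then (1 : ℝ) else 0) := by
      rw [← Finset.prod_const_one (s := T), ← Finset.prod_ite_zero]
      refine Finset.prod_congr rfl fun P _ => ?_
      split_ifs <;> simp
    rw [h1, Finset.prod_one_add]
    refine Finset.sum_congr rfl fun S hS => ?_
    rw [Finset.prod_mul_distrib, Finset.prod_const, Finset.prod_ite_zero, Finset.prod_const_one]
    congr 2
    rw [eq_iff_iff]
    refine ⟨fun h => Finset.prod_dvd_of_coprime (hμ.mono ?_) h, fun h P hP =>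
      (Finset.dvd_prod_of_mem μ hP).trans h⟩
    exact_mod_cast Finset.mem_powerset.1 hS
  simp only [Finset.card_filter, Nat.cast_sum, Nat.cast_ite, Nat.cast_one, Nat.cast_zero]
  rw [Finset.sum_congr rfl fun g _ => key g, Finset.sum_comm]
  simp only [Finset.mul_sum]

variable {F : Type*} [Field F] [Fintype F]

/-- The inverse square root of the cardinality of `F`. -/
def invSqrt (F : Type*) [Fintype F] : ℝ := (√(Fintype.card F : ℝ))⁻¹

theorem card_pos_real (F : Type*) [Field F] [Fintype F] : (0 : ℝ) < Fintype.card F := by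
  exact_mod_cast Fintype.card_pos

theorem one_lt_card_real (F : Type*) [Field F] [Fintype F] : (1 : ℝ) < Fintype.card F := by
  exact_mod_cast Fintype.one_lt_card

theorem invSqrt_pos (F : Type*) [Field F] [Fintype F] : 0 < invSqrt F :=
  inv_pos.2 (Real.sqrt_pos.2 (card_pos_real F))

theorem invSqrt_lt_one (F : Type*) [Field F] [Fintype F] : invSqrt F < 1 :=
  inv_lt_one_of_one_lt₀ (by
    rw [Real.lt_sqrt (by norm_num)]
    simpa using one_lt_card_real F)

theorem invSqrt_sq (F : Type*) [Field F] [Fintype F] :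
    invSqrt F ^ 2 = (Fintype.card F : ℝ)⁻¹ := by
  rw [invSqrt, inv_pow, Real.sq_sqrt (card_pos_real F).le]

/-- If `deg (M * D) ≤ d`, both densities equal `q ^ (-deg (M * D))` and cancel. If `deg D > d + 1`,
both are zero. In between, each residue class contains at most one polynomial, so both densities lie
in `[0, q ^ (-d)]`. The cutoff involves only `D`, which is what the later count of sieve moduli
needs. -/
theorem abs_card_monics_sub_le {M D : F[X]} (hM : M.Monic) (hD : D.Monic) (hMD : IsCoprime M D)
    (R : F[X]) (d : ℕ) :
    |(((monics F (d + 1)).filter fun g => M ∣ g - R ∧ D ∣ g).card : ℝ)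
          / (Fintype.card F : ℝ) ^ (d + 1)
        - (((monics F d).filter fun g => M ∣ g - R ∧ D ∣ g).card : ℝ) / (Fintype.card F : ℝ) ^ d|
      ≤ if D.natDegree ≤ d + 1 then ((Fintype.card F : ℝ) ^ d)⁻¹ else 0 := by
  have hq := card_pos_real F
  have hq1 := one_lt_card_real F
  obtain ⟨c, hc⟩ := exists_congr_of_isCoprime hMD R 0
  simp only [sub_zero] at hc
  have hzero : ∀ e < D.natDegree,
      ((monics F e).filter fun g => M ∣ g - R ∧ D ∣ g).card = 0 := by
    intro e he
    refine Finset.card_eq_zero.2 (Finset.filter_eq_empty_iff.2 fun f hf hd => ?_)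
    rw [mem_monics] at hf
    have := natDegree_le_of_dvd hd.2 hf.1.ne_zero
    omega
  split_ifs with h
  · simp only [hc]
    have hMDm := hM.mul hD
    rcases le_or_gt (M * D).natDegree d with h1 | h1
    · rw [card_monics_congr hMDm c h1, card_monics_congr hMDm c (h1.trans d.le_succ)]
      push_cast
      rw [pow_sub₀ _ hq.ne' h1, pow_sub₀ _ hq.ne' (h1.trans d.le_succ)]
      have e1 : (Fintype.card F : ℝ) ^ (d + 1) ≠ 0 := by positivity
      have e2 : (Fintype.card F : ℝ) ^ d ≠ 0 := by positivity
      rw [mul_div_right_comm, mul_div_right_comm, div_self e1, div_self e2, sub_self, abs_zero]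
      positivity
    -- Here `deg (M * D) ≥ d + 1`; in degree `d + 1` the exact count can apply only with equality,
    -- where it gives `q ^ 0 = 1`.
    · have h2 : ((monics F d).filter fun g => M * D ∣ g - c).card ≤ 1 :=
        card_monics_congr_le_one c h1
      have h3 : ((monics F (d + 1)).filter fun g => M * D ∣ g - c).card ≤ 1 := by
        rcases Nat.lt_or_ge (d + 1) (M * D).natDegree with h4 | h4
        · exact card_monics_congr_le_one c h4
        · rw [card_monics_congr hMDm c h4, show d + 1 - (M * D).natDegree = 0 by omega, pow_zero]
      have h2' : (((monics F d).filter fun g => M * D ∣ g - c).card : ℝ) ≤ 1 := by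
        exact_mod_cast h2
      have h3' : (((monics F (d + 1)).filter fun g => M * D ∣ g - c).card : ℝ) ≤ 1 := by
        exact_mod_cast h3
      refine abs_sub_le_of_nonneg_of_le (by positivity) ?_ (by positivity) ?_
      · rw [← one_div]
        gcongr
        · exact hq1.le
        · omega
      · rw [← one_div]
        gcongr
  · rw [hzero _ (by omega), hzero _ (by omega)]
    simp

/-- Inclusion-exclusion over `T`, followed by the previous bound for each `S ⊆ T` with `D = ∏ P ∈ S,
μ P`. Only the number of products of degree at most `d + 1` remains. -/
theorem abs_card_sieve_sub_le {M : F[X]} (hM : M.Monic) {T : Finset F[X]} {μ : F[X] → F[X]}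
    (hμ : (T : Set F[X]).Pairwise (Function.onFun IsCoprime μ)) (hμm : ∀ P ∈ T, (μ P).Monic)
    (hMμ : ∀ P ∈ T, IsCoprime M (μ P)) (R : F[X]) (d : ℕ) :
    |(((monics F (d + 1)).filter fun g => M ∣ g - R ∧ ∀ P ∈ T, ¬ μ P ∣ g).card : ℝ)
          / (Fintype.card F : ℝ) ^ (d + 1)
        - (((monics F d).filter fun g => M ∣ g - R ∧ ∀ P ∈ T, ¬ μ P ∣ g).card : ℝ)
          / (Fintype.card F : ℝ) ^ d|
      ≤ (T.powerset.filter fun S => (∏ P ∈ S, μ P).natDegree ≤ d + 1).card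
          * ((Fintype.card F : ℝ) ^ d)⁻¹ := by
  have hf : ∀ e, ((monics F e).filter fun g => M ∣ g - R ∧ ∀ P ∈ T, ¬ μ P ∣ g) =
      ((monics F e).filter fun g => M ∣ g - R).filter fun g => ∀ P ∈ T, ¬ μ P ∣ g :=
    fun e => (Finset.filter_filter _ _ _).symm
  rw [hf, hf, card_sieve_eq hμ, card_sieve_eq hμ, Finset.sum_div, Finset.sum_div,
    ← Finset.sum_sub_distrib]
  refine (Finset.abs_sum_le_sum_abs _ _).trans ?_
  rw [Finset.card_filter, Nat.cast_sum, Finset.sum_mul]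
  refine Finset.sum_le_sum fun S hS => ?_
  rw [Finset.mem_powerset] at hS
  rw [mul_div_assoc, mul_div_assoc, ← mul_sub, abs_mul, abs_pow, abs_neg, abs_one, one_pow,
    one_mul]
  simp only [Finset.filter_filter]
  refine (abs_card_monics_sub_le hM (monic_prod_of_monic _ _ fun P hP => hμm P (hS hP))
    (IsCoprime.prod_right fun P hP => hMμ P (hS hP)) R d).trans_eq ?_
  split_ifs <;> simp

/-- The monic divisors of `h`. -/
def monicDivs (h : F[X]) : Finset F[X] :=
  ((range (h.natDegree + 1)).biUnion (monics F)).filter (· ∣ h)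

theorem mem_monicDivs {h : F[X]} (h0 : h ≠ 0) {D : F[X]} : D ∈ monicDivs h ↔ D.Monic ∧ D ∣ h := by
  simp only [monicDivs, mem_filter, mem_biUnion, mem_range, mem_monics]
  constructor
  · rintro ⟨⟨n, _, h1, _⟩, h2⟩
    exact ⟨h1, h2⟩
  · rintro ⟨h1, h2⟩
    exact ⟨⟨_, Nat.lt_succ_of_le (natDegree_le_of_dvd h2 h0), h1, rfl⟩, h2⟩

/-- The sum of `|D| ^ (-1/2)` over the monic divisors `D` of `h`. -/
def divSum (h : F[X]) : ℝ := ∑ D ∈ monicDivs h, invSqrt F ^ D.natDegree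

theorem divSum_nonneg (h : F[X]) : 0 ≤ divSum h :=
  Finset.sum_nonneg fun _ _ => pow_nonneg (invSqrt_pos F).le _

theorem divSum_one : divSum (1 : F[X]) = 1 := by
  have : monicDivs (1 : F[X]) = {1} := by
    ext D
    rw [mem_monicDivs one_ne_zero, mem_singleton]
    refine ⟨fun h => h.1.eq_one_of_isUnit (isUnit_of_dvd_one h.2), ?_⟩
    rintro rfl
    exact ⟨monic_one, dvd_rfl⟩
  simp [divSum, this]

/-- A monic divisor of `a * b` is a product of monic divisors of `a` and `b`, so the product of the
two sums runs over every divisor at least once. Submultiplicativity lets the average over tuples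
split into one average for each entry. -/
theorem divSum_mul_le {a b : F[X]} (ha : a.Monic) (hb : b.Monic) :
    divSum (a * b) ≤ divSum a * divSum b := by
  have hpos : ∀ n, 0 ≤ invSqrt F ^ n := fun n => pow_nonneg (invSqrt_pos F).le n
  have hsub : monicDivs (a * b) ⊆
      (monicDivs a ×ˢ monicDivs b).image fun p => p.1 * p.2 := by
    intro D hD
    rw [mem_monicDivs (ha.mul hb).ne_zero] at hD
    obtain ⟨u, v, hu, hv, huv⟩ := exists_dvd_and_dvd_of_dvd_mul hD.2
    have hu0 : u ≠ 0 := ne_zero_of_dvd_ne_zero ha.ne_zero hu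
    have hv0 : v ≠ 0 := ne_zero_of_dvd_ne_zero hb.ne_zero hv
    rw [mem_image]
    refine ⟨(normalize u, normalize v), ?_, ?_⟩
    · rw [mem_product, mem_monicDivs ha.ne_zero, mem_monicDivs hb.ne_zero]
      exact ⟨⟨monic_normalize hu0, by simpa using hu⟩, ⟨monic_normalize hv0, by simpa using hv⟩⟩
    · change normalize u * normalize v = D
      rw [← normalize_mul, ← huv]
      exact hD.1.normalize_eq_self
  calc divSum (a * b)
      ≤ ∑ D ∈ (monicDivs a ×ˢ monicDivs b).image fun p => p.1 * p.2,
          invSqrt F ^ D.natDegree :=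
        Finset.sum_le_sum_of_subset_of_nonneg hsub fun _ _ _ => hpos _
    _ ≤ ∑ p ∈ monicDivs a ×ˢ monicDivs b, invSqrt F ^ (p.1 * p.2).natDegree :=
        Finset.sum_image_le_of_nonneg fun _ _ => hpos _
    _ = divSum a * divSum b := by
        rw [divSum, divSum, Finset.sum_mul_sum, ← Finset.sum_product']
        refine Finset.sum_congr rfl fun p hp => ?_
        rw [mem_product, mem_monicDivs ha.ne_zero, mem_monicDivs hb.ne_zero] at hp
        rw [hp.1.1.natDegree_mul hp.2.1, pow_add]

theorem divSum_prod_le {ι : Type*} (s : Finset ι) (f : ι → F[X]) (hf : ∀ i ∈ s, (f i).Monic) :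
    divSum (∏ i ∈ s, f i) ≤ ∏ i ∈ s, divSum (f i) :=
  Finset.le_prod_of_submultiplicative_on_pred_of_nonneg divSum Polynomial.Monic divSum_nonneg
    divSum_one.le (fun _ _ => divSum_mul_le) (fun _ _ ha hb => ha.mul hb) s f hf

/-- After exchanging sums, the `q ^ n` divisors of degree `n` each divide a proportion of at most `q
^ (-n)` of the polynomials and have weight `q ^ (-n / 2)`. What is left is a geometric series in
`invSqrt F`. -/
theorem sum_divSum_le (d : ℕ) :
    ∑ f ∈ monics F d, divSum f ≤ (Fintype.card F : ℝ) ^ d * (1 - invSqrt F)⁻¹ := by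
  have hq := card_pos_real F
  have hs := invSqrt_pos F
  have h1 : ∑ f ∈ monics F d, divSum f =
      ∑ D ∈ (range (d + 1)).biUnion (monics F),
        ∑ f ∈ (monics F d).filter (D ∣ ·), invSqrt F ^ D.natDegree := by
    refine Finset.sum_comm' fun f D => ?_
    simp only [mem_filter]
    constructor
    · rintro ⟨hf, hD⟩
      rw [mem_monics] at hf
      have : D ∈ monicDivs f := hD
      rw [monicDivs, mem_filter, hf.2] at this
      exact ⟨⟨mem_monics.2 hf, this.2⟩, this.1⟩
    · rintro ⟨⟨hf, hD⟩, hD2⟩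
      refine ⟨hf, ?_⟩
      rw [mem_monics] at hf
      rw [monicDivs, mem_filter, hf.2]
      exact ⟨hD2, hD⟩
  rw [h1, Finset.sum_biUnion]
  · calc ∑ n ∈ range (d + 1), ∑ D ∈ monics F n,
          ∑ f ∈ (monics F d).filter (D ∣ ·), invSqrt F ^ D.natDegree
        ≤ ∑ n ∈ range (d + 1), (Fintype.card F : ℝ) ^ d * invSqrt F ^ n := by
          refine Finset.sum_le_sum fun n hn => ?_
          calc ∑ D ∈ monics F n, ∑ f ∈ (monics F d).filter (D ∣ ·), invSqrt F ^ D.natDegree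
              ≤ ∑ D ∈ monics F n, (Fintype.card F : ℝ) ^ d / (Fintype.card F : ℝ) ^ n
                  * invSqrt F ^ n := by
                refine Finset.sum_le_sum fun D hD => ?_
                rw [mem_monics] at hD
                rw [Finset.sum_const, nsmul_eq_mul, hD.2]
                have := card_monics_dvd_le hD.1 d
                rw [hD.2] at this
                gcongr
            _ = _ := by
                rw [Finset.sum_const, card_monics, nsmul_eq_mul, Nat.cast_pow]
                field_simp
      _ ≤ _ := by
          rw [← Finset.mul_sum]
          gcongr
          rw [← tsum_geometric_of_lt_one hs.le (invSqrt_lt_one F)]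
          exact (summable_geometric_of_lt_one hs.le (invSqrt_lt_one F)).sum_le_tsum _
            fun _ _ => by positivity
  · intro a _ b _ hab
    rw [Function.onFun, Finset.disjoint_left]
    intro D h1 h2
    rw [mem_monics] at h1 h2
    exact hab (h1.2.symm.trans h2.2)

/-- The number of sets of primes for which the product of the associated moduli has small
degree. -/
theorem card_powerset_filter_le {h : F[X]} (h0 : h ≠ 0) {T : Finset F[X]}
    (hT : ∀ P ∈ T, P.Monic ∧ Irreducible P) (N : ℕ) :
    ((T.powerset.filter fun S =>
        (∏ P ∈ S, if P ∣ h then P else P ^ 2).natDegree ≤ N).card : ℝ)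
      ≤ Fintype.card F * (invSqrt F ^ N)⁻¹ * divSum h := by
  have hq := card_pos_real F
  have hs := invSqrt_pos F
  -- A set `S` is encoded by the product `E` of its primes dividing `h` and the product of the
  -- others. The modulus is `E` times the square of the second product, which therefore has degree
  -- at most `(N - deg E) / 2`. The squares are the source of the exponent `1/2`.
  let target : Finset ((_ : F[X]) × F[X]) :=
    ((monicDivs h).filter fun E => E.natDegree ≤ N).sigma fun E =>
      (range ((N - E.natDegree) / 2 + 1)).biUnion (monics F)
  have hle : (T.powerset.filter fun S =>
        (∏ P ∈ S, if P ∣ h then P else P ^ 2).natDegree ≤ N).card ≤ target.card := by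
    refine Finset.card_le_card_of_injOn
      (fun S => ⟨∏ P ∈ S.filter (· ∣ h), P, ∏ P ∈ S.filter (fun P => ¬ P ∣ h), P⟩) ?_ ?_
    · intro S hS
      rw [Finset.mem_coe, mem_filter, mem_powerset] at hS
      obtain ⟨hS, hdeg⟩ := hS
      have m1 : (∏ P ∈ S.filter (· ∣ h), P).Monic :=
        monic_prod_of_monic _ _ fun P hP => (hT P (hS (mem_filter.1 hP).1)).1
      have m2 : (∏ P ∈ S.filter (fun P => ¬ P ∣ h), P).Monic :=
        monic_prod_of_monic _ _ fun P hP => (hT P (hS (mem_filter.1 hP).1)).1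
      rw [Finset.prod_ite, Finset.prod_pow, m1.natDegree_mul (m2.pow 2), m2.natDegree_pow] at hdeg
      rw [Finset.mem_coe, Finset.mem_sigma, mem_filter, mem_monicDivs h0, mem_biUnion]
      refine ⟨⟨⟨m1, Finset.prod_dvd_of_coprime ?_ fun P hP => (mem_filter.1 hP).2⟩, ?_⟩, _, ?_,
        mem_monics.2 ⟨m2, rfl⟩⟩
      · intro P hP Q hQ hPQ
        have hP' := hT P (hS (mem_filter.1 hP).1)
        have hQ' := hT Q (hS (mem_filter.1 hQ).1)
        exact isCoprime_of_monic_irreducible hP'.1 hQ'.1 hP'.2 hQ'.2 hPQ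
      · change natDegree (∏ P ∈ S.filter (· ∣ h), P) ≤ N
        omega
      · rw [mem_range]
        change natDegree (∏ P ∈ S.filter (fun P => ¬ P ∣ h), P) <
          (N - natDegree (∏ P ∈ S.filter (· ∣ h), P)) / 2 + 1
        omega
    -- The encoding is injective because `S` is recovered as the set of primes in `T` that divide
    -- the product of the two components.
    · have hrec : ∀ S ⊆ T, ∀ P, P ∈ S ↔ P ∈ T ∧
          P ∣ (∏ P ∈ S.filter (· ∣ h), P) * ∏ P ∈ S.filter (fun P => ¬ P ∣ h), P := by
        intro S hS P
        rw [Finset.prod_filter_mul_prod_filter_not S (fun P => P ∣ h) (fun P => P)]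
        refine ⟨fun hP => ⟨hS hP, Finset.dvd_prod_of_mem (fun P => P) hP⟩, ?_⟩
        rintro ⟨hPT, hd⟩
        obtain ⟨Q, hQ, hPQ⟩ := ((hT P hPT).2.prime.dvd_finsetProd_iff _).1 hd
        have := eq_of_monic_of_associated (hT P hPT).1 (hT Q (hS hQ)).1
          ((hT P hPT).2.associated_of_dvd (hT Q (hS hQ)).2 hPQ)
        rwa [this]
      intro S hS S' hS' heq
      rw [Finset.mem_coe, mem_filter, mem_powerset] at hS hS'
      simp only [Sigma.mk.injEq, heq_eq_eq] at heq
      ext P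
      rw [hrec S hS.1, hrec S' hS'.1, heq.1, heq.2]
  calc _ ≤ (target.card : ℝ) := by exact_mod_cast hle
    _ ≤ ∑ E ∈ (monicDivs h).filter fun E => E.natDegree ≤ N,
          Fintype.card F * (invSqrt F ^ N)⁻¹ * invSqrt F ^ E.natDegree := by
        rw [Finset.card_sigma, Nat.cast_sum]
        refine Finset.sum_le_sum fun E hE => ?_
        have hEN := (mem_filter.1 hE).2
        have h1 : ((range ((N - E.natDegree) / 2 + 1)).biUnion (monics F)).card ≤
            Fintype.card F ^ ((N - E.natDegree) / 2 + 1) := by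
          refine Finset.card_biUnion_le.trans ?_
          simp only [card_monics]
          exact (Nat.geomSum_lt Fintype.one_lt_card fun k hk => mem_range.1 hk).le
        calc (((range ((N - E.natDegree) / 2 + 1)).biUnion (monics F)).card : ℝ)
            ≤ (Fintype.card F : ℝ) ^ ((N - E.natDegree) / 2 + 1) := by exact_mod_cast h1
          _ = Fintype.card F * (invSqrt F ^ (2 * ((N - E.natDegree) / 2)))⁻¹ := by
              rw [pow_mul, invSqrt_sq, inv_pow, inv_inv, pow_succ, mul_comm]
          _ ≤ Fintype.card F * (invSqrt F ^ (N - E.natDegree))⁻¹ := by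
              gcongr _ * ?_
              refine inv_anti₀ (by positivity) ?_
              exact pow_le_pow_of_le_one hs.le (invSqrt_lt_one F).le (Nat.mul_div_le _ _)
          _ = _ := by
              rw [pow_sub₀ _ hs.ne' hEN, mul_inv, inv_inv, mul_assoc]
    _ ≤ _ := by
        rw [← Finset.mul_sum, divSum]
        gcongr
        exact Finset.filter_subset _ _

end OneVariable

/-! ### Sieving tuples: increments of the density -/

section PointSieve

open scoped Classical

/-- At the prime `P`, the entries of `f` are squarefree and pairwise coprime. -/
def GoodAt {F : Type*} [Field F] {ι : Type*} (P : F[X]) (f : ι → F[X]) : Prop :=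
  (∀ α, ¬ P ^ 2 ∣ f α) ∧ ∀ α β, α ≠ β → ¬ (P ∣ f α ∧ P ∣ f β)

/-- `f` is good at all primes, and its values at the points of `F` satisfy the conditions `A`. -/
def PointSieve {F : Type*} [Field F] {ι : Type*} (A : F → (ι → F) → Prop) (f : ι → F[X]) : Prop :=
  (∀ P : F[X], P.Monic → Irreducible P → GoodAt P f) ∧ ∀ x, A x fun α => (f α).eval x

theorem goodAt_congr {F : Type*} [Field F] {ι : Type*} {P : F[X]} {f g : ι → F[X]}
    (h : ∀ α, P ^ 2 ∣ f α - g α) : GoodAt P f ↔ GoodAt P g := by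
  have h2 : ∀ α, P ^ 2 ∣ f α ↔ P ^ 2 ∣ g α := fun α => dvd_iff_dvd_of_dvd_sub (h α)
  have h1 : ∀ α, P ∣ f α ↔ P ∣ g α := fun α =>
    dvd_iff_dvd_of_dvd_sub ((dvd_pow_self P two_ne_zero).trans (h α))
  simp only [GoodAt, h1, h2]

/-- This isolates the condition on one entry: `g` must avoid `P` if another entry is already
divisible by `P`, and `P ^ 2` otherwise. The entry to be replaced is `1`, so it plays no role in the
product. -/
theorem goodAt_update {F : Type*} [Field F] {ι : Type*} [Fintype ι] [DecidableEq ι] {P : F[X]}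
    (hP : Irreducible P) {f : ι → F[X]} {α : ι} (hα : f α = 1) (g : F[X]) :
    GoodAt P (Function.update f α g) ↔
      GoodAt P f ∧ ¬ (if P ∣ ∏ β, f β then P else P ^ 2) ∣ g := by
  have hP1 : ¬ P ∣ (1 : F[X]) := fun h => hP.not_isUnit (isUnit_of_dvd_one h)
  have hP2 : ¬ P ^ 2 ∣ (1 : F[X]) := fun h => hP1 ((dvd_pow_self P two_ne_zero).trans h)
  have hmu : (if P ∣ ∏ β, f β then P else P ^ 2) ∣ g ↔ P ^ 2 ∣ g ∨ P ∣ g ∧ ∃ β, P ∣ f β := by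
    have : P ∣ ∏ β, f β ↔ ∃ β, P ∣ f β := by
      simpa using hP.prime.dvd_finsetProd_iff (S := univ) f
    rw [← this]
    split_ifs with h
    · simp only [h, and_true]
      exact ⟨Or.inr, fun h => h.elim (dvd_pow_self P two_ne_zero).trans id⟩
    · simp only [h, and_false, or_false]
  rw [hmu]
  constructor
  · rintro ⟨h1, h2⟩
    refine ⟨⟨fun β => ?_, fun β γ hβγ => ?_⟩, ?_⟩
    · by_cases hβ : β = α
      · rwa [hβ, hα]
      · simpa [hβ] using h1 β
    · rintro ⟨hb, hc⟩
      have hβ : β ≠ α := by rintro rfl; rw [hα] at hb; exact hP1 hb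
      have hγ : γ ≠ α := by rintro rfl; rw [hα] at hc; exact hP1 hc
      exact h2 β γ hβγ (by simpa [hβ, hγ] using ⟨hb, hc⟩)
    · rintro (h | ⟨h, β, hb⟩)
      · exact h1 α (by simpa using h)
      · have hβ : β ≠ α := by rintro rfl; rw [hα] at hb; exact hP1 hb
        exact h2 β α hβ (by simpa [hβ] using ⟨hb, h⟩)
  · rintro ⟨⟨h1, h2⟩, h3⟩
    refine ⟨fun β => ?_, fun β γ hβγ => ?_⟩
    · by_cases hβ : β = α
      · subst hβ; simpa using fun h => h3 (Or.inl h)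
      · simpa [hβ] using h1 β
    · rintro ⟨hb, hc⟩
      by_cases hβ : β = α
      · subst hβ
        rw [Function.update_self] at hb
        rw [Function.update_of_ne hβγ.symm] at hc
        exact h3 (Or.inr ⟨hb, _, hc⟩)
      · rw [Function.update_of_ne hβ] at hb
        by_cases hγ : γ = α
        · subst hγ
          rw [Function.update_self] at hc
          exact h3 (Or.inr ⟨hc, _, hb⟩)
        · rw [Function.update_of_ne hγ] at hc
          exact h2 β γ hβγ ⟨hb, hc⟩

/-- The product of the squares of all monic linear polynomials. -/
def linModulus (F : Type*) [Field F] [Fintype F] : F[X] := ∏ x : F, (X - C x) ^ 2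

variable {F : Type*} [Field F] [Fintype F]

theorem monic_linModulus : (linModulus F).Monic :=
  monic_prod_of_monic _ _ fun x _ => (monic_X_sub_C x).pow 2

theorem natDegree_linModulus : (linModulus F).natDegree = 2 * Fintype.card F := by
  rw [linModulus, natDegree_prod_of_monic _ _ fun x _ => (monic_X_sub_C x).pow 2]
  simp [mul_comm]

theorem sq_dvd_linModulus (x : F) : (X - C x) ^ 2 ∣ linModulus F :=
  Finset.dvd_prod_of_mem (fun x : F => (X - C x) ^ 2) (mem_univ x)

theorem isCoprime_linModulus {P : F[X]} (hP : P.Monic) (hi : Irreducible P)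
    (h2 : 2 ≤ P.natDegree) : IsCoprime (linModulus F) P := by
  refine IsCoprime.prod_left fun x _ => IsCoprime.pow_left ?_
  refine isCoprime_of_monic_irreducible (monic_X_sub_C x) hP (irreducible_X_sub_C x) hi ?_
  rintro rfl
  rw [natDegree_X_sub_C] at h2
  omega

variable {ι : Type*} [Fintype ι] [DecidableEq ι]

/-- The tuples of monic polynomials of degrees `d` that satisfy `PointSieve A`. -/
def sieveSet (A : F → (ι → F) → Prop) (d : ι → ℕ) : Finset (ι → F[X]) :=
  (Fintype.piFinset fun α => monics F (d α)).filter (PointSieve A)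

/-- The proportion of `sieveSet A d` among the tuples of monic polynomials of degrees `d`. -/
def sieveDensity (A : F → (ι → F) → Prop) (d : ι → ℕ) : ℝ :=
  (sieveSet A d).card / (Fintype.card F : ℝ) ^ ∑ α, d α

/-- The set is fibred over the tuples in which the entry at `α` is reset to `1`. These are the
tuples with degree `0` at `α`, since the only monic polynomial of degree `0` is `1`. -/
theorem card_sieveSet_update (A : F → (ι → F) → Prop) (d : ι → ℕ) (α : ι) (D : ℕ) :
    (sieveSet A (Function.update d α D)).card =
      ∑ f ∈ Fintype.piFinset fun β => monics F (Function.update d α 0 β),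
        ((monics F D).filter fun g => PointSieve A (Function.update f α g)).card := by
  rw [Finset.card_eq_sum_card_fiberwise (f := fun f => Function.update f α 1)
    (t := Fintype.piFinset fun β => monics F (Function.update d α 0 β))]
  · refine Finset.sum_congr rfl fun f hf => ?_
    rw [Fintype.mem_piFinset] at hf
    have hfα : f α = 1 := by simpa [monics_zero] using hf α
    symm
    refine Finset.card_bij (fun g _ => Function.update f α g) ?_ ?_ ?_
    · intro g hg
      rw [mem_filter] at hg
      rw [mem_filter, sieveSet, mem_filter, Fintype.mem_piFinset]
      refine ⟨⟨fun β => ?_, hg.2⟩, ?_⟩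
      · by_cases hβ : β = α
        · subst hβ; simpa using hg.1
        · simpa [hβ] using hf β
      · rw [Function.update_idem, ← hfα, Function.update_eq_self]
    · intro a _ b _ h
      simpa using congrFun h α
    · intro g hg
      rw [mem_filter, sieveSet, mem_filter, Fintype.mem_piFinset] at hg
      have : Function.update f α (g α) = g := by
        rw [← hg.2, Function.update_idem, Function.update_eq_self]
      refine ⟨g α, ?_, this⟩
      rw [mem_filter, this]
      exact ⟨by simpa using hg.1.1 α, hg.1.2⟩
  · intro f hf
    rw [Finset.mem_coe, sieveSet, mem_filter, Fintype.mem_piFinset] at hf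
    rw [Finset.mem_coe, Fintype.mem_piFinset]
    intro β
    by_cases hβ : β = α
    · subst hβ; simp [monics_zero]
    · simpa [hβ] using hf.1 β

/-- The conditions at linear primes and the values at points depend only on `g` modulo `linModulus
F`, so they become a sum over admissible residues `ρ`. A sieve over primes of degree at least `2`
remains, and these are coprime to that modulus. Primes of degree above `N ≥ D` cannot divide `g`;
allowing `N > D` makes it possible to sieve degrees `D` and `D + 1` by the same primes. -/
theorem card_pointSieve_update {A : F → (ι → F) → Prop} {α : ι} {f : ι → F[X]} (hα : f α = 1)
    (hf : ∀ P : F[X], P.Monic → Irreducible P → GoodAt P f) {D N : ℕ} (hD : D ≤ N) :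
    ((monics F D).filter fun g => PointSieve A (Function.update f α g)).card =
      ∑ ρ ∈ (lowDeg F (2 * Fintype.card F)).filter fun ρ =>
          (∀ P : F[X], P.Monic → Irreducible P → P.natDegree = 1 →
            GoodAt P (Function.update f α ρ)) ∧
          ∀ x, A x fun β => (Function.update f α ρ β).eval x,
        ((monics F D).filter fun g => linModulus F ∣ g - ρ ∧
          ∀ P ∈ primesIn F 2 N, ¬ (if P ∣ ∏ β, f β then P else P ^ 2) ∣ g).card := by
  have hQ := monic_linModulus (F := F)
  have hlin : ∀ g ρ : F[X], linModulus F ∣ g - ρ →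
      (((∀ P : F[X], P.Monic → Irreducible P → P.natDegree = 1 →
            GoodAt P (Function.update f α g)) ∧
          ∀ x, A x fun β => (Function.update f α g β).eval x) ↔
        ((∀ P : F[X], P.Monic → Irreducible P → P.natDegree = 1 →
            GoodAt P (Function.update f α ρ)) ∧
          ∀ x, A x fun β => (Function.update f α ρ β).eval x)) := by
    intro g ρ h
    refine and_congr ?_ ?_
    · refine forall_congr' fun P => forall_congr' fun hP => forall_congr' fun _ =>
        forall_congr' fun h1 => goodAt_congr fun β => ?_
      by_cases hβ : β = α
      · subst hβ
        simp only [Function.update_self]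
        have : P = X - C (-P.coeff 0) := by
          rw [C_neg, sub_neg_eq_add]
          exact hP.eq_X_add_C h1
        rw [this]
        exact (sq_dvd_linModulus _).trans h
      · simp [hβ]
    · refine forall_congr' fun x => ?_
      have : (fun β => (Function.update f α g β).eval x) =
          fun β => (Function.update f α ρ β).eval x := by
        funext β
        by_cases hβ : β = α
        · subst hβ
          simp only [Function.update_self]
          rw [← sub_eq_zero, ← eval_sub, ← IsRoot.def, ← dvd_iff_isRoot]
          exact (dvd_pow_self _ two_ne_zero).trans ((sq_dvd_linModulus x).trans h)
        · simp [hβ]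
      rw [this]
  have hsplit : ∀ g ∈ monics F D, PointSieve A (Function.update f α g) ↔
      ((∀ P : F[X], P.Monic → Irreducible P → P.natDegree = 1 →
            GoodAt P (Function.update f α g)) ∧
          ∀ x, A x fun β => (Function.update f α g β).eval x) ∧
        ∀ P ∈ primesIn F 2 N, ¬ (if P ∣ ∏ β, f β then P else P ^ 2) ∣ g := by
    intro g hg
    rw [mem_monics] at hg
    constructor
    · rintro ⟨h1, h2⟩
      refine ⟨⟨fun P hP hi _ => h1 P hP hi, h2⟩, fun P hP => ?_⟩
      rw [mem_primesIn] at hP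
      exact ((goodAt_update hP.2.1 hα g).1 (h1 P hP.1 hP.2.1)).2
    · rintro ⟨⟨h1, h2⟩, h3⟩
      refine ⟨fun P hP hi => ?_, h2⟩
      by_cases hP1 : P.natDegree = 1
      · exact h1 P hP hi hP1
      refine (goodAt_update hi hα g).2 ⟨hf P hP hi, ?_⟩
      by_cases hPN : P.natDegree ≤ N
      · have := hi.natDegree_pos
        exact h3 P (mem_primesIn.2 ⟨hP, hi, by omega, hPN⟩)
      · intro hd
        have hd' : P ∣ g := by
          refine dvd_trans ?_ hd
          split_ifs
          · exact dvd_rfl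
          · exact dvd_pow_self P two_ne_zero
        have := natDegree_le_of_dvd hd' hg.1.ne_zero
        omega
  have hmod : ∀ g : F[X], g %ₘ linModulus F ∈ lowDeg F (2 * Fintype.card F) := by
    intro g
    rw [mem_lowDeg, ← natDegree_linModulus, ← degree_eq_natDegree hQ.ne_zero]
    exact degree_modByMonic_lt _ hQ
  have hmod_iff : ∀ g, ∀ ρ ∈ lowDeg F (2 * Fintype.card F),
      g %ₘ linModulus F = ρ ↔ linModulus F ∣ g - ρ := by
    intro g ρ hρ
    rw [mem_lowDeg, ← natDegree_linModulus, ← degree_eq_natDegree hQ.ne_zero] at hρ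
    rw [← modByMonic_eq_zero_iff_dvd hQ, sub_modByMonic, (modByMonic_eq_self_iff hQ).2 hρ,
      sub_eq_zero]
  rw [Finset.card_eq_sum_card_fiberwise (f := fun g => g %ₘ linModulus F)
    (t := lowDeg F (2 * Fintype.card F)) (fun g _ => hmod g), Finset.sum_filter]
  refine Finset.sum_congr rfl fun ρ hρ => ?_
  rw [Finset.filter_filter]
  split_ifs with h
  · congr 1
    refine Finset.filter_congr fun g hg => ?_
    rw [hsplit g hg, hmod_iff g ρ hρ]
    constructor
    · rintro ⟨⟨_, h2⟩, h3⟩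
      exact ⟨h3, h2⟩
    · rintro ⟨h3, h2⟩
      exact ⟨⟨(hlin g ρ h3).2 h, h2⟩, h3⟩
  · refine Finset.card_eq_zero.2 (Finset.filter_eq_empty_iff.2 fun g hg => ?_)
    rw [hsplit g hg, hmod_iff g ρ hρ]
    rintro ⟨⟨h1, _⟩, h3⟩
    exact h ((hlin g ρ h3).1 h1)

/-- There are at most `q ^ (2q)` residues `ρ`. For each, `abs_card_sieve_sub_le` reduces the
increment to the number of moduli of degree at most `D + 1`, times `q ^ (-D)`; the former is of
order `q ^ ((D + 1) / 2)` times a divisor sum. -/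
theorem abs_card_pointSieve_update_sub_le {A : F → (ι → F) → Prop} {α : ι} {f : ι → F[X]}
    (hα : f α = 1) (hm : ∀ β, (f β).Monic) (D : ℕ) :
    |(((monics F (D + 1)).filter fun g => PointSieve A (Function.update f α g)).card : ℝ)
          / (Fintype.card F : ℝ) ^ (D + 1)
        - (((monics F D).filter fun g => PointSieve A (Function.update f α g)).card : ℝ)
          / (Fintype.card F : ℝ) ^ D|
      ≤ (Fintype.card F : ℝ) ^ (2 * Fintype.card F)
          * (Fintype.card F * (invSqrt F)⁻¹ * invSqrt F ^ D * ∏ β, divSum (f β)) := by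
  have hq := card_pos_real F
  have hs := invSqrt_pos F
  have hprod : 0 ≤ ∏ β, divSum (f β) := Finset.prod_nonneg fun β _ => divSum_nonneg _
  by_cases hf : ∀ P : F[X], P.Monic → Irreducible P → GoodAt P f
  · rw [card_pointSieve_update hα hf le_rfl, card_pointSieve_update hα hf D.le_succ]
    rw [Nat.cast_sum, Nat.cast_sum, Finset.sum_div, Finset.sum_div, ← Finset.sum_sub_distrib]
    refine (Finset.abs_sum_le_sum_abs _ _).trans ?_
    have hterm : ∀ ρ : F[X],
        |(((monics F (D + 1)).filter fun g => linModulus F ∣ g - ρ ∧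
            ∀ P ∈ primesIn F 2 (D + 1), ¬ (if P ∣ ∏ β, f β then P else P ^ 2) ∣ g).card : ℝ)
              / (Fintype.card F : ℝ) ^ (D + 1)
          - (((monics F D).filter fun g => linModulus F ∣ g - ρ ∧
            ∀ P ∈ primesIn F 2 (D + 1), ¬ (if P ∣ ∏ β, f β then P else P ^ 2) ∣ g).card : ℝ)
              / (Fintype.card F : ℝ) ^ D|
        ≤ Fintype.card F * (invSqrt F)⁻¹ * invSqrt F ^ D * ∏ β, divSum (f β) := by
      intro ρ
      have hT : ∀ P ∈ primesIn F 2 (D + 1), P.Monic ∧ Irreducible P := fun P hP =>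
        ⟨(mem_primesIn.1 hP).1, (mem_primesIn.1 hP).2.1⟩
      refine (abs_card_sieve_sub_le (μ := fun P => if P ∣ ∏ β, f β then P else P ^ 2)
        monic_linModulus ?_ ?_ ?_ ρ D).trans ?_
      · intro P hP Q hQ hPQ
        have := isCoprime_of_monic_irreducible (hT P hP).1 (hT Q hQ).1 (hT P hP).2 (hT Q hQ).2 hPQ
        simp only [Function.onFun]
        split_ifs
        · exact this
        · exact this.pow_right
        · exact this.pow_left
        · exact this.pow
      · intro P hP
        split_ifs
        · exact (hT P hP).1
        · exact (hT P hP).1.pow 2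
      · intro P hP
        have := isCoprime_linModulus (hT P hP).1 (hT P hP).2 (mem_primesIn.1 hP).2.2.1
        split_ifs
        · exact this
        · exact this.pow_right
      · have h0 : (∏ β, f β) ≠ 0 := Finset.prod_ne_zero_iff.2 fun β _ => (hm β).ne_zero
        calc _ ≤ (Fintype.card F * (invSqrt F ^ (D + 1))⁻¹ * divSum (∏ β, f β))
                  * ((Fintype.card F : ℝ) ^ D)⁻¹ := by
              gcongr
              exact card_powerset_filter_le h0 hT (D + 1)
          _ = Fintype.card F * (invSqrt F)⁻¹ * invSqrt F ^ D * divSum (∏ β, f β) := by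
              rw [← inv_pow (Fintype.card F : ℝ), ← invSqrt_sq, ← pow_mul, mul_comm 2 D, pow_mul,
                pow_two, pow_succ]
              field_simp
          _ ≤ _ := by
              gcongr
              exact divSum_prod_le _ _ fun β _ => hm β
    refine (Finset.sum_le_sum fun ρ _ => hterm ρ).trans ?_
    rw [Finset.sum_const, nsmul_eq_mul]
    gcongr
    have : ((lowDeg F (2 * Fintype.card F)).card : ℝ) =
        (Fintype.card F : ℝ) ^ (2 * Fintype.card F) := by
      rw [card_lowDeg, Nat.cast_pow]
    rw [← this]
    exact_mod_cast Finset.card_filter_le _ _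
  -- If the other entries already fail at some prime, no choice of `g` repairs this, and both counts
  -- are zero.
  · have : ∀ E, ((monics F E).filter fun g => PointSieve A (Function.update f α g)).card = 0 := by
      intro E
      refine Finset.card_eq_zero.2 (Finset.filter_eq_empty_iff.2 fun g _ h => hf fun P hP hi => ?_)
      exact ((goodAt_update hi hα g).1 (h.1 P hP hi)).1
    rw [this, this]
    simp only [Nat.cast_zero, zero_div, sub_self, abs_zero]
    positivity

/-- The constant in the bound for the increments of `sieveDensity`. -/
def incrementConst (F : Type*) [Field F] [Fintype F] (m : ℕ) : ℝ :=
  (Fintype.card F : ℝ) ^ (2 * Fintype.card F) * (Fintype.card F * (invSqrt F)⁻¹)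
    * (1 - invSqrt F)⁻¹ ^ m

theorem incrementConst_nonneg (m : ℕ) : 0 ≤ incrementConst F m := by
  have hq := card_pos_real F
  have hs := invSqrt_pos F
  have : 0 < 1 - invSqrt F := sub_pos.2 (invSqrt_lt_one F)
  unfold incrementConst
  positivity

/-- Average the preceding bound over the other entries. The product of divisor sums factors, and
each factor has average at most `(1 - invSqrt F)⁻¹`, uniformly in the other degrees. This uniformity
is what lets the degrees grow independently. -/
theorem abs_sieveDensity_succ_sub_le (A : F → (ι → F) → Prop) (d : ι → ℕ) (α : ι) (D : ℕ) :
    |sieveDensity A (Function.update d α (D + 1)) - sieveDensity A (Function.update d α D)|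
      ≤ incrementConst F (Fintype.card ι) * invSqrt F ^ D := by
  have hq := card_pos_real F
  have hs := invSqrt_pos F
  have hsum : ∀ E, ∑ β, Function.update d α E β = E + ∑ β, Function.update d α 0 β := by
    intro E
    rw [Finset.sum_update_of_mem (mem_univ α), Finset.sum_update_of_mem (mem_univ α), zero_add]
  have hden : ∀ E, sieveDensity A (Function.update d α E) =
      ((Fintype.card F : ℝ) ^ ∑ β, Function.update d α 0 β)⁻¹ *
      ∑ f ∈ Fintype.piFinset fun β => monics F (Function.update d α 0 β),
        (((monics F E).filter fun g => PointSieve A (Function.update f α g)).card : ℝ)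
          / (Fintype.card F : ℝ) ^ E := by
    intro E
    rw [sieveDensity, card_sieveSet_update, Nat.cast_sum, hsum, pow_add, ← Finset.sum_div]
    field_simp
  rw [hden, hden, ← mul_sub, ← Finset.sum_sub_distrib, abs_mul, abs_of_nonneg (by positivity)]
  calc _ ≤ ((Fintype.card F : ℝ) ^ ∑ β, Function.update d α 0 β)⁻¹ *
      ∑ f ∈ Fintype.piFinset fun β => monics F (Function.update d α 0 β),
        (Fintype.card F : ℝ) ^ (2 * Fintype.card F)
          * (Fintype.card F * (invSqrt F)⁻¹ * invSqrt F ^ D * ∏ β, divSum (f β)) := by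
        gcongr
        refine (Finset.abs_sum_le_sum_abs _ _).trans (Finset.sum_le_sum fun f hf => ?_)
        rw [Fintype.mem_piFinset] at hf
        refine abs_card_pointSieve_update_sub_le ?_ (fun β => (mem_monics.1 (hf β)).1) D
        simpa [monics_zero] using hf α
    _ = ((Fintype.card F : ℝ) ^ ∑ β, Function.update d α 0 β)⁻¹ *
        ((Fintype.card F : ℝ) ^ (2 * Fintype.card F)
          * (Fintype.card F * (invSqrt F)⁻¹ * invSqrt F ^ D *
            ∏ β, ∑ f ∈ monics F (Function.update d α 0 β), divSum f)) := by
        rw [Finset.prod_univ_sum, ← Finset.mul_sum, ← Finset.mul_sum]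
    _ ≤ ((Fintype.card F : ℝ) ^ ∑ β, Function.update d α 0 β)⁻¹ *
        ((Fintype.card F : ℝ) ^ (2 * Fintype.card F)
          * (Fintype.card F * (invSqrt F)⁻¹ * invSqrt F ^ D *
            ∏ β, ((Fintype.card F : ℝ) ^ Function.update d α 0 β * (1 - invSqrt F)⁻¹))) := by
        gcongr with β
        · exact fun β _ => Finset.sum_nonneg fun _ _ => divSum_nonneg _
        · exact sum_divSum_le _
    _ = _ := by
        rw [Finset.prod_mul_distrib, Finset.prod_pow_eq_pow_sum, Finset.prod_const,
          Finset.card_univ, incrementConst]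
        have : (Fintype.card F : ℝ) ^ ∑ β, Function.update d α 0 β ≠ 0 := by positivity
        field_simp

end PointSieve

/-! ### Convergence to the product of local densities -/

section LocalDensities

open scoped Classical

/-- The local condition at `P` in `PointSieve A`. -/
def LocalCond {F : Type*} [Field F] {ι : Type*} (A : F → (ι → F) → Prop) (P : F[X]) (f : ι → F[X]) : Prop :=
  GoodAt P f ∧ ∀ x, P = X - C x → A x fun α => (f α).eval x

theorem localCond_congr {F : Type*} [Field F] {ι : Type*} {A : F → (ι → F) → Prop} {P : F[X]} {f g : ι → F[X]}
    (h : ∀ α, P ^ 2 ∣ f α - g α) : LocalCond A P f ↔ LocalCond A P g := by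
  refine and_congr (goodAt_congr h) (forall_congr' fun x => forall_congr' fun hx => ?_)
  have : (fun α => (f α).eval x) = fun α => (g α).eval x := by
    funext α
    rw [← sub_eq_zero, ← eval_sub, ← IsRoot.def, ← dvd_iff_isRoot, ← hx]
    exact (dvd_pow_self P two_ne_zero).trans (h α)
  rw [this]

variable {F : Type*} [Field F] [Fintype F] {ι : Type*} [Fintype ι] [DecidableEq ι]

theorem mod_mem_lowDeg {M : F[X]} (hM : M.Monic) (f : F[X]) :
    f %ₘ M ∈ lowDeg F M.natDegree := by
  rw [mem_lowDeg, ← degree_eq_natDegree hM.ne_zero]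
  exact degree_modByMonic_lt _ hM

theorem mod_eq_iff_of_mem_lowDeg {M : F[X]} (hM : M.Monic) {f ρ : F[X]}
    (hρ : ρ ∈ lowDeg F M.natDegree) : f %ₘ M = ρ ↔ M ∣ f - ρ := by
  rw [mem_lowDeg, ← degree_eq_natDegree hM.ne_zero] at hρ
  rw [← modByMonic_eq_zero_iff_dvd hM, sub_modByMonic, (modByMonic_eq_self_iff hM).2 hρ,
    sub_eq_zero]

/-- The number of residue classes modulo `P ^ 2` of tuples that satisfy `Ω`. -/
def residueCount (Ω : (ι → F[X]) → Prop) (P : F[X]) : ℕ :=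
  ((Fintype.piFinset fun _ : ι => lowDeg F (2 * P.natDegree)).filter Ω).card

/-- Induction on `T`: fixing the residues modulo `P ^ 2` turns the condition at `P` into a
congruence that is absorbed into `M`. For this reason the statement carries an arbitrary modulus `M`
and arbitrary residues `R`. The degree hypothesis ensures that the final modulus still fits into
every entry. -/
theorem card_congr_and_local {T : Finset F[X]} (hT : ∀ P ∈ T, P.Monic ∧ Irreducible P)
    (Ω : F[X] → (ι → F[X]) → Prop)
    (hΩ : ∀ P ∈ T, ∀ f g : ι → F[X], (∀ α, P ^ 2 ∣ f α - g α) → (Ω P f ↔ Ω P g))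
    {M : F[X]} (hM : M.Monic) (hMT : ∀ P ∈ T, IsCoprime M P) (R : ι → F[X]) {d : ι → ℕ}
    (hd : ∀ α, M.natDegree + ∑ P ∈ T, 2 * P.natDegree ≤ d α) :
    (((Fintype.piFinset fun α => monics F (d α)).filter fun f =>
        (∀ α, M ∣ f α - R α) ∧ ∀ P ∈ T, Ω P f).card : ℝ) =
      (Fintype.card F : ℝ) ^ (∑ α, d α) /
          (Fintype.card F : ℝ) ^ (M.natDegree * Fintype.card ι) *
        ∏ P ∈ T, ((residueCount (Ω P) P : ℝ) /
          (Fintype.card F : ℝ) ^ (2 * P.natDegree * Fintype.card ι)) := by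
  have hq := card_pos_real F
  induction T using Finset.induction_on generalizing M R with
  | empty =>
    have : ((Fintype.piFinset fun α => monics F (d α)).filter fun f =>
        (∀ α, M ∣ f α - R α) ∧ ∀ P ∈ (∅ : Finset F[X]), Ω P f) =
        Fintype.piFinset fun α => (monics F (d α)).filter fun g => M ∣ g - R α := by
      ext f
      simp [Fintype.mem_piFinset, forall_and]
    rw [this, Fintype.card_piFinset, Nat.cast_prod, Finset.prod_empty, mul_one]
    have hterm : ∀ α, (((monics F (d α)).filter fun g => M ∣ g - R α).card : ℝ) =
        (Fintype.card F : ℝ) ^ d α / (Fintype.card F : ℝ) ^ M.natDegree := by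
      intro α
      have hdα : M.natDegree ≤ d α := by simpa using hd α
      rw [card_monics_congr hM _ hdα, Nat.cast_pow, pow_sub₀ _ hq.ne' hdα, div_eq_mul_inv]
    rw [Finset.prod_congr rfl fun α _ => hterm α, Finset.prod_div_distrib,
      Finset.prod_pow_eq_pow_sum, Finset.prod_const, Finset.card_univ, pow_mul]
  | insert P T hP ih =>
    have hPm := (hT P (mem_insert_self P T)).1
    have hPi := (hT P (mem_insert_self P T)).2
    have hP2 : (P ^ 2).Monic := hPm.pow 2
    have hdeg : (P ^ 2).natDegree = 2 * P.natDegree := hPm.natDegree_pow 2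
    have hcop : IsCoprime M (P ^ 2) := (hMT P (mem_insert_self P T)).pow_right
    rw [Finset.card_eq_sum_card_fiberwise (f := fun f α => f α %ₘ P ^ 2)
      (t := Fintype.piFinset fun _ : ι => lowDeg F (2 * P.natDegree))]
    · have hfib : ∀ ρ ∈ Fintype.piFinset fun _ : ι => lowDeg F (2 * P.natDegree),
          ((((Fintype.piFinset fun α => monics F (d α)).filter fun f =>
            (∀ α, M ∣ f α - R α) ∧ ∀ P' ∈ insert P T, Ω P' f).filter fun f =>
              (fun α => f α %ₘ P ^ 2) = ρ).card : ℝ) =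
          if Ω P ρ then (Fintype.card F : ℝ) ^ (∑ α, d α) /
            (Fintype.card F : ℝ) ^ ((M * P ^ 2).natDegree * Fintype.card ι) *
              ∏ P ∈ T, ((residueCount (Ω P) P : ℝ) /
                (Fintype.card F : ℝ) ^ (2 * P.natDegree * Fintype.card ι)) else 0 := by
        intro ρ hρ
        rw [Fintype.mem_piFinset] at hρ
        have hmod : ∀ f : ι → F[X], (fun α => f α %ₘ P ^ 2) = ρ ↔ ∀ α, P ^ 2 ∣ f α - ρ α := by
          intro f
          rw [funext_iff]
          exact forall_congr' fun α => mod_eq_iff_of_mem_lowDeg hP2 (by rw [hdeg]; exact hρ α)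
        rw [Finset.filter_filter]
        split_ifs with h
        · choose c hc using fun α => exists_congr_of_isCoprime hcop (R α) (ρ α)
          rw [← ih (fun Q hQ => hT Q (mem_insert_of_mem hQ))
            (fun Q hQ => hΩ Q (mem_insert_of_mem hQ)) (hM.mul hP2) ?_ c ?_]
          · congr 2
            refine Finset.filter_congr fun f _ => ?_
            rw [hmod]
            simp only [← hc]
            constructor
            · rintro ⟨⟨h1, h2⟩, h3⟩
              exact ⟨fun α => ⟨h1 α, h3 α⟩, fun Q hQ => h2 Q (mem_insert_of_mem hQ)⟩
            · rintro ⟨h1, h2⟩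
              refine ⟨⟨fun α => (h1 α).1, fun Q hQ => ?_⟩, fun α => (h1 α).2⟩
              rcases Finset.mem_insert.1 hQ with rfl | hQ
              · exact (hΩ Q (mem_insert_self Q T) f ρ fun α => (h1 α).2).2 h
              · exact h2 Q hQ
          · intro Q hQ
            refine (hMT Q (mem_insert_of_mem hQ)).mul_left (IsCoprime.pow_left ?_)
            have hQ' := hT Q (mem_insert_of_mem hQ)
            refine isCoprime_of_monic_irreducible hPm hQ'.1 hPi hQ'.2 ?_
            rintro rfl
            exact hP hQ
          · intro α
            have := hd α
            rw [Finset.sum_insert hP] at this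
            rw [hM.natDegree_mul hP2, hdeg]
            omega
        · rw [Nat.cast_eq_zero]
          refine Finset.card_eq_zero.2 (Finset.filter_eq_empty_iff.2 fun f _ => ?_)
          rw [hmod]
          rintro ⟨⟨_, h2⟩, h3⟩
          exact h ((hΩ P (mem_insert_self P T) f ρ h3).1 (h2 P (mem_insert_self P T)))
      rw [Nat.cast_sum, Finset.sum_congr rfl hfib, ← Finset.sum_filter, Finset.sum_const,
        nsmul_eq_mul, Finset.prod_insert hP, hM.natDegree_mul hP2, hdeg, add_mul, pow_add]
      unfold residueCount
      field_simp
    · intro f _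
      rw [Finset.mem_coe, Fintype.mem_piFinset]
      intro α
      rw [← hdeg]
      exact mod_mem_lowDeg hP2 _

theorem card_piFinset_dvd_le {D : ι → F[X]} (hD : ∀ α, (D α).Monic) (d : ι → ℕ) :
    (((Fintype.piFinset fun α => monics F (d α)).filter fun f => ∀ α, D α ∣ f α).card : ℝ) ≤
      (Fintype.card F : ℝ) ^ (∑ α, d α) / (Fintype.card F : ℝ) ^ ∑ α, (D α).natDegree := by
  have : ((Fintype.piFinset fun α => monics F (d α)).filter fun f => ∀ α, D α ∣ f α) =
      Fintype.piFinset fun α => (monics F (d α)).filter fun g => D α ∣ g := by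
    ext f
    simp [Fintype.mem_piFinset, forall_and]
  rw [this, Fintype.card_piFinset, Nat.cast_prod, ← Finset.prod_pow_eq_pow_sum,
    ← Finset.prod_pow_eq_pow_sum, ← Finset.prod_div_distrib]
  exact Finset.prod_le_prod (fun _ _ => Nat.cast_nonneg _)
    fun α _ => card_monics_dvd_le (hD α) (d α)

/-- Union bound: one of `m` entries is divisible by `P ^ 2`, or one of at most `m ^ 2` pairs of
entries is divisible by `P`. Each event has proportion at most `|P| ^ (-2)`. -/
theorem card_not_goodAt_le {P : F[X]} (hP : P.Monic) (d : ι → ℕ) :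
    (((Fintype.piFinset fun α => monics F (d α)).filter fun f => ¬ GoodAt P f).card : ℝ) ≤
      (Fintype.card ι + Fintype.card ι * Fintype.card ι) * ((Fintype.card F : ℝ) ^ (∑ α, d α) /
        (Fintype.card F : ℝ) ^ (2 * P.natDegree)) := by
  set S := Fintype.piFinset fun α => monics F (d α)
  have hsub : (S.filter fun f => ¬ GoodAt P f) ⊆
      (univ.biUnion fun α => S.filter fun f => P ^ 2 ∣ f α) ∪
      (univ : Finset (ι × ι)).biUnion fun p =>
        S.filter fun f => p.1 ≠ p.2 ∧ P ∣ f p.1 ∧ P ∣ f p.2 := by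
    intro f hf
    rw [mem_filter, GoodAt, not_and_or] at hf
    simp only [mem_union, mem_biUnion, mem_univ, true_and, mem_filter, Prod.exists]
    rcases hf with ⟨hS, h | h⟩
    · push Not at h
      obtain ⟨α, hα⟩ := h
      exact Or.inl ⟨α, hS, hα⟩
    · push Not at h
      obtain ⟨α, β, h1, h2⟩ := h
      exact Or.inr ⟨α, β, hS, h1, h2⟩
  have h1 : ∀ α, ((S.filter fun f => P ^ 2 ∣ f α).card : ℝ) ≤
      (Fintype.card F : ℝ) ^ (∑ α, d α) / (Fintype.card F : ℝ) ^ (2 * P.natDegree) := by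
    intro α
    have := card_piFinset_dvd_le (D := fun β => if β = α then P ^ 2 else 1)
      (fun β => by split_ifs; exacts [hP.pow 2, monic_one]) d
    have hs : ∑ β, (if β = α then P ^ 2 else 1).natDegree = 2 * P.natDegree := by
      rw [Finset.sum_eq_single α]
      · rw [if_pos rfl, hP.natDegree_pow]
      · intro β _ h; rw [if_neg h, natDegree_one]
      · simp
    rw [hs] at this
    refine le_trans ?_ this
    norm_cast
    refine Finset.card_le_card fun f hf => ?_
    rw [mem_filter] at hf ⊢
    refine ⟨hf.1, fun β => ?_⟩
    split_ifs with h
    · rw [h]; exact hf.2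
    · exact one_dvd _
  have h2 : ∀ p : ι × ι,
      ((S.filter fun f => p.1 ≠ p.2 ∧ P ∣ f p.1 ∧ P ∣ f p.2).card : ℝ) ≤
      (Fintype.card F : ℝ) ^ (∑ α, d α) / (Fintype.card F : ℝ) ^ (2 * P.natDegree) := by
    rintro ⟨α, β⟩
    by_cases hne : α = β
    · simp only [hne, ne_eq, not_true_eq_false, false_and, Finset.filter_false, card_empty,
        Nat.cast_zero]
      have := card_pos_real F
      positivity
    have := card_piFinset_dvd_le (D := fun γ => if γ = α ∨ γ = β then P else 1)
      (fun β => by split_ifs; exacts [hP, monic_one]) d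
    have hs : ∑ γ, (if γ = α ∨ γ = β then P else 1).natDegree = 2 * P.natDegree := by
      rw [← Finset.sum_subset (Finset.subset_univ {α, β}), Finset.sum_pair hne]
      · simp [two_mul]
      · intro γ _ h
        simp only [mem_insert, mem_singleton] at h
        rw [if_neg h, natDegree_one]
    rw [hs] at this
    refine le_trans ?_ this
    norm_cast
    refine Finset.card_le_card fun f hf => ?_
    rw [mem_filter] at hf ⊢
    refine ⟨hf.1, fun γ => ?_⟩
    split_ifs with h
    · rcases h with rfl | rfl
      exacts [hf.2.2.1, hf.2.2.2]
    · exact one_dvd _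
  calc _ ≤ (∑ α, ((S.filter fun f => P ^ 2 ∣ f α).card : ℝ)) + ∑ p : ι × ι,
        ((S.filter fun f => p.1 ≠ p.2 ∧ P ∣ f p.1 ∧ P ∣ f p.2).card : ℝ) := by
        norm_cast
        exact (Finset.card_le_card hsub).trans ((Finset.card_union_le _ _).trans
          (add_le_add Finset.card_biUnion_le Finset.card_biUnion_le))
    _ ≤ _ := by
        refine (add_le_add (Finset.sum_le_sum fun α _ => h1 α)
          (Finset.sum_le_sum fun p _ => h2 p)).trans_eq ?_
        simp only [Finset.sum_const, nsmul_eq_mul, Finset.card_univ, Fintype.card_prod]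
        push_cast
        ring

/-- The proportion of residue classes modulo `P ^ 2` that satisfy `LocalCond A P`. -/
def localDensity (A : F → (ι → F) → Prop) (P : F[X]) : ℝ :=
  residueCount (LocalCond A P) P / (Fintype.card F : ℝ) ^ (2 * P.natDegree * Fintype.card ι)

/-- Imposing the conditions only at primes of degree at most `T` gives the product exactly. The
surplus tuples fail at some prime of degree `n > T`; with at most `q ^ n` primes of degree `n` and
proportion `O(q ^ (-2n))` for each, the tail is `O(q ^ (-T))`. -/
theorem abs_sieveDensity_sub_prod_le (A : F → (ι → F) → Prop) {T : ℕ} (hT : 1 ≤ T) {d : ι → ℕ}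
    (hd : ∀ α, ∑ P ∈ primesIn F 1 T, 2 * P.natDegree ≤ d α) :
    |sieveDensity A d - ∏ P ∈ primesIn F 1 T, localDensity A P| ≤
      (Fintype.card ι + Fintype.card ι * Fintype.card ι) * ((Fintype.card F : ℝ) ^ T)⁻¹ := by
  have hq := card_pos_real F
  have hq1 := one_lt_card_real F
  have hPT : ∀ P ∈ primesIn F 1 T, P.Monic ∧ Irreducible P := fun P hP =>
    ⟨(mem_primesIn.1 hP).1, (mem_primesIn.1 hP).2.1⟩
  set S := Fintype.piFinset fun α => monics F (d α) with hS
  have h1 := card_congr_and_local hPT (LocalCond (ι := ι) A)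
    (fun P _ f g h => localCond_congr h) monic_one (fun P _ => isCoprime_one_left)
    (fun _ => 0) (d := d) (by simpa using hd)
  simp only [one_dvd, implies_true, true_and, natDegree_one, zero_mul, pow_zero, div_one] at h1
  rw [← hS] at h1
  have hsub : sieveSet A d ⊆ S.filter fun f => ∀ P ∈ primesIn F 1 T, LocalCond A P f := by
    intro f hf
    rw [sieveSet, mem_filter] at hf
    rw [mem_filter]
    exact ⟨hf.1, fun P hP => ⟨hf.2.1 P (hPT P hP).1 (hPT P hP).2, fun x _ => hf.2.2 x⟩⟩
  have hdiff : (S.filter fun f => ∀ P ∈ primesIn F 1 T, LocalCond A P f) \ sieveSet A d ⊆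
      (primesIn F (T + 1) (∑ α, d α)).biUnion fun P => S.filter fun f => ¬ GoodAt P f := by
    intro f hf
    rw [mem_sdiff, mem_filter, sieveSet, mem_filter] at hf
    obtain ⟨⟨hfS, hfT⟩, hn⟩ := hf
    have hval : ∀ x, A x fun α => (f α).eval x := fun x =>
      (hfT (X - C x) (mem_primesIn.2 ⟨monic_X_sub_C x, irreducible_X_sub_C x, by simp,
        by simpa using hT⟩)).2 x rfl
    have : ∃ P : F[X], P.Monic ∧ Irreducible P ∧ ¬ GoodAt P f := by
      by_contra! h
      exact hn ⟨hfS, h, hval⟩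
    obtain ⟨P, hP, hPi, hPg⟩ := this
    rw [mem_biUnion]
    refine ⟨P, mem_primesIn.2 ⟨hP, hPi, ?_, ?_⟩, mem_filter.2 ⟨hfS, hPg⟩⟩
    · by_contra hlt
      exact hPg (hfT P (mem_primesIn.2 ⟨hP, hPi, hPi.natDegree_pos, by omega⟩)).1
    -- A prime where goodness fails divides some entry, so its degree is at most `∑ α, d α` and the
    -- union is finite.
    · have hdvd : ∃ α, P ∣ f α := by
        by_contra! h
        exact hPg ⟨fun α h2 => h α ((dvd_pow_self P two_ne_zero).trans h2),
          fun α _ _ h2 => h α h2.1⟩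
      obtain ⟨α, hα⟩ := hdvd
      rw [hS, Fintype.mem_piFinset] at hfS
      have hfα := mem_monics.1 (hfS α)
      calc P.natDegree ≤ (f α).natDegree := natDegree_le_of_dvd hα hfα.1.ne_zero
        _ = d α := hfα.2
        _ ≤ _ := Finset.single_le_sum (fun _ _ => Nat.zero_le _) (mem_univ α)
  have hbad : (((S.filter fun f => ∀ P ∈ primesIn F 1 T, LocalCond A P f) \
      sieveSet A d).card : ℝ) ≤ (Fintype.card ι + Fintype.card ι * Fintype.card ι) *
        ((Fintype.card F : ℝ) ^ (∑ α, d α) * ((Fintype.card F : ℝ) ^ T)⁻¹) := by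
    calc (((S.filter fun f => ∀ P ∈ primesIn F 1 T, LocalCond A P f) \
          sieveSet A d).card : ℝ)
        ≤ ∑ P ∈ primesIn F (T + 1) (∑ α, d α), ((S.filter fun f => ¬ GoodAt P f).card : ℝ) := by
          norm_cast
          exact (Finset.card_le_card hdiff).trans Finset.card_biUnion_le
      _ ≤ ∑ n ∈ Finset.Icc (T + 1) (∑ α, d α), ∑ P ∈ primesOf F n,
            ((S.filter fun f => ¬ GoodAt P f).card : ℝ) := by
          rw [primesIn, Finset.sum_biUnion]
          intro a _ b _ hab
          rw [Function.onFun, Finset.disjoint_left]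
          intro P h1 h2
          rw [mem_primesOf] at h1 h2
          exact hab (h1.2.1.symm.trans h2.2.1)
      _ ≤ ∑ n ∈ Finset.Icc (T + 1) (∑ α, d α), ∑ P ∈ primesOf F n,
            (Fintype.card ι + Fintype.card ι * Fintype.card ι : ℝ) *
              ((Fintype.card F : ℝ) ^ (∑ α, d α) / (Fintype.card F : ℝ) ^ (2 * n)) := by
          refine Finset.sum_le_sum fun n _ => Finset.sum_le_sum fun P hP => ?_
          rw [mem_primesOf] at hP
          rw [← hP.2.1]
          exact card_not_goodAt_le hP.1 d
      _ ≤ ∑ n ∈ Finset.Icc (T + 1) (∑ α, d α),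
            (Fintype.card ι + Fintype.card ι * Fintype.card ι : ℝ) *
              ((Fintype.card F : ℝ) ^ (∑ α, d α) * (Fintype.card F : ℝ)⁻¹ ^ n) := by
          refine Finset.sum_le_sum fun n _ => ?_
          rw [Finset.sum_const, nsmul_eq_mul]
          calc ((primesOf F n).card : ℝ) *
                ((Fintype.card ι + Fintype.card ι * Fintype.card ι : ℝ) *
                  ((Fintype.card F : ℝ) ^ (∑ α, d α) / (Fintype.card F : ℝ) ^ (2 * n)))
              ≤ (Fintype.card F : ℝ) ^ n *
                ((Fintype.card ι + Fintype.card ι * Fintype.card ι : ℝ) *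
                  ((Fintype.card F : ℝ) ^ (∑ α, d α) / (Fintype.card F : ℝ) ^ (2 * n))) := by
                gcongr
                exact_mod_cast card_primesOf_le (F := F) n
            _ = _ := by
                rw [mul_comm 2 n, pow_mul, pow_two, inv_pow]
                field_simp
      _ ≤ _ := by
          rw [← Finset.mul_sum, ← Finset.mul_sum]
          gcongr
          have h2 : (2 : ℝ) ≤ Fintype.card F := by exact_mod_cast Fintype.one_lt_card
          -- With ratio `ρ = q⁻¹ ≤ 1/2` the tail is at most `ρ ^ (T + 1) / (1 - ρ) ≤ ρ ^ T`, so no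
          -- further constant appears.
          have hr : (Fintype.card F : ℝ)⁻¹ ≤ 1 / 2 := by
            rw [one_div]; exact inv_anti₀ two_pos h2
          have hr0 : 0 < (Fintype.card F : ℝ)⁻¹ := by positivity
          have := geom_sum_Ico_le_of_lt_one (m := T + 1) (n := (∑ α, d α) + 1) hr0.le
            (by linarith)
          have hI : Finset.Ico (T + 1) ((∑ α, d α) + 1) = Finset.Icc (T + 1) (∑ α, d α) := by
            ext; simp only [Finset.mem_Ico, Finset.mem_Icc]; omega
          rw [hI] at this
          refine this.trans ?_
          rw [div_le_iff₀ (by linarith), pow_succ, ← inv_pow]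
          have : 0 < (Fintype.card F : ℝ)⁻¹ ^ T := by positivity
          gcongr
          linarith
  rw [Finset.card_sdiff_of_subset hsub, Nat.cast_sub (Finset.card_le_card hsub)] at hbad
  have hle : ((sieveSet A d).card : ℝ) ≤
      (S.filter fun f => ∀ P ∈ primesIn F 1 T, LocalCond A P f).card := by
    exact_mod_cast Finset.card_le_card hsub
  rw [abs_sub_comm, sieveDensity]
  have hX : (0 : ℝ) < (Fintype.card F : ℝ) ^ (∑ α, d α) := by positivity
  have h3 : ∏ P ∈ primesIn F 1 T, localDensity A P =
      ((S.filter fun f => ∀ P ∈ primesIn F 1 T, LocalCond A P f).card : ℝ) /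
        (Fintype.card F : ℝ) ^ (∑ α, d α) := by
    rw [h1, mul_div_assoc, mul_div_cancel₀ _ hX.ne']
    rfl
  rw [h3, ← sub_div, abs_of_nonneg (div_nonneg (sub_nonneg.2 hle) hX.le), div_le_iff₀ hX]
  linarith

theorem abs_sieveDensity_add_sub_le (A : F → (ι → F) → Prop) (d : ι → ℕ) (α : ι) (D t : ℕ) :
    |sieveDensity A (Function.update d α (D + t)) - sieveDensity A (Function.update d α D)|
      ≤ incrementConst F (Fintype.card ι) * (1 - invSqrt F)⁻¹ * invSqrt F ^ D := by
  have hs := invSqrt_pos F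
  have hs1 := invSqrt_lt_one F
  have hC := incrementConst_nonneg (F := F) (Fintype.card ι)
  have h : |sieveDensity A (Function.update d α (D + t)) - sieveDensity A (Function.update d α D)|
      ≤ ∑ j ∈ range t, incrementConst F (Fintype.card ι) * invSqrt F ^ (D + j) := by
    induction t with
    | zero => simp
    | succ t ih =>
      rw [Finset.sum_range_succ]
      have h1 := abs_sieveDensity_succ_sub_le A d α (D + t)
      have h2 := abs_sub_le (sieveDensity A (Function.update d α (D + (t + 1))))
        (sieveDensity A (Function.update d α (D + t))) (sieveDensity A (Function.update d α D))
      rw [← add_assoc] at h2 ⊢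
      linarith
  refine h.trans ?_
  simp only [pow_add]
  rw [← Finset.mul_sum, ← Finset.mul_sum, mul_assoc, mul_comm (invSqrt F ^ D)]
  gcongr
  rw [← tsum_geometric_of_lt_one hs.le hs1]
  exact (summable_geometric_of_lt_one hs.le hs1).sum_le_tsum _ fun _ _ => by positivity

/-- The sieve with an error term of square root size. -/
theorem abs_sieveDensity_sub_limit_le {A : F → (ι → F) → Prop} {c : ℝ}
    (hc : Filter.Tendsto (fun T => ∏ P ∈ primesIn F 1 T, localDensity A P) Filter.atTop
      (nhds c)) {d : ι → ℕ} {N : ℕ} (hN : ∀ α, N ≤ d α) :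
    |sieveDensity A d - c| ≤ Fintype.card ι *
      (incrementConst F (Fintype.card ι) * (1 - invSqrt F)⁻¹) * invSqrt F ^ N := by
  have hs := invSqrt_pos F
  have hs1 := invSqrt_lt_one F
  have hq1 := one_lt_card_real F
  set K := incrementConst F (Fintype.card ι) * (1 - invSqrt F)⁻¹ with hK
  have hK0 : 0 ≤ K := mul_nonneg (incrementConst_nonneg _) (inv_nonneg.2 (sub_nonneg.2 hs1.le))
  -- All degrees are raised by `t`, one coordinate at a time; the cost of each coordinate does not
  -- depend on `t` or on the other degrees.
  have hshift : ∀ (t : ℕ) (S : Finset ι),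
      |sieveDensity A (fun β => if β ∈ S then d β + t else d β) - sieveDensity A d| ≤
        S.card * (K * invSqrt F ^ N) := by
    intro t S
    induction S using Finset.induction_on with
    | empty => simp
    | insert α S hα ih =>
      have e1 : (fun β => if β ∈ insert α S then d β + t else d β) =
          Function.update (fun β => if β ∈ S then d β + t else d β) α (d α + t) := by
        funext β
        by_cases h : β = α
        · subst h; simp
        · simp [h]
      have e2 : (fun β => if β ∈ S then d β + t else d β) =
          Function.update (fun β => if β ∈ S then d β + t else d β) α (d α) := by
        funext β
        by_cases h : β = α
        · subst h; simp [hα]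
        · simp [h]
      have h1 := abs_sieveDensity_add_sub_le A (fun β => if β ∈ S then d β + t else d β) α
        (d α) t
      rw [← e1, ← e2] at h1
      have h2 : K * invSqrt F ^ d α ≤ K * invSqrt F ^ N := by
        exact mul_le_mul_of_nonneg_left (pow_le_pow_of_le_one hs.le hs1.le (hN α)) hK0
      rw [Finset.card_insert_of_notMem hα, Nat.cast_add, Nat.cast_one, add_mul, one_mul]
      refine (abs_sub_le _ (sieveDensity A (fun β => if β ∈ S then d β + t else d β)) _).trans ?_
      linarith
  have hlim : Filter.Tendsto (fun T : ℕ =>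
      (Fintype.card ι + Fintype.card ι * Fintype.card ι : ℝ) * ((Fintype.card F : ℝ) ^ T)⁻¹
        + |∏ P ∈ primesIn F 1 T, localDensity A P - c|) Filter.atTop (nhds 0) := by
    have h1 : Filter.Tendsto (fun T : ℕ => ((Fintype.card F : ℝ) ^ T)⁻¹) Filter.atTop (nhds 0) := by
      simp only [← inv_pow]
      exact tendsto_pow_atTop_nhds_zero_of_lt_one (by positivity) (inv_lt_one_of_one_lt₀ hq1)
    have h2 := (hc.sub_const c).abs
    rw [sub_self, abs_zero] at h2
    simpa using (h1.const_mul
      (Fintype.card ι + Fintype.card ι * Fintype.card ι : ℝ)).add h2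
  have hbound : ∀ᶠ T : ℕ in Filter.atTop, |sieveDensity A d - c| ≤
      Fintype.card ι * (K * invSqrt F ^ N) +
      ((Fintype.card ι + Fintype.card ι * Fintype.card ι : ℝ) * ((Fintype.card F : ℝ) ^ T)⁻¹
        + |∏ P ∈ primesIn F 1 T, localDensity A P - c|) := by
    filter_upwards [Filter.eventually_ge_atTop 1] with T hT
    -- This shift makes every degree large enough for the Chinese remainder count at level `T`.
    -- Since its cost is uniform in `T`, one may let `T` tend to infinity with `d` fixed.
    have h1 := hshift (∑ P ∈ primesIn F 1 T, 2 * P.natDegree) univ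
    simp only [mem_univ, if_true, Finset.card_univ] at h1
    have h2 := abs_sieveDensity_sub_prod_le A hT
      (d := fun β => d β + ∑ P ∈ primesIn F 1 T, 2 * P.natDegree) (fun α => Nat.le_add_left _ _)
    have h3 := abs_sub_le (sieveDensity A d)
      (sieveDensity A fun β => d β + ∑ P ∈ primesIn F 1 T, 2 * P.natDegree) c
    have h4 := abs_sub_le (sieveDensity A fun β => d β + ∑ P ∈ primesIn F 1 T, 2 * P.natDegree)
      (∏ P ∈ primesIn F 1 T, localDensity A P) c
    rw [abs_sub_comm (sieveDensity A d) (sieveDensity A _)] at h3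
    linarith
  have := le_of_tendsto_of_tendsto tendsto_const_nhds (hlim.const_add _) hbound
  rw [add_zero] at this
  linarith

end LocalDensities

/-! ### Computation of the local densities -/

section ResidueCounts

open scoped Classical

/-- Splitting a sum over functions with at most one zero according to the position of the zero. -/
theorem sum_at_most_one_zero {ι κ : Type*} [Fintype ι] [DecidableEq ι] [Zero κ] (L : Finset κ)
    (B : (ι → κ) → Prop) (u v : ℝ)
    (_ : ∀ a : κ, Decidable (a = 0))
    (_ : DecidablePred fun a : ι → κ => (∀ α β, α ≠ β → ¬ (a α = 0 ∧ a β = 0)) ∧ B a) :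
    ∑ a ∈ (Fintype.piFinset fun _ : ι => L).filter fun a =>
        (∀ α β, α ≠ β → ¬ (a α = 0 ∧ a β = 0)) ∧ B a, ∏ α, (if a α = 0 then u else v) =
      ((Fintype.piFinset fun _ : ι => L).filter fun a => (∀ α, a α ≠ 0) ∧ B a).card
          * v ^ Fintype.card ι
        + ∑ γ, (((Fintype.piFinset fun _ : ι => L).filter fun a =>
            (a γ = 0 ∧ ∀ α, α ≠ γ → a α ≠ 0) ∧ B a).card : ℝ)
              * (u * v ^ (Fintype.card ι - 1)) := by
  set S := Fintype.piFinset fun _ : ι => L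
  have hsplit : (S.filter fun a => (∀ α β, α ≠ β → ¬ (a α = 0 ∧ a β = 0)) ∧ B a) =
      (S.filter fun a => (∀ α, a α ≠ 0) ∧ B a) ∪ univ.biUnion fun γ => S.filter fun a =>
            (a γ = 0 ∧ ∀ α, α ≠ γ → a α ≠ 0) ∧ B a := by
    ext a
    simp only [mem_filter, mem_union, mem_biUnion, mem_univ, true_and]
    constructor
    · rintro ⟨hS, h, hB⟩
      by_cases h0 : ∀ α, a α ≠ 0
      · exact Or.inl ⟨hS, h0, hB⟩
      · push Not at h0
        obtain ⟨γ, hγ⟩ := h0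
        exact Or.inr ⟨γ, hS, ⟨hγ, fun α hα h1 => h α γ hα ⟨h1, hγ⟩⟩, hB⟩
    · rintro (⟨hS, h, hB⟩ | ⟨γ, hS, ⟨h1, h2⟩, hB⟩)
      · exact ⟨hS, fun α _ _ hz => h α hz.1, hB⟩
      · refine ⟨hS, fun α β hαβ hz => ?_, hB⟩
        by_cases hα : α = γ
        · exact h2 β (fun hβ => hαβ (hα.trans hβ.symm)) hz.2
        · exact h2 α hα hz.1
  rw [hsplit, Finset.sum_union, Finset.sum_biUnion]
  · congr 1
    · rw [← nsmul_eq_mul, ← Finset.sum_const]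
      refine Finset.sum_congr rfl fun a ha => ?_
      rw [mem_filter] at ha
      rw [Finset.prod_congr rfl fun α _ => if_neg (ha.2.1 α), Finset.prod_const, Finset.card_univ]
    · refine Finset.sum_congr rfl fun γ _ => ?_
      rw [← nsmul_eq_mul, ← Finset.sum_const]
      refine Finset.sum_congr rfl fun a ha => ?_
      rw [mem_filter] at ha
      rw [← Finset.mul_prod_erase _ _ (mem_univ γ), if_pos ha.2.1.1,
        Finset.prod_congr rfl fun α hα => if_neg (ha.2.1.2 α (Finset.ne_of_mem_erase hα)),
        Finset.prod_const, Finset.card_erase_of_mem (mem_univ γ), Finset.card_univ]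
  · intro γ _ δ _ hγδ
    rw [Function.onFun, Finset.disjoint_left]
    intro a h1 h2
    rw [mem_filter] at h1 h2
    exact h2.2.1.2 γ hγδ h1.2.1.1
  · rw [Finset.disjoint_left]
    intro a h1 h2
    rw [mem_filter] at h1
    rw [mem_biUnion] at h2
    obtain ⟨γ, _, h2⟩ := h2
    rw [mem_filter] at h2
    exact h1.2.1 γ h2.2.1.1

theorem card_piFinset_ne_zero {ι κ : Type*} [Fintype ι] [DecidableEq ι] [Zero κ] {L : Finset κ}
    (hL : 0 ∈ L) {B : (ι → κ) → Prop} (hB : ∀ a, B a)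
    (_ : DecidablePred fun a : ι → κ => (∀ α, a α ≠ 0) ∧ B a) :
    ((Fintype.piFinset fun _ : ι => L).filter fun a => (∀ α, a α ≠ 0) ∧ B a).card =
      (L.card - 1) ^ Fintype.card ι := by
  have : ((Fintype.piFinset fun _ : ι => L).filter fun a => (∀ α, a α ≠ 0) ∧ B a) =
      Fintype.piFinset fun _ : ι => L.erase 0 := by
    ext a
    simp only [mem_filter, Fintype.mem_piFinset, mem_erase, hB, and_true]
    exact ⟨fun h α => ⟨h.2 α, h.1 α⟩, fun h => ⟨fun α => (h α).2, fun α => (h α).1⟩⟩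
  rw [this, Fintype.card_piFinset, Finset.prod_const, Finset.card_erase_of_mem hL,
    Finset.card_univ]

theorem card_piFinset_eq_zero_at {ι κ : Type*} [Fintype ι] [DecidableEq ι] [Zero κ]
    {L : Finset κ} (hL : 0 ∈ L) {B : (ι → κ) → Prop} (hB : ∀ a, B a) (γ : ι)
    (_ : DecidablePred fun a : ι → κ => (a γ = 0 ∧ ∀ α, α ≠ γ → a α ≠ 0) ∧ B a) :
    ((Fintype.piFinset fun _ : ι => L).filter fun a =>
      (a γ = 0 ∧ ∀ α, α ≠ γ → a α ≠ 0) ∧ B a).card =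
      (L.card - 1) ^ (Fintype.card ι - 1) := by
  have : ((Fintype.piFinset fun _ : ι => L).filter fun a =>
      (a γ = 0 ∧ ∀ α, α ≠ γ → a α ≠ 0) ∧ B a) =
      Fintype.piFinset fun α : ι => if α = γ then {0} else L.erase 0 := by
    ext a
    simp only [mem_filter, Fintype.mem_piFinset, hB, and_true]
    constructor
    · rintro ⟨h1, h2, h3⟩ α
      split_ifs with h
      · subst h; simpa using h2
      · exact mem_erase.2 ⟨h3 α h, h1 α⟩
    · intro h
      have h' : ∀ α, α ≠ γ → a α ∈ L.erase 0 := fun α hα => by simpa [hα] using h α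
      have h0 : a γ = 0 := by simpa using h γ
      refine ⟨fun α => ?_, h0, fun α hα => (mem_erase.1 (h' α hα)).1⟩
      by_cases hα : α = γ
      · rw [hα, h0]; exact hL
      · exact (mem_erase.1 (h' α hα)).2
  rw [this, Fintype.card_piFinset, ← Finset.mul_prod_erase _ _ (mem_univ γ), if_pos rfl,
    card_singleton, one_mul, Finset.prod_congr rfl fun α hα => by
      rw [if_neg (Finset.ne_of_mem_erase hα)],
    Finset.prod_const, Finset.card_erase_of_mem hL, Finset.card_erase_of_mem (mem_univ γ),
    Finset.card_univ]

variable {F : Type*} [Field F] [Fintype F]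

theorem zero_mem_lowDeg (n : ℕ) : (0 : F[X]) ∈ lowDeg F n := by
  rw [mem_lowDeg, degree_zero]
  exact WithBot.bot_lt_coe n

/-- The lifts of `a` are `a + P * b` with `deg b < deg P`. When `a = 0`, the only lift divisible by
`P ^ 2` is `0`. -/
theorem card_lowDeg_filter_mod {P : F[X]} (hP : P.Monic) {a : F[X]}
    (ha : a ∈ lowDeg F P.natDegree) :
    ((lowDeg F (2 * P.natDegree)).filter fun ρ => ρ %ₘ P = a ∧ (a = 0 → ¬ P ^ 2 ∣ ρ)).card =
      if a = 0 then Fintype.card F ^ P.natDegree - 1 else Fintype.card F ^ P.natDegree := by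
  have haP : a.degree < P.degree := by
    rwa [mem_lowDeg, ← degree_eq_natDegree hP.ne_zero] at ha
  have hall : ((lowDeg F (2 * P.natDegree)).filter fun ρ => ρ %ₘ P = a) =
      (lowDeg F P.natDegree).image fun b => a + P * b := by
    ext ρ
    rw [mem_filter, mem_image, mem_lowDeg]
    constructor
    · rintro ⟨h1, h2⟩
      refine ⟨ρ /ₘ P, ?_, by rw [← h2]; exact modByMonic_add_div ρ P⟩
      rw [mem_lowDeg]
      by_cases h0 : ρ /ₘ P = 0
      · rw [h0, degree_zero]; exact WithBot.bot_lt_coe _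
      have h3 : ρ ≠ 0 := by rintro rfl; exact h0 (zero_divByMonic P)
      rw [← natDegree_lt_iff_degree_lt h3] at h1
      rw [← natDegree_lt_iff_degree_lt h0, natDegree_divByMonic ρ hP]
      by_contra hge
      have h4 : P.natDegree = 0 := by omega
      omega
    · rintro ⟨b, hb, rfl⟩
      rw [mem_lowDeg] at hb
      constructor
      · by_cases h0 : b = 0
        · rw [h0, mul_zero, add_zero]
          refine haP.trans_le ?_
          rw [degree_eq_natDegree hP.ne_zero]
          exact_mod_cast (by omega)
        refine (degree_add_le _ _).trans_lt (max_lt ?_ ?_)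
        · refine haP.trans_le ?_
          rw [degree_eq_natDegree hP.ne_zero]
          exact_mod_cast (by omega)
        · have hPb : P * b ≠ 0 := mul_ne_zero hP.ne_zero h0
          rw [← natDegree_lt_iff_degree_lt h0] at hb
          rw [← natDegree_lt_iff_degree_lt hPb, natDegree_mul hP.ne_zero h0]
          omega
      · rw [add_modByMonic, (modByMonic_eq_self_iff hP).2 haP,
          (modByMonic_eq_zero_iff_dvd hP).2 (dvd_mul_right P b), add_zero]
  have hinj : Function.Injective fun b => a + P * b := fun b c h =>
    mul_left_cancel₀ hP.ne_zero (add_left_cancel h)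
  split_ifs with h0
  · have : ((lowDeg F (2 * P.natDegree)).filter fun ρ => ρ %ₘ P = a ∧ (a = 0 → ¬ P ^ 2 ∣ ρ)) =
        ((lowDeg F (2 * P.natDegree)).filter fun ρ => ρ %ₘ P = a).erase 0 := by
      ext ρ
      simp only [mem_filter, mem_erase, h0, true_implies]
      constructor
      · rintro ⟨h1, h2, h3⟩
        refine ⟨?_, h1, h2⟩
        rintro rfl
        exact h3 (dvd_zero _)
      · rintro ⟨h1, h2, h3⟩
        refine ⟨h2, h3, fun hd => ?_⟩
        rw [mem_lowDeg, ← natDegree_lt_iff_degree_lt h1] at h2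
        have := natDegree_le_of_dvd hd h1
        rw [hP.natDegree_pow] at this
        omega
    rw [this, Finset.card_erase_of_mem, hall, Finset.card_image_of_injective _ hinj, card_lowDeg]
    rw [mem_filter, h0]
    exact ⟨zero_mem_lowDeg _, zero_modByMonic P⟩
  · simp only [h0, false_implies, and_true]
    rw [hall, Finset.card_image_of_injective _ hinj, card_lowDeg]

variable {ι : Type*} [Fintype ι] [DecidableEq ι]

/-- Group the classes modulo `P ^ 2` by their residues `a` modulo `P`. Coprimality and the value
condition depend only on `a`, while squarefreeness matters only at a zero entry, where it removes
one lift. -/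
theorem residueCount_localCond (A : F → (ι → F) → Prop) {P : F[X]} (hP : P.Monic) :
    (residueCount (LocalCond A P) P : ℝ) =
      ∑ a ∈ (Fintype.piFinset fun _ : ι => lowDeg F P.natDegree).filter fun a =>
        (∀ α β, α ≠ β → ¬ (a α = 0 ∧ a β = 0)) ∧
          ∀ x, P = X - C x → A x fun α => (a α).eval x,
        ∏ α, (if a α = 0 then (Fintype.card F : ℝ) ^ P.natDegree - 1
          else (Fintype.card F : ℝ) ^ P.natDegree) := by
  rw [residueCount, Finset.card_eq_sum_card_fiberwise (f := fun f α => f α %ₘ P)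
    (t := Fintype.piFinset fun _ : ι => lowDeg F P.natDegree)
    (fun f _ => by
      rw [Finset.mem_coe, Fintype.mem_piFinset]
      exact fun α => mod_mem_lowDeg hP _), Nat.cast_sum, Finset.sum_filter]
  refine Finset.sum_congr rfl fun a ha => ?_
  rw [Fintype.mem_piFinset] at ha
  rw [Finset.filter_filter]
  have hiff : ∀ ρ : ι → F[X], (LocalCond A P ρ ∧ (fun α => ρ α %ₘ P) = a) ↔
      (∀ α, ρ α %ₘ P = a α ∧ (a α = 0 → ¬ P ^ 2 ∣ ρ α)) ∧
        (∀ α β, α ≠ β → ¬ (a α = 0 ∧ a β = 0)) ∧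
          ∀ x, P = X - C x → A x fun α => (a α).eval x := by
    intro ρ
    by_cases hρ : (fun α => ρ α %ₘ P) = a
    · have hρ' : ∀ α, ρ α %ₘ P = a α := fun α => congrFun hρ α
      have hdvd : ∀ α, P ∣ ρ α ↔ a α = 0 := fun α => by
        rw [← modByMonic_eq_zero_iff_dvd hP, hρ']
      have heval : ∀ x, P = X - C x → (fun α => (ρ α).eval x) = fun α => (a α).eval x := by
        intro x hx
        funext α
        rw [← hρ', hx, modByMonic_X_sub_C_eq_C_eval, eval_C]
      simp only [LocalCond, GoodAt, hρ', hdvd, and_true, true_and]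
      constructor
      · rintro ⟨⟨h1, h2⟩, h3⟩
        exact ⟨fun α _ => h1 α, h2, fun x hx => heval x hx ▸ h3 x hx⟩
      · rintro ⟨h1, h2, h3⟩
        exact ⟨⟨fun α hd => h1 α ((hdvd α).1 ((dvd_pow_self P two_ne_zero).trans hd)) hd, h2⟩,
          fun x hx => (heval x hx).symm ▸ h3 x hx⟩
    · simp only [hρ, and_false, false_iff, not_and]
      intro h
      exact absurd (funext fun α => (h α).1) hρ
  simp only [hiff]
  split_ifs with h
  · have : ((Fintype.piFinset fun _ : ι => lowDeg F (2 * P.natDegree)).filter fun ρ =>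
        (∀ α, ρ α %ₘ P = a α ∧ (a α = 0 → ¬ P ^ 2 ∣ ρ α)) ∧
          (∀ α β, α ≠ β → ¬ (a α = 0 ∧ a β = 0)) ∧
          ∀ x, P = X - C x → A x fun α => (a α).eval x) =
        Fintype.piFinset fun α => (lowDeg F (2 * P.natDegree)).filter fun ρ =>
          ρ %ₘ P = a α ∧ (a α = 0 → ¬ P ^ 2 ∣ ρ) := by
      ext ρ
      simp only [mem_filter, Fintype.mem_piFinset]
      exact ⟨fun h1 α => ⟨h1.1 α, h1.2.1 α⟩, fun h1 => ⟨fun α => (h1 α).1, fun α => (h1 α).2, h⟩⟩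
    rw [this, Fintype.card_piFinset, Nat.cast_prod]
    refine Finset.prod_congr rfl fun α _ => ?_
    rw [card_lowDeg_filter_mod hP (ha α)]
    split_ifs
    · rw [Nat.cast_sub (Nat.one_le_pow _ _ Fintype.card_pos), Nat.cast_pow, Nat.cast_one]
    · rw [Nat.cast_pow]
  · rw [Nat.cast_eq_zero]
    exact Finset.card_eq_zero.2 (Finset.filter_eq_empty_iff.2 fun ρ _ hρ => h hρ.2)

/-- The density of tuples that are good at a prime of norm `Q`. -/
def goodDensity (m : ℕ) (Q : ℝ) : ℝ := (1 - Q⁻¹) ^ m * (1 + m / Q)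

/-- The first summand counts tuples with no entry divisible by the prime; the second has `m`
positions for the unique divisible entry, which has `Q - 1` lifts. -/
theorem goodDensity_eq {m : ℕ} (hm : 0 < m) {Q : ℝ} (hQ : 0 < Q) :
    ((Q - 1) ^ m * Q ^ m + m * ((Q - 1) ^ (m - 1) * ((Q - 1) * Q ^ (m - 1)))) / Q ^ (2 * m) =
      goodDensity m Q := by
  obtain ⟨k, rfl⟩ : ∃ k, m = k + 1 := ⟨m - 1, by omega⟩
  have h1 : (1 - Q⁻¹) = (Q - 1) / Q := by field_simp
  rw [goodDensity, h1, div_pow, Nat.add_sub_cancel, mul_comm 2, pow_mul, pow_two]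
  field_simp
  ring

theorem localDensity_of_two_le [Nonempty ι] (A : F → (ι → F) → Prop) {P : F[X]} (hP : P.Monic)
    (h2 : 2 ≤ P.natDegree) : localDensity A P = goodDensity (Fintype.card ι) (polyNorm P) := by
  have hq := card_pos_real F
  have hQ : 0 < polyNorm P := pow_pos hq _
  have hx : ∀ x : F, P ≠ X - C x := by
    rintro x rfl
    rw [natDegree_X_sub_C] at h2
    omega
  have hB : ∀ a : ι → F[X], ∀ x, P = X - C x → A x fun α => (a α).eval x :=
    fun _ x h => absurd h (hx x)
  rw [localDensity, residueCount_localCond A hP, sum_at_most_one_zero _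
    (fun a : ι → F[X] => ∀ x, P = X - C x → A x fun α => (a α).eval x) _ _ _ _,
    card_piFinset_ne_zero (zero_mem_lowDeg _) hB _]
  simp only [card_piFinset_eq_zero_at (zero_mem_lowDeg _) hB, card_lowDeg]
  rw [Finset.sum_const, Finset.card_univ, nsmul_eq_mul, ← goodDensity_eq Fintype.card_pos hQ]
  have h1 : 1 ≤ Fintype.card F ^ P.natDegree := Nat.one_le_pow _ _ Fintype.card_pos
  push_cast [Nat.cast_sub h1]
  rw [polyNorm, ← pow_mul, ← pow_mul, ← pow_mul,
    show 2 * P.natDegree * Fintype.card ι = P.natDegree * (2 * Fintype.card ι) by ring]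

/-- The number of value vectors at a point, weighted by the density of tuples that take them. -/
def valueWeight (B : (ι → F) → Prop) : ℝ :=
  (univ.filter fun a : ι → F => (∀ α, a α ≠ 0) ∧ B a).card * (Fintype.card F : ℝ) ^ Fintype.card ι
    + ∑ γ, ((univ.filter fun a : ι → F => (a γ = 0 ∧ ∀ α, α ≠ γ → a α ≠ 0) ∧ B a).card : ℝ)
      * (((Fintype.card F : ℝ) - 1) * (Fintype.card F : ℝ) ^ (Fintype.card ι - 1))

/-- Residues modulo `X - C x` are constants, namely the values at `x`, so the sum over residue
tuples is a sum over value vectors in `F`. -/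
theorem localDensity_linear (A : F → (ι → F) → Prop) (x : F) :
    localDensity A (X - C x) =
      valueWeight (A x) / (Fintype.card F : ℝ) ^ (2 * Fintype.card ι) := by
  have hx : ∀ y : F, (X - C x = X - C y) ↔ y = x := by
    intro y
    rw [sub_right_inj, C_inj, eq_comm]
  rw [localDensity, residueCount_localCond A (monic_X_sub_C x), natDegree_X_sub_C, mul_one,
    valueWeight]
  congr 1
  have h := sum_at_most_one_zero (univ : Finset F) (A x) ((Fintype.card F : ℝ) - 1)
    (Fintype.card F : ℝ) (fun _ => inferInstance) (fun _ => inferInstance)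
  rw [Fintype.piFinset_univ] at h
  rw [← h, pow_one]
  simp only [hx, forall_eq]
  have hmem : ∀ a : ι → F[X], a ∈ (Fintype.piFinset fun _ : ι => lowDeg F 1) →
      ∀ α, C ((a α).coeff 0) = a α := by
    intro a ha α
    rw [Fintype.mem_piFinset] at ha
    have := ha α
    rw [mem_lowDeg] at this
    exact (eq_C_of_degree_le_zero (Order.le_of_lt_succ this)).symm
  refine Finset.sum_nbij' (fun a α => (a α).coeff 0) (fun a α => C (a α)) ?_ ?_ ?_ ?_ ?_
  · intro a ha
    rw [mem_filter] at ha ⊢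
    have h1 := hmem a ha.1
    refine ⟨mem_univ _, fun α β hαβ hz => ha.2.1 α β hαβ ?_, ?_⟩
    · rw [← h1 α, ← h1 β, C_eq_zero, C_eq_zero]
      exact hz
    · convert ha.2.2 using 2 with α
      rw [← h1 α, eval_C, coeff_C_zero]
  · intro a ha
    rw [mem_filter] at ha ⊢
    refine ⟨?_, fun α β hαβ hz => ha.2.1 α β hαβ ?_, ?_⟩
    · rw [Fintype.mem_piFinset]
      intro α
      rw [mem_lowDeg]
      exact degree_C_lt
    · simpa using hz
    · simpa using ha.2.2
  · intro a ha
    funext α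
    exact hmem a (mem_filter.1 ha).1 α
  · intro a _
    funext α
    simp
  · intro a ha
    refine Finset.prod_congr rfl fun α _ => ?_
    have h1 := hmem a (mem_filter.1 ha).1 α
    have : (a α).coeff 0 = 0 ↔ a α = 0 := by
      rw [← h1, C_eq_zero, coeff_C_zero]
    simp only [this]

/-- The weight of the vacuous condition. -/
theorem valueWeight_true [Nonempty ι] :
    valueWeight (fun _ : ι → F => True) =
      ((Fintype.card F : ℝ) - 1) ^ Fintype.card ι * (Fintype.card F : ℝ) ^ (Fintype.card ι - 1) *
        (Fintype.card F + Fintype.card ι) := by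
  have hB : ∀ _ : ι → F, True := fun _ => trivial
  rw [valueWeight, ← Fintype.piFinset_univ, card_piFinset_ne_zero (mem_univ (0 : F)) hB _]
  simp only [card_piFinset_eq_zero_at (mem_univ (0 : F)) hB, Finset.card_univ]
  rw [Finset.sum_const, Finset.card_univ, nsmul_eq_mul]
  obtain ⟨k, hk⟩ : ∃ k, Fintype.card ι = k + 1 := ⟨Fintype.card ι - 1, by
    have := Fintype.card_pos (α := ι); omega⟩
  rw [hk]
  push_cast [Nat.cast_sub (Fintype.card_pos : 1 ≤ Fintype.card F)]
  ring

theorem valueWeight_true_div [Nonempty ι] :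
    valueWeight (fun _ : ι → F => True) / (Fintype.card F : ℝ) ^ (2 * Fintype.card ι) =
      goodDensity (Fintype.card ι) (Fintype.card F) := by
  rw [← goodDensity_eq Fintype.card_pos (card_pos_real F), valueWeight_true]
  congr 1
  obtain ⟨k, hk⟩ : ∃ k, Fintype.card ι = k + 1 := ⟨Fintype.card ι - 1, by
    have := Fintype.card_pos (α := ι); omega⟩
  rw [hk]
  push_cast
  ring

end ResidueCounts

/-! ### The zeta function and the constants `L` -/

section EulerProducts

open scoped Classical

variable {F : Type*} [Field F] [Fintype F]

theorem polyNorm_pos (f : F[X]) : 0 < polyNorm f := pow_pos (card_pos_real F) _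

theorem polyNorm_mul {f g : F[X]} (hf : f ≠ 0) (hg : g ≠ 0) :
    polyNorm (f * g) = polyNorm f * polyNorm g := by
  rw [polyNorm, natDegree_mul hf hg, pow_add]
  rfl

theorem one_lt_polyNorm {P : F[X]} (hP : Irreducible P) : 1 < polyNorm P :=
  one_lt_pow₀ (one_lt_card_real F) hP.natDegree_pos.ne'

/-- The part of the zeta function that comes from the polynomials without prime factor in `T`. -/
def zetaCoprime (T : Finset F[X]) : ℝ :=
  ∑' f : {f : F[X] // f.Monic},
    if ∀ P ∈ T, ¬ P ∣ f.1 then polyNorm f.1 ^ (-(2 : ℝ)) else 0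

theorem summable_zetaCoprime (B : {f : F[X] // f.Monic} → Prop) (_ : DecidablePred B) :
    Summable fun f : {f : F[X] // f.Monic} =>
      if B f then polyNorm f.1 ^ (-(2 : ℝ)) else 0 := by
  refine Summable.of_nonneg_of_le (fun f => ?_) (fun f => ?_) (summable_zetaPoly F one_lt_two)
  · have := polyNorm_pos f.1
    split_ifs <;> positivity
  · have := polyNorm_pos f.1
    split_ifs
    · exact le_rfl
    · positivity

/-- The terms removed belong to the multiples `P * f` with `f` free of primes in `T`, because `P ∉
T`. They sum to `|P| ^ (-2)` times the old value. -/
theorem zetaCoprime_insert {T : Finset F[X]} (hT : ∀ P ∈ T, P.Monic ∧ Irreducible P) {P : F[X]}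
    (hP : P.Monic) (hPi : Irreducible P) (hPT : P ∉ T) :
    zetaCoprime (insert P T) = (1 - (polyNorm P ^ 2)⁻¹) * zetaCoprime T := by
  have hpow : ∀ f : F[X], polyNorm f ^ (-(2 : ℝ)) = (polyNorm f ^ 2)⁻¹ := fun f => by
    rw [Real.rpow_neg (polyNorm_pos f).le]
    norm_cast
  have hmul : ∑' f : {f : F[X] // f.Monic},
      (if (∀ Q ∈ T, ¬ Q ∣ f.1) ∧ P ∣ f.1 then polyNorm f.1 ^ (-(2 : ℝ)) else 0) =
      (polyNorm P ^ 2)⁻¹ * zetaCoprime T := by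
    rw [zetaCoprime, ← tsum_mul_left]
    let i : {f : F[X] // f.Monic} → {f : F[X] // f.Monic} := fun f => ⟨P * f.1, hP.mul f.2⟩
    have hi : Function.Injective i := fun f g h => by
      have := congrArg Subtype.val h
      exact Subtype.ext (mul_left_cancel₀ hP.ne_zero this)
    rw [← hi.tsum_eq]
    · refine tsum_congr fun f => ?_
      have hiff : ((∀ Q ∈ T, ¬ Q ∣ (i f).1) ∧ P ∣ (i f).1) ↔ ∀ Q ∈ T, ¬ Q ∣ f.1 := by
        refine ⟨fun h Q hQ hd => h.1 Q hQ (hd.trans (dvd_mul_left _ _)), fun h =>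
          ⟨fun Q hQ hd => ?_, dvd_mul_right _ _⟩⟩
        rcases (hT Q hQ).2.prime.dvd_or_dvd hd with h1 | h1
        · have := eq_of_monic_of_associated (hT Q hQ).1 hP ((hT Q hQ).2.associated_of_dvd hPi h1)
          exact hPT (this ▸ hQ)
        · exact h Q hQ h1
      simp only [hiff]
      split_ifs
      · rw [hpow, hpow, polyNorm_mul hP.ne_zero f.2.ne_zero, mul_pow, mul_inv]
      · rw [mul_zero]
    · intro f hf
      rw [Function.mem_support, ne_eq, ite_eq_right_iff, Classical.not_imp] at hf
      obtain ⟨g, hg⟩ := hf.1.2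
      have hgm : g.Monic := hP.of_mul_monic_left (hg ▸ f.2)
      exact ⟨⟨g, hgm⟩, Subtype.ext hg.symm⟩
  rw [sub_mul, one_mul, ← hmul, zetaCoprime, zetaCoprime, eq_sub_iff_add_eq,
    ← Summable.tsum_add (summable_zetaCoprime _ _) (summable_zetaCoprime _ _)]
  refine tsum_congr fun f => ?_
  simp only [Finset.forall_mem_insert]
  by_cases h1 : P ∣ f.1 <;> by_cases h2 : ∀ Q ∈ T, ¬ Q ∣ f.1 <;> simp [h1, h2]

theorem zetaCoprime_eq {T : Finset F[X]} (hT : ∀ P ∈ T, P.Monic ∧ Irreducible P) :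
    zetaCoprime T = (∏ P ∈ T, (1 - (polyNorm P ^ 2)⁻¹)) * zetaPoly F 2 := by
  induction T using Finset.induction_on with
  | empty => simp [zetaCoprime, zetaPoly]
  | insert P T hP ih =>
    have hP' := hT P (mem_insert_self P T)
    have hT' : ∀ Q ∈ T, Q.Monic ∧ Irreducible Q := fun Q hQ => hT Q (mem_insert_of_mem hQ)
    rw [zetaCoprime_insert hT' hP'.1 hP'.2 hP, ih hT', Finset.prod_insert hP, mul_assoc]

theorem mem_primesIn_irreducible {a b : ℕ} {P : F[X]} (hP : P ∈ primesIn F a b) :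
    P.Monic ∧ Irreducible P :=
  ⟨(mem_primesIn.1 hP).1, (mem_primesIn.1 hP).2.1⟩

/-- Every monic `f ≠ 1` has a prime factor and is eventually removed; dominated convergence leaves
only the term of `f = 1`. Together with `zetaCoprime_eq` this gives the Euler product at `2`. -/
theorem tendsto_zetaCoprime :
    Filter.Tendsto (fun T => zetaCoprime (primesIn F 1 T)) Filter.atTop (nhds 1) := by
  have h1 : ∑' f : {f : F[X] // f.Monic}, (if f = ⟨1, monic_one⟩ then (1 : ℝ) else 0) = 1 :=
    tsum_ite_eq _ _
  rw [← h1]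
  refine tendsto_tsum_of_dominated_convergence (bound := fun f : {f : F[X] // f.Monic} =>
    polyNorm f.1 ^ (-(2 : ℝ))) (summable_zetaPoly F one_lt_two) ?_ ?_
  · intro f
    split_ifs with hf
    · subst hf
      refine tendsto_const_nhds.congr fun T => ?_
      rw [if_pos]
      · simp [polyNorm]
      · intro P hP hd
        exact (mem_primesIn_irreducible hP).2.not_isUnit (isUnit_of_dvd_one hd)
    · have hf1 : f.1 ≠ 1 := fun h => hf (Subtype.ext h)
      obtain ⟨P, hP, hPi, hPf⟩ := exists_monic_irreducible_factor f.1
        fun h => hf1 (f.2.eq_one_of_isUnit h)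
      refine tendsto_const_nhds.congr' ?_
      filter_upwards [Filter.eventually_ge_atTop f.1.natDegree] with T hT
      rw [if_neg]
      push Not
      exact ⟨P, mem_primesIn.2 ⟨hP, hPi, hPi.natDegree_pos,
        (natDegree_le_of_dvd hPf f.2.ne_zero).trans hT⟩, hPf⟩
  · refine Filter.Eventually.of_forall fun T f => ?_
    have := polyNorm_pos f.1
    split_ifs
    · rw [Real.norm_of_nonneg (by positivity)]
    · rw [norm_zero]; positivity

theorem zetaPoly_two_pos : 0 < zetaPoly F 2 := by
  refine (summable_zetaPoly F one_lt_two).tsum_pos (fun f => ?_) ⟨1, monic_one⟩ ?_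
  · have := polyNorm_pos f.1; positivity
  · have := polyNorm_pos (1 : F[X]); positivity

theorem tendsto_prod_one_sub_sq :
    Filter.Tendsto (fun T => ∏ P ∈ primesIn F 1 T, (1 - (polyNorm P ^ 2)⁻¹)) Filter.atTop
      (nhds (zetaPoly F 2)⁻¹) := by
  have h := (tendsto_zetaCoprime (F := F)).mul_const (zetaPoly F 2)⁻¹
  rw [one_mul] at h
  refine h.congr fun T => ?_
  rw [zetaCoprime_eq fun P hP => mem_primesIn_irreducible hP, mul_assoc,
    mul_inv_cancel₀ zetaPoly_two_pos.ne', mul_one]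

theorem tendsto_prod_eulerFactor (j : ℕ) :
    Filter.Tendsto (fun T => ∏ P ∈ primesIn F 1 T, eulerFactor j P) Filter.atTop
      (nhds (∏' P : {P : F[X] // P.Monic ∧ Irreducible P}, eulerFactor j P.1)) := by
  have hs : Filter.Tendsto (fun T => (primesIn F 1 T).subtype fun P => P.Monic ∧ Irreducible P)
      Filter.atTop Filter.atTop := by
    refine Filter.tendsto_atTop_finset_of_monotone (fun a b hab P hP => ?_) fun P => ?_
    · rw [Finset.mem_subtype, mem_primesIn] at hP ⊢
      exact ⟨hP.1, hP.2.1, hP.2.2.1, hP.2.2.2.trans hab⟩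
    · refine ⟨P.1.natDegree, ?_⟩
      rw [Finset.mem_subtype, mem_primesIn]
      exact ⟨P.2.1, P.2.2, P.2.2.natDegree_pos, le_rfl⟩
  refine ((multipliable_eulerFactor F j).hasProd.comp hs).congr fun T => ?_
  exact Finset.prod_subtype_of_mem (eulerFactor j) fun P hP => mem_primesIn_irreducible hP

theorem eulerFactor_pos (j : ℕ) (P : F[X]) : 0 < eulerFactor j P := by
  have := polyNorm_pos P
  rw [eulerFactor, sub_pos, div_lt_one (by positivity)]
  have h : (0 : ℝ) ≤ j := Nat.cast_nonneg j
  nlinarith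

/-- A convergent product of positive factors could still be zero. Here the logarithms are summable,
so each product is an exponential. Positivity is needed to turn the absolute error into a relative
one. -/
theorem eulerL_pos (m : ℕ) : 0 < eulerL F m := by
  refine Finset.prod_pos fun j _ => ?_
  have hs : Summable fun P : {P : F[X] // P.Monic ∧ Irreducible P} =>
      -((j : ℝ) / ((polyNorm P.1 + 1) * (polyNorm P.1 + j))) := by
    have hz : Summable fun P : {P : F[X] // P.Monic ∧ Irreducible P} =>
        polyNorm P.1 ^ (-(2 : ℝ)) :=
      (summable_zetaPoly F one_lt_two).comp_injective
        (i := fun P : {P : F[X] // P.Monic ∧ Irreducible P} =>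
          (⟨P.1, P.2.1⟩ : {f : F[X] // f.Monic}))
        (fun P Q h => Subtype.ext (by simpa using h))
    refine Summable.neg (Summable.of_nonneg_of_le (fun P => ?_) (fun P => ?_)
      (hz.mul_left (j : ℝ)))
    · have := polyNorm_pos P.1; positivity
    · have := polyNorm_pos P.1
      have hj : (0 : ℝ) ≤ j := Nat.cast_nonneg j
      rw [div_eq_mul_inv, Real.rpow_neg this.le]
      gcongr
      norm_cast
      nlinarith
  have hlog := Real.summable_log_one_add_of_summable hs
  have := Real.rexp_tsum_eq_tprod
    (f := fun P : {P : F[X] // P.Monic ∧ Irreducible P} => eulerFactor j P.1)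
    (fun P => eulerFactor_pos j P.1) (by simpa only [eulerFactor, sub_eq_add_neg] using hlog)
  rw [← this]
  exact Real.exp_pos _

/-- The quotient of consecutive densities is `(1 - 1/Q) (Q + j + 1) / (Q + j)`, which equals the
`j`-th Euler factor times `1 - Q ^ (-2)`. -/
theorem goodDensity_eq_prod (m : ℕ) {Q : ℝ} (hQ : 0 < Q) :
    goodDensity (m + 1) Q =
      (∏ j ∈ Finset.Icc 1 m, (1 - (j : ℝ) / ((Q + 1) * (Q + j)))) * (1 - (Q ^ 2)⁻¹) ^ (m + 1) := by
  induction m with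
  | zero =>
    simp only [goodDensity]
    simp
    field_simp
    ring
  | succ m ih =>
    rw [Finset.prod_Icc_succ_top (by omega), pow_succ (1 - (Q ^ 2)⁻¹) (m + 1)]
    have h : goodDensity (m + 1 + 1) Q = goodDensity (m + 1) Q *
        ((1 - ((m + 1 : ℕ) : ℝ) / ((Q + 1) * (Q + (m + 1 : ℕ)))) * (1 - (Q ^ 2)⁻¹)) := by
      have hm : 0 < Q + ((m + 1 : ℕ) : ℝ) := by positivity
      simp only [goodDensity, pow_succ (1 - Q⁻¹) (m + 1)]
      push_cast at hm ⊢
      field_simp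
      ring
    rw [h, ih]
    ring

theorem goodDensity_pos (m : ℕ) {Q : ℝ} (hQ : 1 < Q) : 0 < goodDensity m Q := by
  have : 0 < 1 - Q⁻¹ := sub_pos.2 (inv_lt_one_of_one_lt₀ hQ)
  unfold goodDensity
  positivity

theorem tendsto_prod_goodDensity {m : ℕ} (hm : 0 < m) :
    Filter.Tendsto (fun T => ∏ P ∈ primesIn F 1 T, goodDensity m (polyNorm P)) Filter.atTop
      (nhds (eulerL F (m - 1) / zetaPoly F 2 ^ m)) := by
  obtain ⟨k, rfl⟩ : ∃ k, m = k + 1 := ⟨m - 1, by omega⟩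
  rw [Nat.add_sub_cancel, div_eq_mul_inv, ← inv_pow]
  have h1 := tendsto_finsetProd (Finset.Icc 1 k) fun j _ => tendsto_prod_eulerFactor (F := F) j
  refine (h1.mul ((tendsto_prod_one_sub_sq (F := F)).pow (k + 1))).congr fun T => ?_
  rw [Finset.prod_comm, ← Finset.prod_pow, ← Finset.prod_mul_distrib]
  exact Finset.prod_congr rfl fun P _ => (goodDensity_eq_prod k (polyNorm_pos P)).symm

variable {ι : Type*} [Fintype ι] [DecidableEq ι]

/-- The local density differs from `goodDensity` only at the finitely many linear primes; there the
quotient is the ratio of weights of the actual condition and the vacuous one. -/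
theorem tendsto_prod_localDensity [Nonempty ι] (A : F → (ι → F) → Prop) :
    Filter.Tendsto (fun T => ∏ P ∈ primesIn F 1 T, localDensity A P) Filter.atTop
      (nhds (eulerL F (Fintype.card ι - 1) / zetaPoly F 2 ^ Fintype.card ι *
        ∏ x, valueWeight (A x) / valueWeight (fun _ : ι → F => True))) := by
  refine ((tendsto_prod_goodDensity (F := F) (Fintype.card_pos (α := ι))).mul_const _).congr' ?_
  filter_upwards [Filter.eventually_ge_atTop 1] with T hT
  have hne : ∀ P ∈ primesIn F 1 T, goodDensity (Fintype.card ι) (polyNorm P) ≠ 0 := fun P hP =>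
    (goodDensity_pos _ (one_lt_polyNorm (mem_primesIn_irreducible hP).2)).ne'
  have h1 : ∏ x, valueWeight (A x) / valueWeight (fun _ : ι → F => True) =
      ∏ P ∈ primesIn F 1 T, localDensity A P / goodDensity (Fintype.card ι) (polyNorm P) := by
    rw [← Finset.prod_subset (s₁ := univ.image fun x : F => (X - C x : F[X]))]
    · rw [Finset.prod_image]
      · refine Finset.prod_congr rfl fun x _ => ?_
        have hp : (0 : ℝ) < (Fintype.card F : ℝ) ^ (2 * Fintype.card ι) :=
          pow_pos (card_pos_real F) _
        rw [localDensity_linear, polyNorm, natDegree_X_sub_C, pow_one, ← valueWeight_true_div,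
          div_div_div_cancel_right₀ hp.ne']
      · intro x _ y _ h
        simpa using h
    · intro P hP
      rw [mem_image] at hP
      obtain ⟨x, _, rfl⟩ := hP
      exact mem_primesIn.2 ⟨monic_X_sub_C x, irreducible_X_sub_C x, by simp, by simpa using hT⟩
    · intro P hP hPx
      have hP' := mem_primesIn.1 hP
      rw [localDensity_of_two_le A hP'.1, div_self (hne P hP)]
      by_contra h
      have hd : P.natDegree = 1 := by omega
      refine hPx (mem_image.2 ⟨-P.coeff 0, mem_univ _, ?_⟩)
      rw [C_neg, sub_neg_eq_add]
      exact (hP'.1.eq_X_add_C hd).symm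
  rw [h1, ← Finset.prod_mul_distrib]
  exact Finset.prod_congr rfl fun P hP => mul_div_cancel₀ _ (hne P hP)

end EulerProducts

/-! ### Pairs `(s, ω)` as characters of the group -/

section Duality

open scoped Classical

variable {n : ℕ} {r : Fin n → ℕ}

theorem PairIndex.s_dvd (p : PairIndex r) (j : Fin n) : p.s j ∣ r j := by
  have h := (Finset.mem_sigma.1 p.2).1
  exact Nat.dvd_of_mem_divisors (Fintype.mem_piFinset.1 h j)

theorem dvd_ell (s : Fin n → ℕ) (j : Fin n) : s j ∣ ell s := Finset.dvd_lcm (mem_univ j)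

theorem ell_dvd {L : ℕ} (hL : ∀ j, r j ∣ L) (p : PairIndex r) : ell p.s ∣ L :=
  Finset.lcm_dvd fun j _ => (p.s_dvd j).trans (hL j)

theorem ell_pos (hr : ∀ j, 0 < r j) (p : PairIndex r) : 0 < ell p.s := by
  refine Nat.pos_of_ne_zero fun h => ?_
  rw [ell, Finset.lcm_eq_zero_iff] at h
  obtain ⟨j, _, hj⟩ := h
  have := p.s_dvd j
  rw [hj, zero_dvd_iff] at this
  exact (hr j).ne' this

theorem pairing_add (p : PairIndex r) (v w : Fin n → ℕ) :
    pairing p (fun j => v j + w j) = pairing p v + pairing p w := by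
  simp only [pairing, mul_add, Finset.sum_add_distrib]

theorem pairing_mul (p : PairIndex r) (k : ℕ) (v : Fin n → ℕ) :
    pairing p (fun j => k * v j) = k * pairing p v := by
  simp only [pairing, Finset.mul_sum]
  exact Finset.sum_congr rfl fun _ _ => by ring

theorem pairing_sum {ι : Type*} (p : PairIndex r) (t : Finset ι) (k : ι → ℕ)
    (v : ι → Fin n → ℕ) :
    pairing p (fun j => ∑ i ∈ t, k i * v i j) = ∑ i ∈ t, k i * pairing p (v i) := by
  simp only [pairing, Finset.mul_sum]
  rw [Finset.sum_comm]
  exact Finset.sum_congr rfl fun i _ => Finset.sum_congr rfl fun _ _ => by ring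

/-- The element of `ℤ/r₁ × ⋯ × ℤ/rₙ` given by an integer vector. -/
def toGroup (r : Fin n → ℕ) (v : Fin n → ℕ) : ∀ j, ZMod (r j) :=
  fun j => (v j : ZMod (r j))

theorem toGroup_add (v w : Fin n → ℕ) :
    toGroup r (fun j => v j + w j) = toGroup r v + toGroup r w := by
  funext j
  simp [toGroup]

theorem toGroup_mul (k : ℕ) (v : Fin n → ℕ) :
    toGroup r (fun j => k * v j) = k • toGroup r v := by
  funext j
  simp [toGroup]

/-- Changing `v j` by a multiple of `r j`, hence of `s j`, changes the `j`-th term by a multiple of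
`(ℓ(s) / s j) * s j = ℓ(s)`. So each pair defines a character of the group. -/
theorem pairing_modEq_of_toGroup_eq (p : PairIndex r) {v w : Fin n → ℕ}
    (h : toGroup r v = toGroup r w) : pairing p v ≡ pairing p w [MOD ell p.s] := by
  refine Nat.ModEq.sum fun j _ => ?_
  have h1 : v j ≡ w j [MOD p.s j] :=
    ((ZMod.natCast_eq_natCast_iff _ _ _).1 (congrFun h j)).of_dvd (p.s_dvd j)
  have h2 := (h1.mul_left' (ell p.s / p.s j)).mul_left (p.w j)
  rw [Nat.div_mul_cancel (dvd_ell p.s j)] at h2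
  convert h2 using 1 <;> ring

theorem toGroup_surjective [∀ j, NeZero (r j)] (y : (j : Fin n) → ZMod (r j)) :
    ∃ α : RFull r, toGroup r (fun j => (α j : ℕ)) = y :=
  ⟨fun j => ⟨(y j).val, ZMod.val_lt _⟩, funext fun _ => ZMod.natCast_zmod_val _⟩

theorem toGroup_injective [∀ j, NeZero (r j)] {α β : RFull r}
    (h : toGroup r (fun j => (α j : ℕ)) = toGroup r (fun j => (β j : ℕ))) : α = β := by
  funext j
  have h1 := (ZMod.natCast_eq_natCast_iff' _ _ _).1 (congrFun h j)
  rw [Nat.mod_eq_of_lt (α j).2, Nat.mod_eq_of_lt (β j).2] at h1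
  exact Fin.ext h1

/-- Every character of the group is given by a pair `(s, ω)`. -/
theorem exists_pairIndex_of_addChar [∀ j, NeZero (r j)]
    (ψ : AddChar ((j : Fin n) → ZMod (r j)) ℂ) :
    ∃ p : PairIndex r, ∀ v : Fin n → ℕ,
      ψ (toGroup r v) = 1 ↔ pairing p v ≡ 0 [MOD ell p.s] := by
  have hr : ∀ j, 0 < r j := fun j => Nat.pos_of_ne_zero (NeZero.ne _)
  let ξ : Fin n → ℂ := fun j => ψ (Pi.single j 1)
  have hξr : ∀ j, ξ j ^ r j = 1 := by
    intro j
    rw [← AddChar.map_nsmul_eq_pow, ← AddChar.map_zero_eq_one ψ]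
    congr 1
    rw [← Pi.single_smul]
    simp
  -- The character is determined by its values `ξ j` on the standard generators: `s j` is the order
  -- of `ξ j`, and `w j` is its exponent with respect to a fixed primitive `s j`-th root of unity.
  let s : Fin n → ℕ := fun j => orderOf (ξ j)
  have hsr : ∀ j, s j ∣ r j := fun j => orderOf_dvd_of_pow_eq_one (hξr j)
  have hs0 : ∀ j, 0 < s j := fun j => Nat.pos_of_dvd_of_pos (hsr j) (hr j)
  have hℓ0 : ell s ≠ 0 := by
    intro h
    rw [ell, Finset.lcm_eq_zero_iff] at h
    obtain ⟨j, _, hj⟩ := h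
    exact (hs0 j).ne' hj
  have hζ := Complex.isPrimitiveRoot_exp (ell s) hℓ0
  set ζ := Complex.exp (2 * Real.pi * Complex.I / (ell s : ℕ)) with hζdef
  have hω : ∀ j, ∃ w, (1 ≤ w ∧ w ≤ s j) ∧ Nat.Coprime w (s j) ∧ (ζ ^ (ell s / s j)) ^ w = ξ j := by
    intro j
    have : NeZero (s j) := ⟨(hs0 j).ne'⟩
    have h1 : IsPrimitiveRoot (ζ ^ (ell s / s j)) (s j) :=
      hζ.pow (Nat.pos_of_ne_zero hℓ0) (Nat.div_mul_cancel (dvd_ell s j)).symm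
    obtain ⟨i, hi, hcop, hpow⟩ := h1.isPrimitiveRoot_iff.1 (IsPrimitiveRoot.orderOf (ξ j))
    -- The exponent `0` is coprime to `s j` only if `s j = 1`; as `Omega` requires `1 ≤ w`, it is
    -- replaced by `w = s j`.
    rcases Nat.eq_zero_or_pos i with h0 | h0
    · refine ⟨s j, ⟨hs0 j, le_rfl⟩, ?_, ?_⟩
      · rw [h0, Nat.coprime_zero_left] at hcop
        change orderOf (ξ j) = 1 at hcop
        simp only [s, hcop, Nat.coprime_self]
      · rw [h1.pow_eq_one, ← hpow, h0, pow_zero]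
    · exact ⟨i, ⟨h0, hi.le⟩, hcop, hpow⟩
  choose w hw hcop hpow using hω
  have hmem : (⟨s, w⟩ : (_ : Fin n → ℕ) × (Fin n → ℕ)) ∈ (divisorVecs r).sigma Omega := by
    simp only [Finset.mem_sigma, divisorVecs, Omega, Fintype.mem_piFinset, Nat.mem_divisors,
      Finset.mem_filter, Finset.mem_Icc]
    exact ⟨fun j => ⟨hsr j, (hr j).ne'⟩, fun j => ⟨hw j, hcop j⟩⟩
  have hsum : ∀ (t : Finset (Fin n)) (f : Fin n → ((j : Fin n) → ZMod (r j))),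
      ψ (∑ j ∈ t, f j) = ∏ j ∈ t, ψ (f j) := by
    intro t f
    induction t using Finset.induction_on with
    | empty => simp
    | insert j t hj ih => rw [Finset.sum_insert hj, Finset.prod_insert hj, AddChar.map_add_eq_mul, ih]
  refine ⟨⟨⟨s, w⟩, hmem⟩, fun v => ?_⟩
  have hv : toGroup r v = ∑ j, v j • (Pi.single j 1 : (j : Fin n) → ZMod (r j)) := by
    funext i
    rw [Finset.sum_apply, Finset.sum_eq_single i]
    · simp [toGroup]
    · intro j _ hj
      simp [hj.symm]
    · simp
  have hψ : ψ (toGroup r v) = ζ ^ pairing (⟨⟨s, w⟩, hmem⟩ : PairIndex r) v := by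
    rw [hv, hsum, pairing, ← Finset.prod_pow_eq_pow_sum]
    refine Finset.prod_congr rfl fun j _ => ?_
    rw [AddChar.map_nsmul_eq_pow, pow_mul, pow_mul, hpow j]
  rw [hψ, hζ.pow_eq_one_iff_dvd, Nat.modEq_zero_iff_dvd]

/-- Duality for finite abelian groups: if `w ∉ ⟨v⟩`, some character of the quotient by `⟨v⟩` is
nontrivial at `w`, and its pullback comes from a pair. -/
theorem mem_zmultiples_iff_pairing [∀ j, NeZero (r j)] (v w : Fin n → ℕ) :
    toGroup r w ∈ AddSubgroup.zmultiples (toGroup r v) ↔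
      ∀ p : PairIndex r, pairing p v ≡ 0 [MOD ell p.s] → pairing p w ≡ 0 [MOD ell p.s] := by
  constructor
  · intro h p hp
    rw [← mem_multiples_iff_mem_zmultiples] at h
    obtain ⟨k, hk⟩ := h
    replace hk : k • toGroup r v = toGroup r w := hk
    rw [← toGroup_mul] at hk
    refine (pairing_modEq_of_toGroup_eq p hk.symm).trans ?_
    rw [pairing_mul]
    simpa using hp.mul_left k
  · intro h
    by_contra hw
    have h0 : ((toGroup r w : (j : Fin n) → ZMod (r j)) :
        ((j : Fin n) → ZMod (r j)) ⧸ AddSubgroup.zmultiples (toGroup r v)) ≠ 0 := by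
      rwa [ne_eq, QuotientAddGroup.eq_zero_iff]
    obtain ⟨ψ, hψ⟩ := AddChar.exists_apply_ne_zero.2 h0
    obtain ⟨p, hp⟩ := exists_pairIndex_of_addChar
      (ψ.compAddMonoidHom (QuotientAddGroup.mk' (AddSubgroup.zmultiples (toGroup r v))))
    refine hψ ((hp w).2 (h p ((hp v).1 ?_)))
    rw [AddChar.compAddMonoidHom_apply, QuotientAddGroup.mk'_apply,
      (QuotientAddGroup.eq_zero_iff _).2 (AddSubgroup.mem_zmultiples _), AddChar.map_zero_eq_one]

/-- The element of the group given by `β`. -/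
abbrev vecElt (β : RFull r) : (j : Fin n) → ZMod (r j) := toGroup r fun j => (β j : ℕ)

theorem mem_zeroSumPairs {β : RFull r} {p : PairIndex r} :
    p ∈ zeroSumPairs β ↔ pairing p (fun j => (β j : ℕ)) ≡ 0 [MOD ell p.s] := by
  simp [zeroSumPairs]

theorem zeroSumPairs_eq_iff [∀ j, NeZero (r j)] {β γ : RFull r} :
    zeroSumPairs β = zeroSumPairs γ ↔
      AddSubgroup.zmultiples (vecElt β) = AddSubgroup.zmultiples (vecElt γ) := by
  rw [le_antisymm_iff (a := AddSubgroup.zmultiples (vecElt β)), AddSubgroup.zmultiples_le,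
    AddSubgroup.zmultiples_le, mem_zmultiples_iff_pairing, mem_zmultiples_iff_pairing,
    Finset.ext_iff]
  simp only [mem_zeroSumPairs]
  exact ⟨fun h => ⟨fun p => (h p).2, fun p => (h p).1⟩, fun h p => ⟨h.2 p, h.1 p⟩⟩

theorem addOrderOf_vecElt (hr : ∀ j, 0 < r j) (β : RFull r) :
    addOrderOf (vecElt β) = ramIndex β := by
  rw [Pi.addOrderOf, ramIndex]
  congr 1
  funext j
  exact ZMod.addOrderOf_coe _ (hr j).ne'

theorem card_generators {G : Type*} [AddCommGroup G] [Fintype G] (x : G) :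
    (univ.filter fun y : G => AddSubgroup.zmultiples y = AddSubgroup.zmultiples x).card =
      Nat.totient (addOrderOf x) := by
  have h := IsAddCyclic.card_addOrderOf_eq_totient (α := AddSubgroup.zmultiples x)
    (d := addOrderOf x) (by rw [← Nat.card_eq_fintype_card, Nat.card_zmultiples])
  rw [← h]
  symm
  refine Finset.card_bij (fun y _ => (y : G)) ?_ (fun a _ b _ h => Subtype.ext h) ?_
  · intro y hy
    rw [mem_filter] at hy ⊢
    refine ⟨mem_univ _, AddSubgroup.eq_of_le_of_card_ge ?_ ?_⟩
    · rw [AddSubgroup.zmultiples_le]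
      exact y.2
    · rw [Nat.card_zmultiples, Nat.card_zmultiples, ← hy.2, AddSubgroup.addOrderOf_coe]
  · intro y hy
    rw [mem_filter] at hy
    refine ⟨⟨y, hy.2 ▸ AddSubgroup.mem_zmultiples y⟩, ?_, rfl⟩
    rw [mem_filter]
    refine ⟨mem_univ _, ?_⟩
    rw [← AddSubgroup.addOrderOf_coe, ← Nat.card_zmultiples, hy.2, Nat.card_zmultiples]

/-- By `zeroSumPairs_eq_iff` the class of `β` is the set of generators of `⟨β⟩`, a cyclic group of
order `e(β)`. -/
theorem card_class [∀ j, NeZero (r j)] (β : RFull r) :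
    (univ.filter fun γ : RFull r => zeroSumPairs γ = zeroSumPairs β).card =
      Nat.totient (ramIndex β) := by
  have hr : ∀ j, 0 < r j := fun j => Nat.pos_of_ne_zero (NeZero.ne _)
  rw [← addOrderOf_vecElt hr, ← card_generators]
  refine Finset.card_bij (fun γ _ => vecElt γ) ?_ (fun a _ b _ h => toGroup_injective h) ?_
  · intro γ hγ
    rw [mem_filter, zeroSumPairs_eq_iff] at hγ
    exact mem_filter.2 ⟨mem_univ _, hγ.2⟩
  · intro y hy
    obtain ⟨γ, rfl⟩ := toGroup_surjective y
    refine ⟨γ, mem_filter.2 ⟨mem_univ _, ?_⟩, rfl⟩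
    rw [zeroSumPairs_eq_iff]
    exact (mem_filter.1 hy).2

theorem totient_sq (e : ℕ) : Nat.totient (e ^ 2) = e * Nat.totient e := by
  rcases Nat.eq_zero_or_pos e with rfl | he
  · simp
  have h := Nat.totient_gcd_mul_totient_mul e e
  rw [Nat.gcd_self, ← pow_two] at h
  have hφ : 0 < Nat.totient e := Nat.totient_pos.2 he
  refine Nat.eq_of_mul_eq_mul_left hφ ?_
  rw [h]
  ring

end Duality

/-! ### Character values through discrete logarithms -/

section CharacterValues

open scoped Classical

theorem pow_eq_pow_iff_of_isPrimitiveRoot {M : Type*} [CommMonoid M] {ζ : M} {m : ℕ}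
    (hζ : IsPrimitiveRoot ζ m) (hm : 0 < m) {a b : ℕ} : ζ ^ a = ζ ^ b ↔ a ≡ b [MOD m] := by
  rw [pow_eq_pow_mod a hζ.pow_eq_one, pow_eq_pow_mod b hζ.pow_eq_one]
  exact ⟨hζ.pow_inj (Nat.mod_lt _ hm) (Nat.mod_lt _ hm), fun h => by rw [h]⟩

/-- A discrete logarithm to the base `g`, with value `0` where there is none. -/
def dlog {F : Type*} [Field F] (g : Fˣ) (u : F) : ℕ :=
  if h : ∃ k : ℕ, (g : F) ^ k = u then Nat.find h else 0

theorem dlog_zero {F : Type*} [Field F] (g : Fˣ) : dlog g (0 : F) = 0 := by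
  rw [dlog, dif_neg]
  rintro ⟨k, hk⟩
  exact pow_ne_zero k g.ne_zero hk

theorem pow_dlog {F : Type*} [Field F] {g : Fˣ} (hg : ∀ u : Fˣ, u ∈ Submonoid.powers g) {u : F}
    (hu : u ≠ 0) : (g : F) ^ dlog g u = u := by
  obtain ⟨k, hk⟩ := hg (Units.mk0 u hu)
  have hex : ∃ k : ℕ, (g : F) ^ k = u := ⟨k, by
    have := congrArg Units.val hk
    simpa using this⟩
  rw [dlog, dif_pos hex]
  exact Nat.find_spec hex

theorem isPrimitiveRoot_mulChar {F : Type*} [Field F] {g : Fˣ}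
    (hg : ∀ u : Fˣ, u ∈ Submonoid.powers g) {χ : MulChar F ℂ} {m : ℕ} (hχ : orderOf χ = m) :
    IsPrimitiveRoot (χ g) m := by
  have h : orderOf (χ (g : F)) = orderOf χ := by
    rw [orderOf_eq_orderOf_iff]
    intro k
    have hgz : ∀ u : Fˣ, u ∈ Subgroup.zpowers g := fun u => by
      obtain ⟨k, rfl⟩ := hg u
      exact Subgroup.npow_mem_zpowers g k
    rw [MulChar.eq_iff hgz, MulChar.pow_apply_coe, MulChar.one_apply_coe]
  rw [← hχ, ← h]
  exact IsPrimitiveRoot.orderOf _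

/-- A zero base is harmless when `m` divides its exponent: the reduced exponent is `0` and the
factor is `1`, matching the convention `dlog g 0 = 0`. -/
theorem mulChar_prod_pow {F : Type*} [Field F] {g : Fˣ} (hg : ∀ u : Fˣ, u ∈ Submonoid.powers g)
    {χ : MulChar F ℂ} {m : ℕ} (hχ : IsPrimitiveRoot (χ g) m) {ι : Type*} (t : Finset ι)
    (u : ι → F) (k : ι → ℕ) (hu : ∀ i ∈ t, u i = 0 → m ∣ k i) :
    χ (∏ i ∈ t, u i ^ (k i % m)) = χ g ^ ∑ i ∈ t, dlog g (u i) * k i := by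
  rw [map_prod, ← Finset.prod_pow_eq_pow_sum]
  refine Finset.prod_congr rfl fun i hi => ?_
  by_cases h0 : u i = 0
  · rw [Nat.mod_eq_zero_of_dvd (hu i hi h0), pow_zero, map_one, h0, dlog_zero, zero_mul, pow_zero]
  · conv_lhs => rw [← pow_dlog hg h0]
    rw [map_pow, map_pow, ← pow_mul, mul_comm (dlog g (u i)), mul_comm (dlog g (u i)), pow_mul,
      pow_mul, ← pow_eq_pow_mod _ hχ.pow_eq_one]

variable {F : Type*} [Field F] {n : ℕ} {r : Fin n → ℕ}

/-- The exponent vector of the values `a` of a tuple. -/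
def expVec (g : Fˣ) (a : RNonzero r → F) (j : Fin n) : ℕ :=
  ∑ α : RNonzero r, dlog g (a α) * (α.1 j : ℕ)

/-- `χ_ℓ(s)` of the value of `F_(s)^(ω)` at a point where the tuple takes the values `a`. -/
def charValue (χ : ℕ → MulChar F ℂ) (a : RNonzero r → F) (p : PairIndex r) : ℂ :=
  χ (ell p.s) (∏ α : RNonzero r, a α ^ (pairing p (fun j => (α.1 j : ℕ)) % ell p.s))

/-- The characters `χ_m` have exact order `m` for all `m` that occur. -/
def HasOrders (r : Fin n → ℕ) (χ : ℕ → MulChar F ℂ) : Prop :=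
  ∀ p : PairIndex r, orderOf (χ (ell p.s)) = ell p.s

/-- The hypothesis covers both patterns: `γ` nonzero is the position of the only zero, and `γ = 0`
means that there is none. On `A_γ` the vanishing entry has reduced exponent `0`; off `A_γ` its
exponent is positive and the product vanishes. -/
theorem charValue_eq [∀ j, NeZero (r j)] {g : Fˣ} (hg : ∀ u : Fˣ, u ∈ Submonoid.powers g)
    {χ : ℕ → MulChar F ℂ} (hχ : HasOrders r χ) {a : RNonzero r → F} {γ : RFull r}
    (ha : ∀ α, a α = 0 ↔ α.1 = γ) (p : PairIndex r) :
    charValue χ a p = if p ∈ zeroSumPairs γ then χ (ell p.s) g ^ pairing p (expVec g a) else 0 := by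
  split_ifs with hp
  · rw [mem_zeroSumPairs, Nat.modEq_zero_iff_dvd] at hp
    rw [charValue, mulChar_prod_pow hg (isPrimitiveRoot_mulChar hg (hχ p))]
    · congr 1
      exact (pairing_sum p univ (fun α => dlog g (a α)) fun α j => (α.1 j : ℕ)).symm
    · intro α _ h
      rwa [(ha α).1 h]
  · rw [mem_zeroSumPairs, Nat.modEq_zero_iff_dvd] at hp
    have hγ : ∃ j, (γ j : ℕ) ≠ 0 := by
      by_contra! h
      exact hp (by simp [pairing, h])
    rw [charValue, Finset.prod_eq_zero (mem_univ (⟨γ, hγ⟩ : RNonzero r)), MulChar.map_zero]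
    rw [(ha _).2 rfl, zero_pow]
    exact fun h => hp (Nat.dvd_of_mod_eq_zero h)

theorem mulChar_twistCoeff {g : Fˣ} (hg : ∀ u : Fˣ, u ∈ Submonoid.powers g)
    {χ : ℕ → MulChar F ℂ} (hχ : HasOrders r χ) (c : Fin n → Fˣ) (p : PairIndex r) :
    χ (ell p.s) (twistCoeff c p) = χ (ell p.s) g ^ pairing p fun j => dlog g (c j : F) := by
  rw [twistCoeff, mulChar_prod_pow hg (isPrimitiveRoot_mulChar hg (hχ p))]
  · congr 1
    exact Finset.sum_congr rfl fun j _ => mul_comm _ _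
  · intro j _ h
    exact absurd h (c j).ne_zero

/-- The prescription vanishes outside `A_β`, and is given by the group element of `h` on `A_β`. -/
def HasStandardForm (χ : ℕ → MulChar F ℂ) (g : Fˣ) (ε : PairIndex r → ℂ) (β : RFull r)
    (h : Fin n → ℕ) : Prop :=
  ∀ p, ε p = if p ∈ zeroSumPairs β then χ (ell p.s) g ^ pairing p h else 0

theorem eval_twistPoly (c : Fin n → Fˣ) (f : RNonzero r → F[X]) (p : PairIndex r) (x : F) :
    (twistPoly c f p).eval x = twistCoeff c p *
      ∏ α : RNonzero r, (f α).eval x ^ (pairing p (fun j => (α.1 j : ℕ)) % ell p.s) := by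
  rw [twistPoly, eval_mul, eval_C, eval_prod]
  simp only [eval_pow]

theorem exists_eq_zero_iff [∀ j, NeZero (r j)] {a : RNonzero r → F}
    (ha : ∀ α γ, α ≠ γ → ¬ (a α = 0 ∧ a γ = 0)) :
    ∃ γ : RFull r, ∀ α, a α = 0 ↔ α.1 = γ := by
  by_cases h : ∃ γ, a γ = 0
  · obtain ⟨γ, hγ⟩ := h
    refine ⟨γ.1, fun α => ⟨fun hα => ?_, fun hα => ?_⟩⟩
    · by_contra hne
      exact ha α γ (fun h => hne (congrArg Subtype.val h)) ⟨hα, hγ⟩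
    · rw [Subtype.ext hα, hγ]
  · push Not at h
    refine ⟨zeroVec r fun j => Nat.pos_of_ne_zero (NeZero.ne _), fun α => ?_⟩
    refine ⟨fun hα => absurd hα (h α), fun hα => ?_⟩
    obtain ⟨j, hj⟩ := α.2
    rw [hα] at hj
    exact absurd rfl hj

/-- At a finite point `β` is the position of the vanishing entry, if any, and `h` collects the
logarithms of the coefficients and of the values. At infinity `β` represents the total degree
vector, and only the coefficients enter `h`. -/
theorem IsAdmissible.hasStandardForm [∀ j, NeZero (r j)] {g : Fˣ}
    (hg : ∀ u : Fˣ, u ∈ Submonoid.powers g) {χ : ℕ → MulChar F ℂ} (hχ : HasOrders r χ)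
    {d : RNonzero r → ℕ} {ε : PairIndex r → ℂ} (h : IsAdmissible χ d ε) :
    ∃ β h, HasStandardForm χ g ε β h := by
  obtain ⟨c, f, hf, x, hε⟩ := h
  have hgood : IsGoodTuple f := by
    rcases hf with hf | hf
    · exact hf.1
    · obtain ⟨β, hβ⟩ := Set.mem_iUnion.1 hf
      exact hβ.1
  cases x with
  | some x =>
    have hcop : ∀ α γ, α ≠ γ → ¬ ((f α).eval x = 0 ∧ (f γ).eval x = 0) := by
      rintro α γ hαγ ⟨h1, h2⟩
      obtain ⟨u, v, huv⟩ := hgood.2 α γ hαγ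
      have := congrArg (eval x) huv
      simp [h1, h2] at this
    obtain ⟨γ, hγ⟩ := exists_eq_zero_iff hcop
    refine ⟨γ, fun j => dlog g (c j : F) + expVec g (fun α => (f α).eval x) j, fun p => ?_⟩
    rw [hε p]
    change χ (ell p.s) ((twistPoly c f p).eval x) = _
    have h1 := charValue_eq hg hχ hγ p
    rw [charValue] at h1
    rw [eval_twistPoly, _root_.map_mul, h1, mulChar_twistCoeff hg hχ, pairing_add, pow_add]
    split_ifs <;> simp
  | none =>
    obtain ⟨β, hβ⟩ := toGroup_surjective (toGroup r (totalDegree f))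
    refine ⟨β, fun j => dlog g (c j : F), fun p => ?_⟩
    rw [hε p, ← mulChar_twistCoeff hg hχ]
    have h1 : pairing p (totalDegree f) ≡ 0 [MOD ell p.s] ↔
        pairing p (fun j => (β j : ℕ)) ≡ 0 [MOD ell p.s] := by
      have := pairing_modEq_of_toGroup_eq p hβ
      exact ⟨this.trans, this.symm.trans⟩
    simp only [twistValue, mem_zeroSumPairs, ← h1]
    split_ifs
    · rfl
    · rw [MulChar.map_zero]

theorem HasStandardForm.eq_zero_iff {g : Fˣ} {χ : ℕ → MulChar F ℂ} {ε : PairIndex r → ℂ}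
    {β : RFull r} {h : Fin n → ℕ} (hε : HasStandardForm χ g ε β h) (p : PairIndex r) :
    ε p = 0 ↔ p ∉ zeroSumPairs β := by
  have hne : χ (ell p.s) (g : F) ≠ 0 := (g.isUnit.map (χ (ell p.s))).ne_zero
  rw [hε p]
  split_ifs with hp
  · simpa [hp] using fun h0 : χ (ell p.s) (g : F) = 0 => absurd h0 hne
  · simp [hp]

theorem HasStandardForm.isClassAdmissible_iff {g : Fˣ} {χ : ℕ → MulChar F ℂ}
    {d : RNonzero r → ℕ} {ε : PairIndex r → ℂ} {β : RFull r} {h : Fin n → ℕ}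
    (hε : HasStandardForm χ g ε β h) (ha : IsAdmissible χ d ε) (b : RClass r) :
    IsClassAdmissible χ d ε b ↔ b = Quotient.mk _ β := by
  induction b using Quotient.inductionOn with
  | h γ =>
    rw [IsClassAdmissible, Quotient.eq]
    simp only [ha, true_and, Quotient.lift_mk, hε.eq_zero_iff, not_iff_not]
    change _ ↔ zeroSumPairs γ = zeroSumPairs β
    rw [Finset.ext_iff]
    exact forall_congr' fun p => Iff.comm

/-- The zeros of the two families determine `A_γ` and `A_β`. On this common set the values agree
exactly when every character trivial on `γ` is trivial on the difference of the group elements,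
which by duality puts the difference in `⟨γ⟩`. -/
theorem charValue_eq_iff [∀ j, NeZero (r j)] {g : Fˣ} (hg : ∀ u : Fˣ, u ∈ Submonoid.powers g)
    {χ : ℕ → MulChar F ℂ} (hχ : HasOrders r χ) {ε : PairIndex r → ℂ}
    {β : RFull r} {h : Fin n → ℕ} (hε : HasStandardForm χ g ε β h) {a : RNonzero r → F}
    {γ : RFull r} (ha : ∀ α, a α = 0 ↔ α.1 = γ) :
    (∀ p, charValue χ a p = ε p) ↔ zeroSumPairs γ = zeroSumPairs β ∧
      toGroup r (expVec g a) - toGroup r h ∈ AddSubgroup.zmultiples (vecElt γ) := by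
  have hr : ∀ j, 0 < r j := fun j => Nat.pos_of_ne_zero (NeZero.ne _)
  have hform : HasStandardForm χ g (charValue χ a) γ (expVec g a) := charValue_eq hg hχ ha
  by_cases hγβ : zeroSumPairs γ = zeroSumPairs β
  · obtain ⟨δ, hδ⟩ := toGroup_surjective (toGroup r (expVec g a) - toGroup r h)
    rw [← hδ, mem_zmultiples_iff_pairing]
    simp only [hγβ, true_and]
    have hsum : ∀ p : PairIndex r, pairing p (expVec g a) ≡
        pairing p h + pairing p (fun j => (δ j : ℕ)) [MOD ell p.s] := by
      intro p
      rw [← pairing_add]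
      refine pairing_modEq_of_toGroup_eq p ?_
      rw [toGroup_add, hδ]
      abel
    refine forall_congr' fun p => ?_
    rw [← mem_zeroSumPairs (β := γ), hγβ, hform p, hε p, hγβ]
    by_cases hp : p ∈ zeroSumPairs β
    · simp only [hp, if_true, true_implies]
      have hζ := isPrimitiveRoot_mulChar hg (hχ p)
      rw [pow_eq_pow_iff_of_isPrimitiveRoot hζ (ell_pos hr p)]
      constructor
      · intro h1
        have h2 := (hsum p).symm.trans h1
        exact Nat.ModEq.add_left_cancel' (pairing p h) (by simpa using h2)
      · intro h1
        have h2 := (hsum p).trans (h1.add_left (pairing p h))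
        simpa using h2
    · simp [hp]
  · simp only [hγβ, false_and, iff_false]
    intro h1
    refine hγβ (Finset.ext fun p => ?_)
    rw [← not_iff_not, ← hform.eq_zero_iff, ← hε.eq_zero_iff, h1 p]

end CharacterValues

/-! ### Counting value vectors for a prescription -/

section FiberCounts

open scoped Classical

theorem toGroup_expVec {F : Type*} [Field F] {n : ℕ} {r : Fin n → ℕ} (g : Fˣ) (a : RNonzero r → F) :
    toGroup r (expVec g a) = ∑ α, dlog g (a α) • vecElt α.1 := by
  funext j
  simp [toGroup, expVec, Finset.sum_apply]

variable {F : Type*} [Field F] [Fintype F] {n : ℕ} {r : Fin n → ℕ}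

/-- The least exponent is not additive, but it is so modulo the order `q - 1` of `g`, hence modulo
every divisor of `q - 1`. This is where `r j ∣ q - 1` enters. -/
theorem natCast_dlog_mul {g : Fˣ} (hg : ∀ u : Fˣ, u ∈ Submonoid.powers g) {k : ℕ}
    (hk : k ∣ Fintype.card F - 1) (u v : Fˣ) :
    (dlog g ((u * v : Fˣ) : F) : ZMod k) = dlog g (u : F) + dlog g (v : F) := by
  have hgz : ∀ u : Fˣ, u ∈ Subgroup.zpowers g := fun u => by
    obtain ⟨k, rfl⟩ := hg u
    exact Subgroup.npow_mem_zpowers g k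
  have hord : orderOf g = Fintype.card F - 1 := by
    rw [orderOf_eq_card_of_forall_mem_zpowers hgz, Nat.card_eq_fintype_card, Fintype.card_units]
  have hpow : ∀ w : Fˣ, g ^ dlog g (w : F) = w := fun w => Units.ext (by
    rw [Units.val_pow_eq_pow_val]
    exact pow_dlog hg w.ne_zero)
  have h : g ^ dlog g ((u * v : Fˣ) : F) = g ^ (dlog g (u : F) + dlog g (v : F)) := by
    rw [hpow, pow_add, hpow, hpow]
  rw [pow_eq_pow_iff_modEq, hord] at h
  have := (ZMod.natCast_eq_natCast_iff _ _ k).2 (h.of_dvd hk)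
  simpa using this

/-- The group element that a tuple of nonzero values represents, as a homomorphism. -/
def valueHom {g : Fˣ} (hg : ∀ u : Fˣ, u ∈ Submonoid.powers g)
    (hr : ∀ j, r j ∣ Fintype.card F - 1) :
    (RNonzero r → Fˣ) →* Multiplicative ((j : Fin n) → ZMod (r j)) :=
  MonoidHom.mk' (fun v => Multiplicative.ofAdd (toGroup r (expVec g fun α => (v α : F)))) (by
    intro u v
    rw [← ofAdd_add]
    congr 1
    funext j
    simp only [toGroup, expVec, Pi.add_apply, Pi.mul_apply]
    push_cast
    rw [← Finset.sum_add_distrib]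
    refine Finset.sum_congr rfl fun α _ => ?_
    rw [← add_mul, ← natCast_dlog_mul hg (hr j)]
    push_cast
    rfl)

theorem valueHom_apply {g : Fˣ} (hg : ∀ u : Fˣ, u ∈ Submonoid.powers g)
    (hr : ∀ j, r j ∣ Fintype.card F - 1) (v : RNonzero r → Fˣ) :
    (valueHom hg hr v).toAdd = toGroup r (expVec g fun α => (v α : F)) := rfl

/-- For `β ≠ 0`, the tuple with `g` at position `β` and `1` elsewhere maps to `β`; the zero element
is the image of `1`. -/
theorem valueHom_surjective [∀ j, NeZero (r j)] {g : Fˣ}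
    (hg : ∀ u : Fˣ, u ∈ Submonoid.powers g) (hr : ∀ j, r j ∣ Fintype.card F - 1) :
    Function.Surjective (valueHom (r := r) hg hr) := by
  intro y
  obtain ⟨β, hβ⟩ := toGroup_surjective y.toAdd
  by_cases h : ∃ j, (β j : ℕ) ≠ 0
  · refine ⟨Pi.mulSingle ⟨β, h⟩ g, ?_⟩
    rw [← Multiplicative.toAdd.injective.eq_iff, valueHom_apply, ← hβ, toGroup_expVec]
    have h1 : ∀ k, (dlog g (1 : F) : ZMod k) = 0 ∨ ¬ k ∣ Fintype.card F - 1 := by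
      intro k
      by_cases hk : k ∣ Fintype.card F - 1
      · left
        have := natCast_dlog_mul hg hk 1 1
        simpa using this
      · exact Or.inr hk
    have hg1 : ∀ k, k ∣ Fintype.card F - 1 → (dlog g (g : F) : ZMod k) = 1 := by
      intro k hk
      have hgz : ∀ u : Fˣ, u ∈ Subgroup.zpowers g := fun u => by
        obtain ⟨k, rfl⟩ := hg u
        exact Subgroup.npow_mem_zpowers g k
      have hord : orderOf g = Fintype.card F - 1 := by
        rw [orderOf_eq_card_of_forall_mem_zpowers hgz, Nat.card_eq_fintype_card,
          Fintype.card_units]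
      have h2 : g ^ dlog g (g : F) = g ^ 1 := Units.ext (by
        rw [Units.val_pow_eq_pow_val, pow_one]
        exact pow_dlog hg g.ne_zero)
      rw [pow_eq_pow_iff_modEq, hord] at h2
      have := (ZMod.natCast_eq_natCast_iff _ _ k).2 (h2.of_dvd hk)
      simpa using this
    funext j
    rw [Finset.sum_apply, Finset.sum_eq_single (⟨β, h⟩ : RNonzero r)]
    · rw [Pi.mulSingle_eq_same, Pi.smul_apply, nsmul_eq_mul, hg1 _ (hr j), one_mul]
    · intro α _ hα
      rw [Pi.mulSingle_eq_of_ne hα, Units.val_one, Pi.smul_apply, nsmul_eq_mul,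
        (h1 (r j)).resolve_right (not_not.2 (hr j)), zero_mul]
    · simp
  · refine ⟨1, ?_⟩
    rw [map_one, ← Multiplicative.toAdd.injective.eq_iff, ← hβ]
    push Not at h
    funext j
    simp [toGroup, h j]

theorem natCard_group : Nat.card ((j : Fin n) → ZMod (r j)) = groupOrder r := by
  rw [Nat.card_pi, groupOrder]
  simp

/-- All fibres of a surjective homomorphism have the same size, and the translate of `H` by `y`
consists of `|H|` fibres. -/
theorem card_valueHom_coset [∀ j, NeZero (r j)] {g : Fˣ}
    (hg : ∀ u : Fˣ, u ∈ Submonoid.powers g) (hr : ∀ j, r j ∣ Fintype.card F - 1)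
    (y : (j : Fin n) → ZMod (r j)) (H : AddSubgroup ((j : Fin n) → ZMod (r j))) :
    (univ.filter fun v : RNonzero r → Fˣ =>
        toGroup r (expVec g fun α => (v α : F)) - y ∈ H).card * groupOrder r =
      Nat.card H * (Fintype.card F - 1) ^ Fintype.card (RNonzero r) := by
  set Λ := valueHom (r := r) hg hr
  have hsurj := valueHom_surjective (r := r) hg hr
  have hfib : ∀ z : Multiplicative ((j : Fin n) → ZMod (r j)),
      (univ.filter fun v => Λ v = z).card = (univ.filter fun v => Λ v = 1).card := fun z =>
    MonoidHom.card_fiber_eq_of_mem_range Λ (hsurj z) (hsurj 1)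
  have htot : Fintype.card (RNonzero r → Fˣ) =
      groupOrder r * (univ.filter fun v => Λ v = 1).card := by
    rw [← Finset.card_univ, Finset.card_eq_sum_card_fiberwise (f := Λ) (t := univ)
      (fun _ _ => Finset.mem_coe.2 (mem_univ _)), Finset.sum_congr rfl fun z _ => hfib z,
      Finset.sum_const, smul_eq_mul, Finset.card_univ, ← natCard_group,
      ← Nat.card_eq_fintype_card, Nat.card_congr Multiplicative.toAdd]
  have hcos : (univ.filter fun v : RNonzero r → Fˣ =>
      toGroup r (expVec g fun α => (v α : F)) - y ∈ H).card =
      Nat.card H * (univ.filter fun v => Λ v = 1).card := by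
    rw [Finset.card_eq_sum_card_fiberwise (f := Λ)
      (t := univ.filter fun z => z.toAdd - y ∈ H)]
    · rw [Finset.sum_congr rfl (g := fun _ => (univ.filter fun v => Λ v = 1).card)]
      · rw [Finset.sum_const, smul_eq_mul]
        congr 1
        rw [Nat.card_eq_fintype_card, ← Finset.card_univ]
        refine Finset.card_bij' (fun z hz => ⟨z.toAdd - y, (mem_filter.1 hz).2⟩)
          (fun h _ => Multiplicative.ofAdd (h.1 + y)) ?_ ?_ ?_ ?_
        · intro z _; exact mem_univ _
        · intro h _; rw [mem_filter]; simp
        · intro z _; simp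
        · intro h _; simp
      · intro z hz
        rw [← hfib z, Finset.filter_filter]
        congr 1
        refine Finset.filter_congr fun v _ => ?_
        refine ⟨fun h => h.2, fun h => ⟨?_, h⟩⟩
        rw [← valueHom_apply hg hr]
        rw [mem_filter, ← h] at hz
        exact hz.2
    · intro v hv
      rw [Finset.mem_coe, mem_filter] at hv ⊢
      exact ⟨mem_univ _, hv.2⟩
  rw [hcos, mul_assoc, mul_comm _ (groupOrder r), ← htot]
  simp [Fintype.card_units]

/-- Start from all unit tuples and set the entry at `γ` to zero. This moves the group element by a
multiple of `γ`, so the coset condition is unaffected, and the forgotten unit is free. The exponent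
`Fintype.card {α // α.1 = γ}` is `1` or `0`, so `γ = 0` needs no separate treatment. -/
theorem card_zero_pattern_coset [∀ j, NeZero (r j)] {g : Fˣ}
    (hg : ∀ u : Fˣ, u ∈ Submonoid.powers g) (hr : ∀ j, r j ∣ Fintype.card F - 1)
    (y : (j : Fin n) → ZMod (r j)) (γ : RFull r) :
    (univ.filter fun a : RNonzero r → F => (∀ α, a α = 0 ↔ α.1 = γ) ∧
        toGroup r (expVec g a) - y ∈ AddSubgroup.zmultiples (vecElt γ)).card *
        (Fintype.card F - 1) ^ Fintype.card {α : RNonzero r // α.1 = γ} * groupOrder r =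
      ramIndex γ * (Fintype.card F - 1) ^ Fintype.card (RNonzero r) := by
  have hr0 : ∀ j, 0 < r j := fun j => Nat.pos_of_ne_zero (NeZero.ne _)
  have h := card_valueHom_coset hg hr y (AddSubgroup.zmultiples (vecElt γ))
  rw [Nat.card_zmultiples, addOrderOf_vecElt hr0] at h
  rw [← h]
  congr 1
  have hcard : Fintype.card ({α : RNonzero r // α.1 = γ} → Fˣ) =
      (Fintype.card F - 1) ^ Fintype.card {α : RNonzero r // α.1 = γ} := by
    simp [Fintype.card_units]
  rw [← hcard, ← Finset.card_univ, ← Finset.card_product]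
  symm
  have hdiff : ∀ v : RNonzero r → Fˣ, toGroup r (expVec g fun α => (v α : F)) -
      toGroup r (expVec g fun α => if α.1 = γ then 0 else (v α : F)) ∈
        AddSubgroup.zmultiples (vecElt γ) := by
    intro v
    rw [toGroup_expVec, toGroup_expVec, ← Finset.sum_sub_distrib]
    refine AddSubgroup.sum_mem _ fun α _ => ?_
    split_ifs with hα
    · rw [hα]
      exact AddSubgroup.sub_mem _ (AddSubgroup.nsmul_mem _ (AddSubgroup.mem_zmultiples _) _)
        (AddSubgroup.nsmul_mem _ (AddSubgroup.mem_zmultiples _) _)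
    · rw [sub_self]
      exact AddSubgroup.zero_mem _
  have hmem : ∀ v : RNonzero r → Fˣ,
      (toGroup r (expVec g fun α => (v α : F)) - y ∈ AddSubgroup.zmultiples (vecElt γ)) ↔
      toGroup r (expVec g fun α => if α.1 = γ then 0 else (v α : F)) - y ∈
        AddSubgroup.zmultiples (vecElt γ) := by
    intro v
    have h1 := AddSubgroup.add_mem_cancel_left (AddSubgroup.zmultiples (vecElt γ)) (hdiff v)
      (y := toGroup r (expVec g fun α => if α.1 = γ then 0 else (v α : F)) - y)
    rw [← h1]
    congr! 1
    abel
  refine Finset.card_bij (fun v _ => (fun α => if α.1 = γ then 0 else (v α : F),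
    fun α => v α.1)) ?_ ?_ ?_
  · intro v hv
    rw [mem_filter] at hv
    rw [mem_product, mem_filter]
    refine ⟨⟨mem_univ _, fun α => ?_, (hmem v).1 hv.2⟩, mem_univ _⟩
    by_cases hα : α.1 = γ <;> simp [hα]
  · intro u _ v _ huv
    rw [Prod.mk.injEq] at huv
    funext α
    by_cases hα : α.1 = γ
    · exact congrFun huv.2 ⟨α, hα⟩
    · have := congrFun huv.1 α
      simp only [hα, if_false] at this
      exact Units.ext this
  · rintro ⟨a, t⟩ hat
    rw [mem_product, mem_filter] at hat
    obtain ⟨⟨_, ha, hy⟩, _⟩ := hat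
    change ∀ α, a α = 0 ↔ α.1 = γ at ha
    let v : RNonzero r → Fˣ := fun α =>
      if hα : α.1 = γ then t ⟨α, hα⟩ else Units.mk0 (a α) fun h0 => hα ((ha α).1 h0)
    have hva : (fun α => if α.1 = γ then 0 else (v α : F)) = a := by
      funext α
      by_cases hα : α.1 = γ
      · simp only [hα, if_true]; exact ((ha α).2 hα).symm
      · simp [v, hα]
    refine ⟨v, ?_, ?_⟩
    · rw [mem_filter, hmem, hva]
      exact ⟨mem_univ _, hy⟩
    · rw [Prod.mk.injEq]
      refine ⟨hva, funext fun α => ?_⟩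
      simp [v, α.2]

theorem card_zero_pattern_charValue [∀ j, NeZero (r j)] {g : Fˣ}
    (hg : ∀ u : Fˣ, u ∈ Submonoid.powers g) (hr : ∀ j, r j ∣ Fintype.card F - 1)
    {χ : ℕ → MulChar F ℂ} (hχ : HasOrders r χ) {ε : PairIndex r → ℂ}
    {β : RFull r} {h : Fin n → ℕ} (hε : HasStandardForm χ g ε β h)
    {B : (RNonzero r → F) → Prop} (hB : ∀ a, B a ↔ ∀ p, charValue χ a p = ε p) (γ : RFull r) :
    (univ.filter fun a : RNonzero r → F => (∀ α, a α = 0 ↔ α.1 = γ) ∧ B a).card *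
        (Fintype.card F - 1) ^ Fintype.card {α : RNonzero r // α.1 = γ} * groupOrder r =
      if zeroSumPairs γ = zeroSumPairs β then
        ramIndex γ * (Fintype.card F - 1) ^ Fintype.card (RNonzero r) else 0 := by
  split_ifs with hγβ
  · rw [← card_zero_pattern_coset hg hr (toGroup r h) γ]
    congr 3
    refine Finset.filter_congr fun a _ => and_congr_right fun ha => ?_
    rw [hB, charValue_eq_iff hg hχ hε ha]
    simp only [hγβ, true_and]
  · rw [Finset.card_eq_zero.2, zero_mul, zero_mul]
    refine Finset.filter_eq_empty_iff.2 fun a _ h1 => hγβ ?_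
    exact ((charValue_eq_iff hg hχ hε h1.1).1 ((hB a).1 h1.2)).1

theorem exists_ne_zero_iff (hr : ∀ j, 0 < r j) (β : RFull r) :
    (∃ j, (β j : ℕ) ≠ 0) ↔ β ≠ zeroVec r hr := by
  rw [ne_eq, funext_iff, not_forall]
  exact exists_congr fun j => by rw [Fin.ext_iff]; rfl

theorem card_RNonzero (hr : ∀ j, 0 < r j) : Fintype.card (RNonzero r) = groupOrder r - 1 := by
  have h : Fintype.card (RFull r) = groupOrder r := by simp [RFull, groupOrder]
  rw [Fintype.card_subtype, ← h, ← Finset.card_univ,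
    ← Finset.card_erase_of_mem (mem_univ (zeroVec r hr))]
  congr 1
  ext β
  rw [mem_filter, mem_erase, exists_ne_zero_iff hr]
  simp

theorem zeroSumPairs_eq_zeroVec_iff (hr : ∀ j, 0 < r j) (β : RFull r) :
    zeroSumPairs β = zeroSumPairs (zeroVec r hr) ↔ β = zeroVec r hr := by
  refine ⟨fun h => ?_, fun h => by rw [h]⟩
  funext j
  have h1 := (dvd_iff_of_rel h hr j dvd_rfl).2 (dvd_zero _)
  exact Fin.ext (Nat.eq_zero_of_dvd_of_lt h1 (β j).2)

theorem ramIndex_zeroVec (hr : ∀ j, 0 < r j) : ramIndex (zeroVec r hr) = 1 := by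
  have : ∀ j, r j / Nat.gcd (r j) (zeroVec r hr j) = 1 := fun j => by
    simp [zeroVec, Nat.div_self (hr j)]
  refine Nat.dvd_one.1 (Finset.lcm_dvd fun j _ => ?_)
  rw [this j]

/-- The factor of the main term that belongs to a class. -/
def classFactor (F : Type*) [Field F] [Fintype F] (hr : ∀ j, 0 < r j) (b : RClass r) : ℝ :=
  if b = Quotient.mk _ (zeroVec r hr) then
    (Fintype.card F : ℝ) / (groupOrder r * (Fintype.card F + groupOrder r - 1))
  else (Nat.totient (classRamIndex b ^ 2) : ℝ)
    / (groupOrder r * (Fintype.card F + groupOrder r - 1))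

/-- Only patterns `γ` with `A_γ = A_β` contribute. For `β = 0` this is the pattern without zeros, of
weight `q ^ m` per vector. Otherwise there are `φ(e)` positions, each with `e (q - 1) ^ (m - 1) /
|G|` vectors of weight `(q - 1) q ^ (m - 1)`. Division by `valueWeight_true` gives the factor. -/
theorem valueWeight_charValue [∀ j, NeZero (r j)] (hr0 : ∀ j, 0 < r j) (hG : 1 < groupOrder r)
    {g : Fˣ} (hg : ∀ u : Fˣ, u ∈ Submonoid.powers g) (hr : ∀ j, r j ∣ Fintype.card F - 1)
    {χ : ℕ → MulChar F ℂ} (hχ : HasOrders r χ) {ε : PairIndex r → ℂ}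
    {β : RFull r} {h : Fin n → ℕ} (hε : HasStandardForm χ g ε β h)
    {B : (RNonzero r → F) → Prop} (hB : ∀ a, B a ↔ ∀ p, charValue χ a p = ε p) :
    valueWeight B / valueWeight (fun _ : RNonzero r → F => True) = classFactor F hr0 (Quotient.mk _ β) := by
  have hq := one_lt_card_real F
  have hq1 : (0 : ℝ) < (Fintype.card F : ℝ) - 1 := sub_pos.2 hq
  have hm := card_RNonzero (r := r) hr0
  have hne : Nonempty (RNonzero r) := Fintype.card_pos_iff.1 (by omega)
  obtain ⟨k, hk⟩ : ∃ k, groupOrder r = k + 2 := ⟨groupOrder r - 2, by omega⟩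
  have hm' : Fintype.card (RNonzero r) = k + 1 := by omega
  have hGk : (groupOrder r : ℝ) = k + 2 := by rw [hk]; push_cast; rfl
  have hcast : ((Fintype.card F - 1 : ℕ) : ℝ) = (Fintype.card F : ℝ) - 1 := by
    rw [Nat.cast_sub Fintype.card_pos, Nat.cast_one]
  have hn0 : ((univ.filter fun a : RNonzero r → F => (∀ α, a α ≠ 0) ∧ B a).card : ℝ) * (k + 2) =
      if β = zeroVec r hr0 then ((Fintype.card F : ℝ) - 1) ^ (k + 1) else 0 := by
    have h1 := card_zero_pattern_charValue hg hr hχ hε hB (zeroVec r hr0)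
    have hempty : Fintype.card {α : RNonzero r // α.1 = zeroVec r hr0} = 0 := by
      rw [Fintype.card_eq_zero_iff]
      exact ⟨fun α => (exists_ne_zero_iff hr0 _).1 α.1.2 α.2⟩
    have hpat : ∀ a : RNonzero r → F,
        (∀ α, a α = 0 ↔ α.1 = zeroVec r hr0) ↔ ∀ α, a α ≠ 0 := fun a =>
      forall_congr' fun α => by
        have := (exists_ne_zero_iff hr0 _).1 α.2
        simp [this]
    simp only [hpat] at h1
    rw [hempty, pow_zero, mul_one, ramIndex_zeroVec, one_mul, hm'] at h1
    simp only [eq_comm (a := zeroSumPairs (zeroVec r hr0)), zeroSumPairs_eq_zeroVec_iff] at h1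
    have h2 := congrArg (Nat.cast : ℕ → ℝ) h1
    rw [Nat.cast_mul, hGk] at h2
    rw [h2]
    split_ifs
    · rw [Nat.cast_pow, hcast]
    · simp
  have hn1 : ∀ γ : RNonzero r, ((univ.filter fun a : RNonzero r → F =>
      (a γ = 0 ∧ ∀ α, α ≠ γ → a α ≠ 0) ∧ B a).card : ℝ) * (k + 2) =
      if zeroSumPairs γ.1 = zeroSumPairs β then
        ramIndex β * ((Fintype.card F : ℝ) - 1) ^ k else 0 := by
    intro γ
    have h1 := card_zero_pattern_charValue hg hr hχ hε hB γ.1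
    have hone : Fintype.card {α : RNonzero r // α.1 = γ.1} = 1 := by
      rw [Fintype.card_eq_one_iff]
      exact ⟨⟨γ, rfl⟩, fun α => Subtype.ext (Subtype.ext α.2)⟩
    have hpat : ∀ a : RNonzero r → F, (∀ α, a α = 0 ↔ α.1 = γ.1) ↔
        (a γ = 0 ∧ ∀ α, α ≠ γ → a α ≠ 0) := by
      intro a
      constructor
      · exact fun h => ⟨(h γ).2 rfl, fun α hα h0 => hα (Subtype.ext ((h α).1 h0))⟩
      · rintro ⟨h1, h2⟩ α
        refine ⟨fun h0 => ?_, fun hα => by rw [Subtype.ext hα, h1]⟩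
        by_contra hα
        exact h2 α (fun h => hα (congrArg Subtype.val h)) h0
    simp only [hpat] at h1
    rw [hone, pow_one, hm'] at h1
    have h2 := congrArg (Nat.cast : ℕ → ℝ) h1
    rw [Nat.cast_mul, Nat.cast_mul, hGk, hcast] at h2
    -- The pattern count includes the `q - 1` choices of the forgotten unit at `γ`, which are
    -- divided out here.
    have h3 : ∀ c : ℝ, c * (k + 2) = c * ((Fintype.card F : ℝ) - 1) * (k + 2) /
        ((Fintype.card F : ℝ) - 1) := fun c => by field_simp
    rw [h3, h2]
    split_ifs with hγβ
    · rw [Nat.cast_mul, Nat.cast_pow, hcast, ramIndex_eq_of_rel (show γ.1 ≈ β from hγβ), pow_succ]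
      field_simp
    · simp
  have hk2 : (0 : ℝ) < (k : ℝ) + 2 := by positivity
  have hW : valueWeight B * (k + 2) =
      (if β = zeroVec r hr0 then ((Fintype.card F : ℝ) - 1) ^ (k + 1) else 0)
        * (Fintype.card F : ℝ) ^ (k + 1) +
      ∑ γ : RNonzero r, (if zeroSumPairs γ.1 = zeroSumPairs β then
        ramIndex β * ((Fintype.card F : ℝ) - 1) ^ k else 0) *
          (((Fintype.card F : ℝ) - 1) * (Fintype.card F : ℝ) ^ k) := by
    rw [valueWeight, add_mul, Finset.sum_mul, hm', Nat.add_sub_cancel]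
    congr 1
    · rw [← hn0]; ring
    · refine Finset.sum_congr rfl fun γ _ => ?_
      rw [← hn1 γ]; ring
  have hW' : valueWeight B =
      ((if β = zeroVec r hr0 then ((Fintype.card F : ℝ) - 1) ^ (k + 1) else 0)
        * (Fintype.card F : ℝ) ^ (k + 1) +
      ∑ γ : RNonzero r, (if zeroSumPairs γ.1 = zeroSumPairs β then
        ramIndex β * ((Fintype.card F : ℝ) - 1) ^ k else 0) *
          (((Fintype.card F : ℝ) - 1) * (Fintype.card F : ℝ) ^ k)) / (k + 2) :=
    (eq_div_iff hk2.ne').2 hW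
  have hclass : (Quotient.mk (relSetoid r) β = Quotient.mk _ (zeroVec r hr0)) ↔
      β = zeroVec r hr0 := by
    rw [Quotient.eq]
    exact zeroSumPairs_eq_zeroVec_iff hr0 β
  rw [hW', valueWeight_true, hm', Nat.add_sub_cancel, classFactor, hGk]
  simp only [hclass]
  have hden : (0 : ℝ) < Fintype.card F + (k + 2) - 1 := by
    have : (0 : ℝ) ≤ k := Nat.cast_nonneg k
    linarith
  have hden2 : (Fintype.card F : ℝ) + ((k + 1 : ℕ) : ℝ) = Fintype.card F + (k + 2) - 1 := by
    push_cast; ring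
  rw [hden2]
  split_ifs with hβ
  · rw [Finset.sum_eq_zero, add_zero]
    · rw [pow_succ (Fintype.card F : ℝ) k]
      field_simp
    · intro γ _
      rw [hβ, if_neg, zero_mul]
      rw [zeroSumPairs_eq_zeroVec_iff]
      exact (exists_ne_zero_iff hr0 _).1 γ.2
  · have hcount : ∑ γ : RNonzero r, (if zeroSumPairs γ.1 = zeroSumPairs β then
        (ramIndex β : ℝ) * ((Fintype.card F : ℝ) - 1) ^ k else 0) =
        Nat.totient (ramIndex β ^ 2) * ((Fintype.card F : ℝ) - 1) ^ k := by
      rw [← Finset.sum_filter, Finset.sum_const, nsmul_eq_mul, totient_sq, ← card_class β]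
      have hc : (univ.filter fun γ : RNonzero r => zeroSumPairs γ.1 = zeroSumPairs β).card =
          (univ.filter fun γ : RFull r => zeroSumPairs γ = zeroSumPairs β).card := by
        refine Finset.card_bij (fun γ _ => γ.1) ?_ (fun a _ b _ h => Subtype.ext h) ?_
        · intro γ hγ
          rw [mem_filter] at hγ ⊢
          exact ⟨mem_univ _, hγ.2⟩
        · intro γ hγ
          rw [mem_filter] at hγ
          refine ⟨⟨γ, (exists_ne_zero_iff hr0 _).2 ?_⟩, mem_filter.2 ⟨mem_univ _, hγ.2⟩, rfl⟩
          rintro rfl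
          exact hβ ((zeroSumPairs_eq_zeroVec_iff hr0 β).1 hγ.2.symm)
      rw [hc]
      push_cast
      ring
    rw [zero_mul, zero_add, ← Finset.sum_mul, hcount]
    have hcr : classRamIndex (Quotient.mk (relSetoid r) β) = ramIndex β := rfl
    rw [hcr, pow_succ ((Fintype.card F : ℝ) - 1) k]
    have hq0 := card_pos_real F
    field_simp

end FiberCounts

/-! ### Translation to the sieve and the main term -/

section MainTerm

open scoped Classical

/-- Squarefreeness and coprimality can be tested on irreducible polynomials, and normalizing makes
these monic. -/
theorem isGoodTuple_iff {F : Type*} [Field F] {n : ℕ} {r : Fin n → ℕ} (f : RNonzero r → F[X]) :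
    IsGoodTuple f ↔ (∀ α, (f α).Monic) ∧
      ∀ P : F[X], P.Monic → Irreducible P → GoodAt P f := by
  constructor
  · rintro ⟨h1, h2⟩
    refine ⟨fun α => (h1 α).1, fun P _ hP => ⟨fun α hd => ?_, fun α β hαβ hd => ?_⟩⟩
    · rw [pow_two] at hd
      exact hP.not_isUnit ((h1 α).2 P hd)
    · exact hP.not_isUnit ((h2 α β hαβ).isUnit_of_dvd' hd.1 hd.2)
  · rintro ⟨h1, h2⟩
    refine ⟨fun α => ⟨h1 α, ?_⟩, fun α β hαβ => ?_⟩
    · rw [squarefree_iff_irreducible_sq_not_dvd_of_ne_zero (h1 α).ne_zero]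
      intro P hP hd
      have hP0 := hP.ne_zero
      have hn : Irreducible (normalize P) := (normalize_associated P).symm.irreducible hP
      refine (h2 (normalize P) (monic_normalize hP0) hn).1 α ?_
      rw [pow_two, ← normalize_mul, normalize_dvd_iff]
      exact hd
    · refine isCoprime_of_irreducible_dvd (fun h => (h1 α).ne_zero h.1) fun P hP hα hβ => ?_
      have hn : Irreducible (normalize P) := (normalize_associated P).symm.irreducible hP
      refine (h2 (normalize P) (monic_normalize hP.ne_zero) hn).2 α β hαβ ?_
      rw [normalize_dvd_iff, normalize_dvd_iff]
      exact ⟨hα, hβ⟩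

variable {F : Type*} [Field F] [Fintype F] {n : ℕ} {r : Fin n → ℕ}

theorem valueSet_eq (χ : ℕ → MulChar F ℂ) (d : RNonzero r → ℕ) {k : ℕ} (x : Fin k → F)
    (ε : Fin k → PairIndex r → ℂ) :
    valueSet χ d x ε =
      sieveSet (fun y a => ∀ i, x i = y → ∀ p, charValue χ a p = ε i p) d := by
  ext f
  have h1 : ∀ p : PairIndex r, twistCoeff (1 : Fin n → Fˣ) p = 1 := fun p => by simp [twistCoeff]
  have hmem : (∀ α, f α ∈ monics F (d α)) ↔
      (∀ α, (f α).Monic) ∧ ∀ α, (f α).natDegree = d α := by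
    simp only [mem_monics, forall_and]
  rw [Finset.mem_coe, sieveSet, Finset.mem_filter, Fintype.mem_piFinset, hmem]
  simp only [valueSet, tuples, Set.mem_ofPred_eq, isGoodTuple_iff, eval_twistPoly, h1, one_mul,
    PointSieve, charValue]
  constructor
  · rintro ⟨⟨⟨hm, hg⟩, hd⟩, hv⟩
    exact ⟨⟨hm, hd⟩, hg, fun y i hi p => hi ▸ hv i p⟩
  · rintro ⟨⟨hm, hd⟩, hg, hv⟩
    exact ⟨⟨⟨hm, hg⟩, hd⟩, fun i p => hv (x i) i rfl p⟩

/-- Each prescription is admissible for exactly one class, so the product over classes with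
multiplicities regroups as a product over the points. -/
theorem mainTerm_eq (hr : ∀ j, 0 < r j) {χ : ℕ → MulChar F ℂ} {d : RNonzero r → ℕ} {k : ℕ}
    {ε : Fin k → PairIndex r → ℂ} {b : Fin k → RClass r}
    (hb : ∀ i c, IsClassAdmissible χ d (ε i) c ↔ c = b i) :
    mainTerm hr χ d ε = eulerL F (groupOrder r - 2) / zetaPoly F 2 ^ (groupOrder r - 1)
      * (Fintype.card F : ℝ) ^ (∑ α, d α) * ∏ i, classFactor F hr (b i) := by
  have hcount : ∀ c, classCount χ d ε c = (univ.filter fun i => b i = c).card := by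
    intro c
    rw [classCount, ← Set.ncard_coe_finset]
    congr 1
    ext i
    simp [hb, eq_comm]
  have hprod : ∏ i, classFactor F hr (b i) = ∏ c, classFactor F hr c ^ classCount χ d ε c := by
    rw [← Finset.prod_fiberwise univ b]
    refine Finset.prod_congr rfl fun c _ => ?_
    rw [hcount, ← Finset.prod_const]
    exact Finset.prod_congr rfl fun i hi => by rw [(mem_filter.1 hi).2]
  rw [mainTerm, hprod, ← Finset.prod_erase_mul univ _ (mem_univ (Quotient.mk _ (zeroVec r hr))),
    ← mul_assoc]
  congr 1
  · congr 1
    · ring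
    · refine Finset.prod_congr (by congr!) fun c hc => ?_
      rw [classFactor, if_neg (Finset.ne_of_mem_erase hc)]
  · rw [classFactor, if_pos rfl]

/-- A lower bound uniform in the class, needed to compare the error with the main term; both
numerators are at least `1`. -/
theorem classFactor_ge (hr : ∀ j, 0 < r j) (hG : 1 < groupOrder r) (c : RClass r) :
    1 / (groupOrder r * ((Fintype.card F : ℝ) + groupOrder r - 1)) ≤ classFactor F hr c := by
  have hq := one_lt_card_real F
  have hG' : (1 : ℝ) < groupOrder r := by exact_mod_cast hG
  have hden : (0 : ℝ) < groupOrder r * ((Fintype.card F : ℝ) + groupOrder r - 1) :=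
    mul_pos (by linarith) (by linarith)
  rw [classFactor]
  split_ifs
  · gcongr
  · gcongr
    norm_cast
    rw [Nat.succ_le_iff, Nat.totient_pos]
    refine pow_pos ?_ 2
    induction c using Quotient.inductionOn with
    | h β =>
      refine Nat.pos_of_ne_zero fun h0 => ?_
      change ramIndex β = 0 at h0
      rw [ramIndex, Finset.lcm_eq_zero_iff] at h0
      obtain ⟨j, _, hj⟩ := h0
      exact (Nat.div_pos (Nat.gcd_le_left _ (hr j)) (Nat.gcd_pos_of_pos_left _ (hr j))).ne' hj

theorem invSqrt_pow (F : Type*) [Field F] [Fintype F] (N : ℕ) :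
    invSqrt F ^ N = (Fintype.card F : ℝ) ^ (-(N : ℝ) / 2) := by
  have hq := card_pos_real F
  rw [invSqrt, Real.sqrt_eq_rpow, ← Real.rpow_neg hq.le, ← Real.rpow_natCast,
    ← Real.rpow_mul hq.le]
  congr 1
  ring

end MainTerm

end

end AbelianCovers

/-! ### The proposition -/

theorem proposition5p3 {F : Type*} [Field F] [Fintype F] {n : ℕ} (r : Fin (n + 1) → ℕ)
    (hr : ∀ j, 0 < r j) (hdvd : ∀ i j, i ≤ j → r i ∣ r j) (hG : 1 < groupOrder r)
    (hq : Fintype.card F ≡ 1 [MOD r (Fin.last n)]) :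
    ∃ K : ℝ, ∀ χ : ℕ → MulChar F ℂ, (∀ m, m ∣ r (Fin.last n) → orderOf (χ m) = m) →
      ∀ (k : ℕ) (x : Fin k → F), Function.Injective x →
      ∀ (d : RNonzero r → ℕ) (ε : Fin k → PairIndex r → ℂ),
        (∀ i, IsAdmissible χ d (ε i)) →
        |((valueSet χ d x ε).ncard : ℝ) - mainTerm hr χ d ε|
          ≤ K * mainTerm hr χ d ε
              * (Fintype.card F : ℝ) ^ (-((⨅ α, d α : ℕ) : ℝ) / 2) := by
  classical
  have hne : ∀ j, NeZero (r j) := fun j => ⟨(hr j).ne'⟩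
  have hL : ∀ j, r j ∣ r (Fin.last n) := fun j => hdvd j _ (Fin.le_last j)
  have hrq : ∀ j, r j ∣ Fintype.card F - 1 := fun j =>
    (hL j).trans ((Nat.modEq_iff_dvd' Fintype.card_pos).1 hq.symm)
  obtain ⟨g, hg⟩ := IsCyclic.exists_monoid_generator (α := Fˣ)
  have hcard := card_RNonzero hr
  have hnonempty : Nonempty (RNonzero r) := Fintype.card_pos_iff.1 (by omega)
  have hq0 := card_pos_real F
  have hq1 := one_lt_card_real F
  have hs := invSqrt_pos F
  have hs1 := invSqrt_lt_one F
  have hG' : (1 : ℝ) < groupOrder r := by exact_mod_cast hG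
  set m := Fintype.card (RNonzero r) with hm
  set c₀ := eulerL F (m - 1) / zetaPoly F 2 ^ m with hc₀
  have hc₀pos : 0 < c₀ := div_pos (eulerL_pos _) (pow_pos zetaPoly_two_pos _)
  set t := 1 / (groupOrder r * ((Fintype.card F : ℝ) + groupOrder r - 1)) with ht
  have hden : (1 : ℝ) ≤ groupOrder r * ((Fintype.card F : ℝ) + groupOrder r - 1) := by
    nlinarith
  have ht0 : 0 < t := one_div_pos.2 (by linarith)
  have ht1 : t ≤ 1 := (div_le_one (by linarith)).2 hden
  set K₀ := (m : ℝ) * (incrementConst F m * (1 - invSqrt F)⁻¹) with hK₀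
  have hK₀0 : 0 ≤ K₀ := mul_nonneg (Nat.cast_nonneg _)
    (mul_nonneg (incrementConst_nonneg _) (inv_nonneg.2 (sub_nonneg.2 hs1.le)))
  -- The sieve gives an absolute error `K₀ * invSqrt F ^ N` for the density. The limiting density is
  -- `c₀` times at most `q` factors, each at least `t`, with `t ≤ 1`; dividing by `c₀ * t ^ q` makes
  -- the error relative, with a constant chosen before the characters, points, degrees and
  -- prescriptions.
  refine ⟨K₀ / (c₀ * t ^ Fintype.card F), fun χ hχ k x hx d ε hε => ?_⟩
  have hord : HasOrders r χ := fun p => hχ _ (ell_dvd hL p)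
  choose β h hβ using fun i => (hε i).hasStandardForm hg hord
  set A : F → (RNonzero r → F) → Prop :=
    fun y a => ∀ i, x i = y → ∀ p, charValue χ a p = ε i p with hA
  have hmain := mainTerm_eq hr (fun i => (hβ i).isClassAdmissible_iff (hε i))
  rw [show groupOrder r - 1 = m by omega, show groupOrder r - 2 = m - 1 by omega, ← hc₀] at hmain
  have hW : valueWeight (fun _ : RNonzero r → F => True) ≠ 0 := by
    rw [valueWeight_true]
    have : (0 : ℝ) < (Fintype.card F : ℝ) - 1 := sub_pos.2 hq1
    positivity
  -- Points of `F` outside the image of `x` carry a vacuous condition and contribute the ratio `1`;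
  -- injectivity of `x` leaves one prescription at each remaining point.
  have hprod : ∏ y, valueWeight (A y) / valueWeight (fun _ : RNonzero r → F => True) =
      ∏ i, classFactor F hr (Quotient.mk _ (β i)) := by
    symm
    refine Fintype.prod_of_injective x hx _ _ (fun y hy => ?_) fun i => ?_
    · have : A y = fun _ => True := by
        funext a
        rw [eq_iff_iff, iff_true]
        exact fun i hi => absurd ⟨i, hi⟩ hy
      rw [this, div_self hW]
    · refine (valueWeight_charValue hr hG hg hrq hord (hβ i) fun a => ?_).symm
      exact ⟨fun ha => ha i rfl, fun ha i' hi' => by rw [hx hi']; exact ha⟩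
  have hlim := tendsto_prod_localDensity A
  rw [hprod] at hlim
  have hfinal := abs_sieveDensity_sub_limit_le hlim (d := d) (N := ⨅ α, d α)
    fun α => ciInf_le (OrderBot.bddBelow _) α
  rw [← hm, ← hc₀, ← hK₀, sieveDensity] at hfinal
  set p := ∏ i, classFactor F hr (Quotient.mk _ (β i)) with hp
  have hpt : t ^ Fintype.card F ≤ p := by
    have hk : k ≤ Fintype.card F := by
      simpa using Fintype.card_le_of_injective x hx
    calc t ^ Fintype.card F ≤ t ^ k := pow_le_pow_of_le_one ht0.le ht1 hk
      _ = ∏ _i : Fin k, t := by simp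
      _ ≤ p := Finset.prod_le_prod (fun _ _ => ht0.le) fun i _ => classFactor_ge hr hG _
  have hX : (0 : ℝ) < (Fintype.card F : ℝ) ^ ∑ α, d α := by positivity
  rw [← invSqrt_pow, hmain, valueSet_eq, Set.ncard_coe_finset]
  have hmul : ((sieveSet A d).card : ℝ) - c₀ * (Fintype.card F : ℝ) ^ (∑ α, d α) * p =
      (((sieveSet A d).card : ℝ) / (Fintype.card F : ℝ) ^ (∑ α, d α) - c₀ * p) *
        (Fintype.card F : ℝ) ^ (∑ α, d α) := by
    field_simp
  rw [hmul, abs_mul, abs_of_pos hX]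
  calc _ ≤ K₀ * invSqrt F ^ (⨅ α, d α) * (Fintype.card F : ℝ) ^ (∑ α, d α) := by gcongr
    _ = K₀ / (c₀ * t ^ Fintype.card F) * (c₀ * (Fintype.card F : ℝ) ^ (∑ α, d α) *
          t ^ Fintype.card F) * invSqrt F ^ (⨅ α, d α) := by
        field_simp
    _ ≤ _ := by gcongr
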